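/- **Disjoint Paths.** The input is a finite graph $G$ together with $k\ge 0$ pairwise disjoint terminal pairs $(s_1,t_1),\dots,(s_k,t_k)$ of vertices of $G$ (that is, $\{s_i,t_i\}\cap\{s_j,t_j\}=\emptyset$ for $i\ne j$). The question is whether $G$ has pairwise vertex-disjoint paths $P^1,\dots,P^k$ such that $P^i$ is a path from $s_i$ to $t_i$ for every $i$; if so, the input is a yes-instance. A graph is *cobipartite* if it is the complement of a bipartite graph, i.e. if its vertex set can be partitioned into two (possibly empty) cliques. **Theorem.** (1) Disjoint Paths, with $k$ part of the input, is solvable in polynomial time on cobipartite graphs: there are a program for a random access machine (unit-cost steps, addition and truncated subtraction as the only arithmetic) and a polynomial $p$ such that, on every instance $(G,(s_1,t_1),\dots,(s_k,t_k))$ with $G$ a cobipartite graph on $\{0,\dots,n-1\}$, given as the list of the numbers $n$, $k$, $s_1,\dots,s_k$, $t_1,\dots,t_k$ and the $n^2$ entries of the adjacency matrix of $G$, the program halts after at most $p(2+2k+n^2)$ steps and decides correctly whether it is a yes-instance. (2) Let $(G,(s_1,t_1),\dots,(s_k,t_k))$ be an instance in which $V(G)$ is partitioned into two cliques $A$ and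 $B$, and $s_i\neq t_i$ for all $i$. (a) Delete from $G$ both vertices of every terminal pair with $s_it_i\in E(G)$, and delete these pairs from the list of pairs. The resulting instance is a yes-instance if and only if the original one is. (b) Suppose that $s_it_i\notin E(G)$ for all $i$. Let $G'$ be the graph obtained from $G$ by removing all edges with both ends in $A$, all edges with both ends in $B$, and all edges between two terminals. Let $G''$ be the graph obtained from $G'$ by deleting all terminals and adding, for each $i$, a new vertex $x_i$ whose neighbours are those remaining vertices that are adjacent in $G'$ to $s_i$ or to $t_i$. Then $G'$ is bipartite, and $(G,(s_1,t_1),\dots,(s_k,t_k))$ is a yes-instance if and only if $G''$ has a matching with at least $k$ edges. -/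

import Mathlib

/-! ### Random access machines

A machine has registers and a memory, both indexed by `ℕ` and holding natural numbers.  Every
instruction takes one time step.  The only arithmetic is addition and truncated subtraction, so that
the numbers written in `t` steps have `O(t)` more bits than those of the input and the program, and
polynomial time on this machine is polynomial time on a Turing machine. -/

namespace RAM

/-- Instructions. Here `r`, `a`, `b` are register numbers, `c` is a constant and `l` is a position
in the program. -/
inductive Instr where
  /-- `R[r] := c` -/
  | const (r c : ℕ)
  /-- `R[r] := R[a] + R[b]` -/
  | add (r a b : ℕ)
  /-- `R[r] := max (R[a] - R[b], 0)` -/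
  | sub (r a b : ℕ)
  /-- `R[r] := M[R[a]]` -/
  | load (r a : ℕ)
  /-- `M[R[a]] := R[r]` -/
  | store (a r : ℕ)
  /-- if `R[r] = 0`, go to position `l` -/
  | jumpZero (r l : ℕ)

/-- A program is a finite list of instructions, at positions `0, 1, 2, …`. -/
abbrev Program := List Instr

/-- A configuration: the program counter, the registers and the memory. -/
structure Config where
  pc : ℕ
  reg : ℕ → ℕ
  mem : ℕ → ℕ

/-- The effect of one instruction. -/
def Instr.exec (c : Config) : Instr → Config
  | .const r x => ⟨c.pc + 1, Function.update c.reg r x, c.mem⟩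
  | .add r a b => ⟨c.pc + 1, Function.update c.reg r (c.reg a + c.reg b), c.mem⟩
  | .sub r a b => ⟨c.pc + 1, Function.update c.reg r (c.reg a - c.reg b), c.mem⟩
  | .load r a => ⟨c.pc + 1, Function.update c.reg r (c.mem (c.reg a)), c.mem⟩
  | .store a r => ⟨c.pc + 1, c.reg, Function.update c.mem (c.reg a) (c.reg r)⟩
  | .jumpZero r l => ⟨if c.reg r = 0 then l else c.pc + 1, c.reg, c.mem⟩

/-- The machine has halted when the program counter points outside the program. -/
def Halted (P : Program) (c : Config) : Prop := P.length ≤ c.pc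

/-- One time step; a halted machine does not change any more. -/
def step (P : Program) (c : Config) : Config :=
  match P[c.pc]? with
  | some i => i.exec c
  | none => c

/-- The configuration after `t` time steps. -/
def run (P : Program) (t : ℕ) (c : Config) : Config := (step P)^[t] c

/-- The initial configuration on the input `w`: the input stands in the memory cells
`0, …, w.length - 1`, its length stands in register `0`, and all else is `0`. -/
def init (w : List ℕ) : Config where
  pc := 0
  reg := fun r => if r = 0 then w.length else 0
  mem := fun a => w.getD a 0

/-- The decision problem `Q`, restricted to the instances in the class `C`, is solvable in polynomial
time, where instances are presented to the machine through `enc`: a single program halts on every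
instance `x` in `C` within a number of steps that is polynomial in the length of the input, with
`1` in register `0` if `x` is a yes-instance and with `0` in register `0` if it is a no-instance. -/
def PolyTimeSolvableOn {α : Type} (enc : α → List ℕ) (C Q : α → Prop) : Prop :=
  ∃ (P : Program) (p : Polynomial ℕ), ∀ x : α, C x →
    ∃ t ≤ p.eval (enc x).length, Halted P (run P t (init (enc x))) ∧
      (Q x → (run P t (init (enc x))).reg 0 = 1) ∧
      (¬ Q x → (run P t (init (enc x))).reg 0 = 0)

end RAM

/-- A graph is cobipartite if it is the complement of a bipartite graph. -/
def SimpleGraph.IsCobipartite {V : Type*} (G : SimpleGraph V) : Prop := Gᶜ.IsBipartite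

/-- An instance of Disjoint Paths: a graph on `V` with pairwise disjoint terminal pairs
`(s i, t i)`, `i ∈ ι`. -/
structure DisjointPathsInstance (V ι : Type*) where
  G : SimpleGraph V
  s : ι → V
  t : ι → V
  disjoint : ∀ i j, i ≠ j → Disjoint ({s i, t i} : Set V) {s j, t j}

namespace DisjointPathsInstance

variable {V ι : Type*}

/-- Yes-instances: there are pairwise vertex-disjoint paths, the `i`-th one from `s i` to `t i`. -/
def IsYes (I : DisjointPathsInstance V ι) : Prop :=
  ∃ P : ∀ i, I.G.Walk (I.s i) (I.t i), (∀ i, (P i).IsPath) ∧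
    ∀ i j, i ≠ j → List.Disjoint (P i).support (P j).support

/-- The vertices that do not belong to an adjacent terminal pair. -/
def keptVertices (I : DisjointPathsInstance V ι) : Set V :=
  {v | ∀ i, I.G.Adj (I.s i) (I.t i) → v ≠ I.s i ∧ v ≠ I.t i}

/-- The terminals of a nonadjacent pair belong to no adjacent pair. -/
theorem mem_keptVertices (I : DisjointPathsInstance V ι) {i : ι}
    (hi : ¬ I.G.Adj (I.s i) (I.t i)) : I.s i ∈ I.keptVertices ∧ I.t i ∈ I.keptVertices := by
  have key : ∀ v ∈ ({I.s i, I.t i} : Set V), v ∈ I.keptVertices := by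
    intro v hv j hj
    have hij : i ≠ j := by
      rintro rfl
      exact hi hj
    have hd := Set.disjoint_left.mp (I.disjoint i j hij) hv
    simpa using hd
  exact ⟨key _ (by simp), key _ (by simp)⟩

/-- The instance obtained by removing every adjacent terminal pair: both its vertices are deleted
from the graph, and the pair is deleted from the list of terminal pairs. -/
def removeAdjacentPairs (I : DisjointPathsInstance V ι) :
    DisjointPathsInstance I.keptVertices {i // ¬ I.G.Adj (I.s i) (I.t i)} where
  G := I.G.induce I.keptVertices
  s := fun i => ⟨I.s i, (I.mem_keptVertices i.2).1⟩
  t := fun i => ⟨I.t i, (I.mem_keptVertices i.2).2⟩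
  disjoint := by
    intro i j hij
    have h := I.disjoint i j (fun e => hij (Subtype.ext e))
    simp only [Set.disjoint_insert_left, Set.disjoint_singleton_left, Set.mem_insert_iff,
      Set.mem_singleton_iff, Subtype.mk.injEq] at h ⊢
    exact h

/-- `v` is a terminal. -/
def IsTerminal (I : DisjointPathsInstance V ι) (v : V) : Prop := ∃ i, v = I.s i ∨ v = I.t i

/-- The graph obtained from the graph of the instance by removing every edge with both ends in `A`,
every edge with both ends in `B`, and every edge between two terminals. -/
def crossGraph (I : DisjointPathsInstance V ι) (A B : Set V) : SimpleGraph V where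
  Adj u v := I.G.Adj u v ∧ ¬ (u ∈ A ∧ v ∈ A) ∧ ¬ (u ∈ B ∧ v ∈ B) ∧
    ¬ (I.IsTerminal u ∧ I.IsTerminal v)
  symm := ⟨fun _ _ h => ⟨h.1.symm, fun e => h.2.1 e.symm, fun e => h.2.2.1 e.symm,
    fun e => h.2.2.2 e.symm⟩⟩
  loopless := ⟨fun _ h => h.1.ne rfl⟩

/-- The graph obtained from `crossGraph` by deleting all terminals and adding, for every `i`, a new
vertex (`Sum.inr i`) that is adjacent to those remaining vertices that were neighbours of `s i` or
of `t i`. -/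
def matchingGraph (I : DisjointPathsInstance V ι) (A B : Set V) :
    SimpleGraph ({v // ¬ I.IsTerminal v} ⊕ ι) where
  Adj
    | .inl u, .inl v => (I.crossGraph A B).Adj u v
    | .inl u, .inr i => (I.crossGraph A B).Adj u (I.s i) ∨ (I.crossGraph A B).Adj u (I.t i)
    | .inr i, .inl u => (I.crossGraph A B).Adj u (I.s i) ∨ (I.crossGraph A B).Adj u (I.t i)
    | .inr _, .inr _ => False
  symm := ⟨by
    rintro (u | i) (v | j) h
    · exact (I.crossGraph A B).adj_symm h
    · exact h
    · exact h
    · exact h⟩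
  loopless := ⟨by
    rintro (u | i) h
    · exact (I.crossGraph A B).irrefl h
    · exact h⟩

open Classical in
/-- The input for the machine of an instance on the vertex set `{0, …, n - 1}` with `k` terminal
pairs: `n`, `k`, the list of all `s i`, the list of all `t i`, and the adjacency matrix row by row.
No entry exceeds the length of the list. -/
noncomputable def encode {n k : ℕ} (I : DisjointPathsInstance (Fin n) (Fin k)) : List ℕ :=
  [n, k] ++ List.ofFn (fun i => (I.s i : ℕ)) ++ List.ofFn (fun i => (I.t i : ℕ)) ++
    List.ofFn (fun p : Fin (n * n) => if I.G.Adj p.divNat p.modNat then 1 else 0)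

end DisjointPathsInstance

/-! Structure of solutions. Distinct nonadjacent vertices of a cobipartite graph lie in different
cliques. So a path joining a nonadjacent pair `s`, `t` crosses between the cliques along some edge.
If an end of this edge is a terminal of the pair, then its other end is a common neighbour of `s`
and `t`; otherwise both ends are interior. Hence the path can be shortened to one whose interior is
either a single common neighbour or the two ends of a crossing edge, and a crossing edge serves
every nonadjacent pair. Equal or adjacent pairs need no interior vertices. The instance is therefore
a yes-instance iff the remaining ("active") pairs can be given disjoint interiors of this kind among
the nonterminals (`isYes_iff_exists_isLinkage`). This does not involve the adjacent pairs except as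
terminals to be avoided, which gives (2a). For (2b), a nonterminal is adjacent in `G'` to one
terminal of a pair iff it is adjacent in `G` to both, since one of the two lies in its own clique.
Thus edges of `G''` at `x_i` are the common neighbours of pair `i`, and the other edges are crossing
edges. In a matching each `x_i` is used at most once, so a permutation hands the edges at `x_i` to
pair `i` and the other edges arbitrarily to the remaining pairs (`exists_distribution`).

Algorithm. Two cliques are found by propagating a 2-colouring of the complement. What remains is a
matching problem in `G''`, which need not be bipartite, as `x_i` may have neighbours in both
cliques. It is turned into a perfect matching problem: with `m` nonterminals and `k` active pairs
there are `m` padding vertices joined to all other vertices, `s_i` plays the part of `x_i`, and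
`t_i` is joined only to padding vertices. The `t_i` consume `k` padding vertices, so `m - k` are
left for the `m + k` vertices of `G''`, and the other `2 k` of these must form `k` edges
(`Layout.WF.hasPM_iff`).

With auxiliary edges `s_i t_i` a perfect matching is obvious. These edges are deleted one at a time;
a deletion leaves at most one pair of unmatched vertices, and the matching is repaired or its
absence is detected. To avoid lifting augmenting paths out of contracted blossoms, the repair uses
only a decision procedure: an unmatched vertex `r` tries each neighbour `w`, and the edge `r w` is
fixed if the graph without `r` and `w` still has a perfect matching. The decision procedure is
Edmonds' algorithm. It keeps for every reached vertex `u` a whole matching that misses just `u` and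
the goal; an edge between two reached vertices closes a factor-critical blossom based at a missed
vertex, and contracting it preserves the answer (`HasPM.of_contract`, `HasPM.contract`). If there is
no such edge, counting shows that there is no perfect matching (`IsSearch.not_hasPM`).

Machine. The algorithm is written in a language whose only loops run `N` times, `N` being the input
length, so that a polynomial time bound follows by structural induction. A verified compiler into
machine programs (`Compile.cmd_spec`) turns correctness in that language into `PolyTimeSolvableOn`.
-/

namespace RAM

/-! ### Structured low-level code -/

/-- Structured code for the machine. Register `1` is used as scratch space by the jumps. -/
inductive Code where
  | const (r x : ℕ)
  | add (r a b : ℕ)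
  | sub (r a b : ℕ)
  | load (r a : ℕ)
  | store (a r : ℕ)
  | seq (c₁ c₂ : Code)
  /-- run `c₁` if register `r` is `0`, else `c₂` -/
  | ifZero (r : ℕ) (c₁ c₂ : Code)
  /-- repeat `c` as long as register `r` is not `0` -/
  | while (r : ℕ) (c : Code)

namespace Code

/-- The program of a piece of code that starts at position `p`. -/
def assemble : Code → ℕ → Program
  | .const r x, _ => [.const r x]
  | .add r a b, _ => [.add r a b]
  | .sub r a b, _ => [.sub r a b]
  | .load r a, _ => [.load r a]
  | .store a r, _ => [.store a r]
  | .seq c₁ c₂, p => c₁.assemble p ++ c₂.assemble (p + (c₁.assemble p).length)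
  | .ifZero r c₁ c₂, p =>
    let b₂ := c₂.assemble (p + 1)
    let l := p + 1 + b₂.length + 2
    let b₁ := c₁.assemble l
    .jumpZero r l :: (b₂ ++ ([.const 1 0, .jumpZero 1 (l + b₁.length)] ++ b₁))
  | .while r c, p =>
    let b := c.assemble (p + 1)
    .jumpZero r (p + 1 + b.length + 2) :: (b ++ [.const 1 0, .jumpZero 1 p])

/-- `Exec c ρ m ρ' m' t`: the code `c` turns the registers `ρ` and the memory `m` into `ρ'` and `m'`
within `t` steps. -/
inductive Exec : Code → (ℕ → ℕ) → (ℕ → ℕ) → (ℕ → ℕ) → (ℕ → ℕ) → ℕ → Prop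
  | const (r x ρ m) : Exec (.const r x) ρ m (Function.update ρ r x) m 1
  | add (r a b ρ m) : Exec (.add r a b) ρ m (Function.update ρ r (ρ a + ρ b)) m 1
  | sub (r a b ρ m) : Exec (.sub r a b) ρ m (Function.update ρ r (ρ a - ρ b)) m 1
  | load (r a ρ m) : Exec (.load r a) ρ m (Function.update ρ r (m (ρ a))) m 1
  | store (a r ρ m) : Exec (.store a r) ρ m ρ (Function.update m (ρ a) (ρ r)) 1
  | seq {c₁ c₂ ρ₁ m₁ ρ₂ m₂ ρ₃ m₃ t₁ t₂} : Exec c₁ ρ₁ m₁ ρ₂ m₂ t₁ → Exec c₂ ρ₂ m₂ ρ₃ m₃ t₂ →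
      Exec (.seq c₁ c₂) ρ₁ m₁ ρ₃ m₃ (t₁ + t₂)
  | ifZero {r c₁ c₂ ρ m ρ' m' t} : ρ r = 0 → Exec c₁ ρ m ρ' m' t →
      Exec (.ifZero r c₁ c₂) ρ m ρ' m' (t + 1)
  | ifNonzero {r c₁ c₂ ρ m ρ' m' t} : ρ r ≠ 0 → Exec c₂ ρ m ρ' m' t →
      Exec (.ifZero r c₁ c₂) ρ m (Function.update ρ' 1 0) m' (t + 3)
  | whileZero {r c ρ m} : ρ r = 0 → Exec (.while r c) ρ m ρ m 1
  | whileNonzero {r c ρ₁ m₁ ρ₂ m₂ ρ₃ m₃ t₁ t₂} : ρ₁ r ≠ 0 → Exec c ρ₁ m₁ ρ₂ m₂ t₁ →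
      Exec (.while r c) (Function.update ρ₂ 1 0) m₂ ρ₃ m₃ t₂ →
      Exec (.while r c) ρ₁ m₁ ρ₃ m₃ (t₁ + 3 + t₂)

end Code

/-- The program `b` stands in `P` from position `p` on. -/
def CodeAt (P : Program) (p : ℕ) (b : Program) : Prop := ∀ i < b.length, P[p + i]? = b[i]?

theorem CodeAt.left {P : Program} {p : ℕ} {b₁ b₂ : Program} (h : CodeAt P p (b₁ ++ b₂)) :
    CodeAt P p b₁ := fun i hi => by
  rw [h i (by simp; omega), List.getElem?_append_left hi]

theorem CodeAt.right {P : Program} {p : ℕ} {b₁ b₂ : Program} (h : CodeAt P p (b₁ ++ b₂)) :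
    CodeAt P (p + b₁.length) b₂ := fun i hi => by
  rw [add_assoc, h _ (by simp; omega), List.getElem?_append_right (by omega)]
  simp

theorem CodeAt.head {P : Program} {p : ℕ} {a : Instr} {b : Program} (h : CodeAt P p (a :: b)) :
    P[p]? = some a := by simpa using h 0 (by simp)

theorem CodeAt.tail {P : Program} {p : ℕ} {a : Instr} {b : Program} (h : CodeAt P p (a :: b)) :
    CodeAt P (p + 1) b := CodeAt.right (b₁ := [a]) h

theorem run_add (P : Program) (s t : ℕ) (c : Config) : run P (s + t) c = run P t (run P s c) := by
  rw [run, add_comm, Function.iterate_add_apply]; rfl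

theorem run_one {P : Program} {c : Config} {i : Instr} (h : P[c.pc]? = some i) :
    run P 1 c = i.exec c := by simp [run, step, h]

/-- The jump targets are absolute, so the code must be assembled for the very position at which it
stands. The overhead of `3` steps is the conditional jump plus an unconditional jump, which is
simulated by clearing register `1` and testing it. -/
theorem Code.Exec.run {c : Code} {ρ m ρ' m' : ℕ → ℕ} {t : ℕ} (h : c.Exec ρ m ρ' m' t) :
    ∀ (P : Program) (p : ℕ), CodeAt P p (c.assemble p) →
      run P t ⟨p, ρ, m⟩ = ⟨p + (c.assemble p).length, ρ', m'⟩ := by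
  induction h with
  | const | add | sub | load | store =>
    intro P p hP
    rw [run_one hP.head]; simp [Instr.exec, assemble]
  | seq _ _ ih₁ ih₂ =>
    intro P p hP
    rw [run_add, ih₁ P p hP.left, ih₂ P _ hP.right]
    simp [assemble, add_assoc]
  | @ifZero r c₁ c₂ ρ m ρ' m' t h₀ _ ih =>
    intro P p hP
    rw [add_comm, run_add, run_one hP.head]
    have h := hP.tail.right.right
    simp only [assemble, Instr.exec, h₀, if_true]
    rw [ih P _ (by simpa using h)]
    simp; omega
  | @ifNonzero r c₁ c₂ ρ m ρ' m' t h₀ _ ih =>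
    intro P p hP
    rw [show t + 3 = 1 + (t + (1 + 1)) by omega, run_add, run_one hP.head]
    have h := hP.tail.right.left
    simp only [assemble, Instr.exec, h₀, if_false]
    rw [run_add, ih P _ hP.tail.left, run_add, run_one (c := ⟨_, ρ', m'⟩) h.head, Instr.exec, run_one h.tail.head]
    simp [Instr.exec]; omega
  | @whileZero r c ρ m h₀ =>
    intro P p hP
    rw [run_one hP.head]; simp [Instr.exec, h₀, assemble]; omega
  | @whileNonzero r c ρ₁ m₁ ρ₂ m₂ ρ₃ m₃ t₁ t₂ h₀ _ _ ih₁ ih₂ =>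
    intro P p hP
    rw [show t₁ + 3 + t₂ = 1 + (t₁ + (1 + (1 + t₂))) by omega, run_add, run_one hP.head]
    have h := hP.tail.right
    simp only [Instr.exec, h₀, if_false]
    rw [run_add, ih₁ P _ hP.tail.left, run_add, run_one h.head, Instr.exec, run_add,
      run_one h.tail.head]
    simp only [Instr.exec, Function.update_self, if_true]
    exact ih₂ P p hP

/-- Hoare triple with a bound on the number of steps. -/
def Code.Triple (c : Code) (T : ℕ) (Pre Post : (ℕ → ℕ) → (ℕ → ℕ) → Prop) : Prop :=
  ∀ ρ m, Pre ρ m → ∃ ρ' m' t, t ≤ T ∧ c.Exec ρ m ρ' m' t ∧ Post ρ' m'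

namespace Code.Triple

variable {A B C : (ℕ → ℕ) → (ℕ → ℕ) → Prop} {T T₁ T₂ : ℕ} {c c₁ c₂ : Code}

theorem mono {A' B' : (ℕ → ℕ) → (ℕ → ℕ) → Prop} {T' : ℕ} (h : c.Triple T A B)
    (hA : ∀ ρ m, A' ρ m → A ρ m) (hB : ∀ ρ m, B ρ m → B' ρ m) (hT : T ≤ T') :
    c.Triple T' A' B' := fun ρ m hρ => by
  obtain ⟨ρ', m', t, ht, he, hb⟩ := h ρ m (hA _ _ hρ)
  exact ⟨ρ', m', t, ht.trans hT, he, hB _ _ hb⟩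

theorem const {r x : ℕ} (h : ∀ ρ m, A ρ m → B (Function.update ρ r x) m) :
    (Code.const r x).Triple 1 A B :=
  fun ρ m hρ => ⟨_, _, 1, le_rfl, .const r x ρ m, h ρ m hρ⟩

theorem add {r a b : ℕ} (h : ∀ ρ m, A ρ m → B (Function.update ρ r (ρ a + ρ b)) m) :
    (Code.add r a b).Triple 1 A B :=
  fun ρ m hρ => ⟨_, _, 1, le_rfl, .add r a b ρ m, h ρ m hρ⟩

theorem sub {r a b : ℕ} (h : ∀ ρ m, A ρ m → B (Function.update ρ r (ρ a - ρ b)) m) :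
    (Code.sub r a b).Triple 1 A B :=
  fun ρ m hρ => ⟨_, _, 1, le_rfl, .sub r a b ρ m, h ρ m hρ⟩

theorem load {r a : ℕ} (h : ∀ ρ m, A ρ m → B (Function.update ρ r (m (ρ a))) m) :
    (Code.load r a).Triple 1 A B :=
  fun ρ m hρ => ⟨_, _, 1, le_rfl, .load r a ρ m, h ρ m hρ⟩

theorem store {r a : ℕ} (h : ∀ ρ m, A ρ m → B ρ (Function.update m (ρ a) (ρ r))) :
    (Code.store a r).Triple 1 A B :=
  fun ρ m hρ => ⟨_, _, 1, le_rfl, .store a r ρ m, h ρ m hρ⟩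

theorem seq (h₁ : c₁.Triple T₁ A B) (h₂ : c₂.Triple T₂ B C) :
    (Code.seq c₁ c₂).Triple (T₁ + T₂) A C := fun ρ m hρ => by
  obtain ⟨ρ', m', t, ht, he, hb⟩ := h₁ ρ m hρ
  obtain ⟨ρ'', m'', t', ht', he', hb'⟩ := h₂ _ _ hb
  exact ⟨ρ'', m'', t + t', by omega, he.seq he', hb'⟩

/-- The postcondition must ignore register `1`, because the branch for nonzero values ends with an
unconditional jump that clears it. -/
theorem ifZero {r : ℕ} (hB : ∀ ρ m, B ρ m → B (Function.update ρ 1 0) m)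
    (h₁ : c₁.Triple T₁ (fun ρ m => A ρ m ∧ ρ r = 0) B)
    (h₂ : c₂.Triple T₂ (fun ρ m => A ρ m ∧ ρ r ≠ 0) B) :
    (Code.ifZero r c₁ c₂).Triple (T₁ + T₂ + 3) A B := fun ρ m hρ => by
  by_cases h : ρ r = 0
  · obtain ⟨ρ', m', t, ht, he, hb⟩ := h₁ ρ m ⟨hρ, h⟩
    exact ⟨_, _, _, by omega, .ifZero h he, hb⟩
  · obtain ⟨ρ', m', t, ht, he, hb⟩ := h₂ ρ m ⟨hρ, h⟩
    exact ⟨_, _, _, by omega, .ifNonzero h he, hB _ _ hb⟩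

/-- A loop that counts register `r` down from `M` to `0`. -/
theorem countdown {r M : ℕ} {I : ℕ → (ℕ → ℕ) → (ℕ → ℕ) → Prop}
    (hI : ∀ j ρ m, I j ρ m → I j (Function.update ρ 1 0) m)
    (hr : ∀ j ≤ M, ∀ ρ m, I j ρ m → ρ r = M - j)
    (h : ∀ j < M, c.Triple T (I j) (I (j + 1))) :
    (Code.while r c).Triple (M * (T + 3) + 1) (I 0) (I M) := by
  suffices H : ∀ k ≤ M, (Code.while r c).Triple (k * (T + 3) + 1) (I (M - k)) (I M) by
    simpa using H M le_rfl
  intro k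
  induction k with
  | zero =>
    intro _ ρ m hρ
    exact ⟨ρ, m, 1, by omega, .whileZero (by simpa using hr M le_rfl ρ m hρ), hρ⟩
  | succ k ih =>
    intro hk ρ m hρ
    obtain ⟨ρ', m', t, ht, he, hb⟩ := h (M - (k + 1)) (by omega) ρ m hρ
    rw [show M - (k + 1) + 1 = M - k by omega] at hb
    obtain ⟨ρ'', m'', t', ht', he', hb'⟩ := ih (by omega) _ _ (hI _ _ _ hb)
    have := hr _ (by omega) ρ m hρ
    refine ⟨ρ'', m'', _, ?_, .whileNonzero (by omega) he he', hb'⟩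
    have : (k + 1) * (T + 3) = k * (T + 3) + (T + 3) := by ring
    omega

end Code.Triple

end RAM

namespace RAM

/-! ### A programming language with bounded loops

All loops run `N` times, where `N` is the length of the input, so that every program runs in
polynomial time. -/

/-- Variables and two-dimensional arrays. -/
structure Store where
  v : ℕ → ℕ
  a : ℕ → ℕ → ℕ → ℕ

/-- Assignment to a variable. -/
def Store.set (s : Store) (x n : ℕ) : Store := ⟨Function.update s.v x n, s.a⟩

/-- Assignment to an array. -/
def Store.setArr (s : Store) (A : ℕ) (f : ℕ → ℕ → ℕ) : Store := ⟨s.v, Function.update s.a A f⟩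

inductive Expr where
  | var (x : ℕ)
  | const (c : ℕ)
  | add (e₁ e₂ : Expr)
  | sub (e₁ e₂ : Expr)
  /-- `e₁` if `c` is not `0`, else `e₂` -/
  | ite (c e₁ e₂ : Expr)
  /-- an array entry; `0` if an index is at least `N` -/
  | read (A : ℕ) (e₁ e₂ : Expr)
  /-- the sum over all values of the variable `x` that are less than `N` -/
  | sum (x : ℕ) (e : Expr)

def Expr.eval (N : ℕ) : Expr → Store → ℕ
  | .var x, s => s.v x
  | .const c, _ => c
  | .add e₁ e₂, s => e₁.eval N s + e₂.eval N s
  | .sub e₁ e₂, s => e₁.eval N s - e₂.eval N s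
  | .ite c e₁ e₂, s => if c.eval N s = 0 then e₂.eval N s else e₁.eval N s
  | .read A e₁ e₂, s =>
    if e₁.eval N s < N ∧ e₂.eval N s < N then s.a A (e₁.eval N s) (e₂.eval N s) else 0
  | .sum x e, s => ∑ i ∈ Finset.range N, e.eval N (s.set x i)

inductive Cmd where
  | set (x : ℕ) (e : Expr)
  /-- set all entries of the array `A` simultaneously, to the value of `e`, in which the variables
  `1` and `2` stand for the indices of the entry -/
  | fill (A : ℕ) (e : Expr)
  | seq (c₁ c₂ : Cmd)
  /-- `c₁` if `e` is not `0`, else `c₂` -/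
  | ite (e : Expr) (c₁ c₂ : Cmd)
  /-- repeat `c` for `N` times -/
  | loop (c : Cmd)

def Cmd.exec (N : ℕ) : Cmd → Store → Store
  | .set x e, s => s.set x (e.eval N s)
  | .fill A e, s => s.setArr A fun i j => e.eval N ((s.set 1 i).set 2 j)
  | .seq c₁ c₂, s => c₂.exec N (c₁.exec N s)
  | .ite e c₁ c₂, s => if e.eval N s = 0 then c₂.exec N s else c₁.exec N s
  | .loop c, s => (c.exec N)^[N] s

/-! ### Compilation -/

namespace Compile

open Code (Triple)

/-- The register of the `d`-th temporary. Register `2 * x` holds the variable `x`, register `3` holds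
`N`, and register `5` holds `1`. -/
local notation "t⟦" d "⟧" => (2 * d + 7)

/-- Multiplication of the `d`-th temporary by `N`. -/
def mul (d : ℕ) : Code :=
  .seq (.const t⟦d + 1⟧ 0) <| .seq (.add t⟦d + 2⟧ 3 t⟦d + 1⟧) <|
  .seq (.while t⟦d + 2⟧ (.seq (.add t⟦d + 1⟧ t⟦d + 1⟧ t⟦d⟧)
    (.sub t⟦d + 2⟧ t⟦d + 2⟧ 5)))
  (.add t⟦d⟧ t⟦d + 1⟧ t⟦d + 2⟧)

/-- The address of an array entry. -/
abbrev adr (N q i j : ℕ) : ℕ := (q * N + i) * N + j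

/-- Computation of an address in the `d`-th temporary. -/
def addr (q ri rj d : ℕ) : Code :=
  .seq (.const t⟦d⟧ q) <| .seq (mul d) <| .seq (.add t⟦d⟧ t⟦d⟧ ri) <|
  .seq (mul d) (.add t⟦d⟧ t⟦d⟧ rj)

/-- Computation of the value of an expression in the `d`-th temporary. -/
def expr : Expr → ℕ → Code
  | .var x, d => .seq (.const t⟦d⟧ 0) (.add t⟦d⟧ (2 * x) t⟦d⟧)
  | .const c, d => .const t⟦d⟧ c
  | .add e₁ e₂, d => .seq (expr e₁ d) <| .seq (expr e₂ (d + 1)) (.add t⟦d⟧ t⟦d⟧ t⟦d + 1⟧)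
  | .sub e₁ e₂, d => .seq (expr e₁ d) <| .seq (expr e₂ (d + 1)) (.sub t⟦d⟧ t⟦d⟧ t⟦d + 1⟧)
  | .ite c e₁ e₂, d => .seq (expr c d) (.ifZero t⟦d⟧ (expr e₂ d) (expr e₁ d))
  | .read A e₁ e₂, d => .seq (expr e₁ d) <| .seq (expr e₂ (d + 1)) <|
    .seq (.sub t⟦d + 2⟧ 3 t⟦d⟧) <| .ifZero t⟦d + 2⟧ (.const t⟦d⟧ 0) <|
    .seq (.sub t⟦d + 2⟧ 3 t⟦d + 1⟧) <| .ifZero t⟦d + 2⟧ (.const t⟦d⟧ 0) <|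
    .seq (addr (2 * A) t⟦d⟧ t⟦d + 1⟧ (d + 2)) (.load t⟦d⟧ t⟦d + 2⟧)
  | .sum x e, d =>
    .seq (.const t⟦d⟧ 0) <| .seq (.add t⟦d + 1⟧ (2 * x) t⟦d⟧) <|
    .seq (.add t⟦d + 2⟧ 3 t⟦d⟧) <| .seq (.const (2 * x) 0) <|
    .seq (.while t⟦d + 2⟧ (.seq (expr e (d + 3)) <|
      .seq (.add t⟦d⟧ t⟦d⟧ t⟦d + 3⟧) <| .seq (.add (2 * x) (2 * x) 5)
      (.sub t⟦d + 2⟧ t⟦d + 2⟧ 5)))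
    (.add (2 * x) t⟦d + 1⟧ t⟦d + 2⟧)

/-- Run `b` for all values of the variables `1` and `2` that are less than `N`. -/
def each (d : ℕ) (b : Code) : Code :=
  .seq (.const t⟦d + 4⟧ 0) <| .seq (.add t⟦d⟧ 2 t⟦d + 4⟧) <|
  .seq (.add t⟦d + 1⟧ 4 t⟦d + 4⟧) <| .seq (.add t⟦d + 2⟧ 3 t⟦d + 4⟧) <|
  .seq (.const 2 0) <|
  .seq (.while t⟦d + 2⟧ (.seq (.const t⟦d + 4⟧ 0) <|
    .seq (.add t⟦d + 3⟧ 3 t⟦d + 4⟧) <| .seq (.const 4 0) <|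
    .seq (.while t⟦d + 3⟧ (.seq b <| .seq (.add 4 4 5) (.sub t⟦d + 3⟧ t⟦d + 3⟧ 5))) <|
    .seq (.add 2 2 5) (.sub t⟦d + 2⟧ t⟦d + 2⟧ 5))) <|
  .seq (.const t⟦d + 4⟧ 0) <| .seq (.add 2 t⟦d⟧ t⟦d + 4⟧)
  (.add 4 t⟦d + 1⟧ t⟦d + 4⟧)

def cmd : Cmd → ℕ → Code
  | .set x e, d => .seq (expr e d) <| .seq (.const t⟦d + 1⟧ 0)
    (.add (2 * x) t⟦d⟧ t⟦d + 1⟧)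
  | .fill A e, d =>
    .seq (each d (.seq (expr e (d + 4)) <| .seq (addr 1 2 4 (d + 5))
      (.store t⟦d + 5⟧ t⟦d + 4⟧)))
    (each d (.seq (addr 1 2 4 (d + 4)) <| .seq (.load t⟦d + 4⟧ t⟦d + 4⟧) <|
      .seq (addr (2 * A) 2 4 (d + 5)) (.store t⟦d + 5⟧ t⟦d + 4⟧)))
  | .seq c₁ c₂, d => .seq (cmd c₁ d) (cmd c₂ d)
  | .ite e c₁ c₂, d => .seq (expr e d) (.ifZero t⟦d⟧ (cmd c₂ d) (cmd c₁ d))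
  | .loop c, d => .seq (.const t⟦d + 1⟧ 0) <| .seq (.add t⟦d⟧ 3 t⟦d + 1⟧)
    (.while t⟦d⟧ (.seq (cmd c (d + 1)) (.sub t⟦d⟧ t⟦d⟧ 5)))

/-- The registers that a computation in the temporaries from `d` on must not change. -/
def Low (d r : ℕ) : Prop := r % 2 = 0 ∨ (2 ≤ r ∧ r < 2 * d + 7)

/-- A triple that starts in a fixed state. -/
abbrev From (c : Code) (T : ℕ) (ρ₀ m₀ : ℕ → ℕ) (Post : (ℕ → ℕ) → (ℕ → ℕ) → Prop) : Prop :=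
  c.Triple T (fun ρ m => ρ = ρ₀ ∧ m = m₀) Post

theorem From.triple {c : Code} {T : ℕ} {A B : (ℕ → ℕ) → (ℕ → ℕ) → Prop}
    (h : ∀ ρ m, A ρ m → From c T ρ m B) : c.Triple T A B :=
  fun ρ m hρ => h ρ m hρ ρ m ⟨rfl, rfl⟩

/-- Registers `3` and `5` hold `N` and `1`. -/
def Std (N : ℕ) (ρ : ℕ → ℕ) : Prop := ρ 3 = N ∧ ρ 5 = 1

/-- Repeated addition, counted down from `N`. The exhausted counter is `0` at the end, so adding it
copies the product back. -/
theorem mul_spec {N d : ℕ} {ρ₀ m₀ : ℕ → ℕ} (h : Std N ρ₀) :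
    From (mul d) (N * 5 + 4) ρ₀ m₀ fun ρ m => m = m₀ ∧ (∀ r, Low d r → ρ r = ρ₀ r) ∧
      ρ t⟦d⟧ = ρ₀ t⟦d⟧ * N := by
  obtain ⟨h3, h5⟩ := h
  have key := Triple.countdown (r := t⟦d + 2⟧) (M := N) (T := 2)
    (c := .seq (.add t⟦d + 1⟧ t⟦d + 1⟧ t⟦d⟧) (.sub t⟦d + 2⟧ t⟦d + 2⟧ 5))
    (I := fun j ρ m => m = m₀ ∧ (∀ r, Low (d + 1) r → ρ r = ρ₀ r) ∧
      ρ t⟦d + 1⟧ = ρ₀ t⟦d⟧ * j ∧ ρ t⟦d + 2⟧ = N - j)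
    (by
      rintro j ρ m ⟨hm, hl, h1, h2⟩
      simp only [Low] at *
      refine ⟨hm, fun r hr => ?_, ?_, ?_⟩ <;>
        simp (disch := omega) only [Function.update_of_ne, *])
    (by
      rintro j hj ρ m ⟨hm, hl, h1, h2⟩
      exact h2)
    (by
      intro j hj
      refine (Triple.seq (B := fun ρ m => m = m₀ ∧ (∀ r, Low (d + 1) r → ρ r = ρ₀ r) ∧
        ρ t⟦d + 1⟧ = ρ₀ t⟦d⟧ * (j + 1) ∧ ρ t⟦d + 2⟧ = N - j)
        (T₁ := 1) (T₂ := 1) (.add ?_) (.sub ?_))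
      · rintro ρ m ⟨hm, hl, h1, h2⟩
        have := hl t⟦d⟧ (by unfold Low; omega)
        simp only [Low] at *
        refine ⟨hm, fun r hr => ?_, ?_, ?_⟩
        · simp (disch := omega) only [Function.update_of_ne]; exact hl r hr
        · simp only [Function.update_self, h1, this]; ring
        · simp (disch := omega) only [Function.update_of_ne, h2]
      · rintro ρ m ⟨hm, hl, h1, h2⟩
        have := hl 5 (by unfold Low; omega)
        simp only [Low] at *
        refine ⟨hm, fun r hr => ?_, ?_, ?_⟩
        · simp (disch := omega) only [Function.update_of_ne]; exact hl r hr
        · simp (disch := omega) only [Function.update_of_ne, h1]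
        · simp only [Function.update_self, h2, this, h5]; omega)
  refine (Triple.seq (Triple.const (B := fun ρ m => ρ = Function.update ρ₀ t⟦d + 1⟧ 0 ∧ m = m₀)
    ?_) (.seq (.add ?_) (.seq key (.add ?_)))).mono (fun _ _ => id) (fun _ _ => id) (by omega)
  · rintro ρ m ⟨rfl, rfl⟩; exact ⟨rfl, rfl⟩
  · rintro ρ m ⟨rfl, rfl⟩
    refine ⟨rfl, fun r hr => ?_, ?_, ?_⟩
    · simp only [Low] at hr
      simp (disch := omega) only [Function.update_of_ne]
    · simp (disch := omega) only [Function.update_of_ne, Function.update_self, mul_zero]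
    · simp (disch := omega) only [Function.update_of_ne, Function.update_self, h3]; simp
  · rintro ρ m ⟨hm, hl, h1, h2⟩
    simp only [Low] at *
    refine ⟨hm, fun r hr => ?_, ?_⟩
    · simp (disch := omega) only [Function.update_of_ne]; exact hl r (by omega)
    · simp only [Function.update_self, h1, h2]; simp

/-- Horner's scheme in base `N`, with two multiplications and two additions. -/
theorem addr_spec {N q ri rj d : ℕ} {ρ₀ m₀ : ℕ → ℕ} (h : Std N ρ₀) (hi : Low d ri) (hj : Low d rj) :
    From (addr q ri rj d) (N * 10 + 11) ρ₀ m₀ fun ρ m => m = m₀ ∧ (∀ r, Low d r → ρ r = ρ₀ r) ∧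
      ρ t⟦d⟧ = adr N q (ρ₀ ri) (ρ₀ rj) := by
  let Q := fun (k : ℕ) (ρ m : ℕ → ℕ) => m = m₀ ∧ (∀ r, Low d r → ρ r = ρ₀ r) ∧ ρ t⟦d⟧ = k
  have hmul : ∀ k, (mul d).Triple (N * 5 + 4) (Q k) (Q (k * N)) := fun k => by
    refine From.triple ?_
    rintro ρ m ⟨rfl, hl, rfl⟩
    refine (mul_spec ⟨?_, ?_⟩).mono (fun _ _ => id) ?_ le_rfl
    · rw [hl 3 (by unfold Low; omega), h.1]
    · rw [hl 5 (by unfold Low; omega), h.2]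
    · rintro ρ' m' ⟨rfl, hl', h'⟩
      exact ⟨rfl, fun r hr => (hl' r hr).trans (hl r hr), h'⟩
  have hadd : ∀ k r, Low d r → (Code.add t⟦d⟧ t⟦d⟧ r).Triple 1 (Q k) (Q (k + ρ₀ r)) := by
    intro k r hr
    refine .add ?_
    rintro ρ m ⟨rfl, hl, rfl⟩
    refine ⟨rfl, fun r' hr' => ?_, ?_⟩
    · rw [← hl r' hr']
      simp only [Low] at *
      simp (disch := omega) only [Function.update_of_ne]
    · simp [hl r hr]
  refine (Triple.seq (.const (B := Q q) ?_) (.seq (hmul q) (.seq (hadd _ ri hi)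
    (.seq (hmul _) (hadd _ rj hj))))).mono (fun _ _ => id) (fun _ _ => id) (by omega)
  rintro ρ m ⟨rfl, rfl⟩
  refine ⟨rfl, fun r hr => ?_, by simp⟩
  simp only [Low] at *
  simp (disch := omega) only [Function.update_of_ne]

/-- The memory holds the arrays. -/
def Mem (N : ℕ) (a : ℕ → ℕ → ℕ → ℕ) (m : ℕ → ℕ) : Prop :=
  ∀ A i j, i < N → j < N → m (adr N (2 * A) i j) = a A i j

/-- The machine is in a state that represents the store. -/
structure Rel (N : ℕ) (s : Store) (ρ m : ℕ → ℕ) : Prop where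
  var : ∀ x, ρ (2 * x) = s.v x
  std : Std N ρ
  mem : Mem N s.a m

theorem Rel.of_low {N d : ℕ} {s : Store} {ρ ρ' m : ℕ → ℕ} (h : Rel N s ρ m)
    (hl : ∀ r, Low d r → ρ' r = ρ r) : Rel N s ρ' m :=
  ⟨fun x => by rw [hl _ (by unfold Low; omega), h.var], ⟨by rw [hl _ (by unfold Low; omega), h.std.1],
    by rw [hl _ (by unfold Low; omega), h.std.2]⟩, h.mem⟩

/-- The result of the computation of a value in the `d`-th temporary. -/
def Res (d k : ℕ) (ρ₀ m₀ ρ m : ℕ → ℕ) : Prop :=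
  m = m₀ ∧ (∀ r, Low d r → ρ r = ρ₀ r) ∧ ρ t⟦d⟧ = k

/-- The second operand is computed one temporary higher, where the first value counts as low and
survives. -/
theorem binary_spec {N d k₁ k₂ T₁ T₂ : ℕ} {s : Store} {e₁ e₂ : Expr} {ρ₀ m₀ : ℕ → ℕ}
    (hR : Rel N s ρ₀ m₀)
    (h₁ : ∀ {ρ m}, Rel N s ρ m → From (expr e₁ d) T₁ ρ m (Res d k₁ ρ m))
    (h₂ : ∀ {ρ m}, Rel N s ρ m → From (expr e₂ (d + 1)) T₂ ρ m (Res (d + 1) k₂ ρ m))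
    {c : Code} {T : ℕ} {Post : (ℕ → ℕ) → (ℕ → ℕ) → Prop}
    (h : ∀ ρ, Rel N s ρ m₀ → (∀ r, Low d r → ρ r = ρ₀ r) → ρ t⟦d⟧ = k₁ → ρ t⟦d + 1⟧ = k₂ →
      From c T ρ m₀ Post) :
    From (.seq (expr e₁ d) (.seq (expr e₂ (d + 1)) c)) (T₁ + (T₂ + T)) ρ₀ m₀ Post := by
  refine .seq (h₁ hR) (From.triple ?_)
  rintro ρ m ⟨rfl, hl, hv⟩
  refine .seq (h₂ (hR.of_low hl)) (From.triple ?_)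
  rintro ρ' m ⟨rfl, hl', hv'⟩
  have hl'' : ∀ r, Low d r → ρ' r = ρ₀ r := fun r hr => by
    rw [hl' r (by unfold Low at *; omega), hl r hr]
  exact h ρ' (hR.of_low hl'') hl'' (by rw [hl' _ (by unfold Low; omega), hv]) hv'

/-- The polynomial depends on the expression alone and is chosen before `N` and the store. Only
`sum` multiplies the cost, by a factor linear in `N`. -/
theorem expr_spec (e : Expr) : ∃ p : Polynomial ℕ, ∀ (N d : ℕ) (s : Store) (ρ m : ℕ → ℕ),
    Rel N s ρ m → From (expr e d) (p.eval N) ρ m (Res d (e.eval N s) ρ m) := by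
  have low : ∀ {d k : ℕ} {ρ₀ ρ m : ℕ → ℕ}, (∀ r, Low d r → ρ r = ρ₀ r) →
      Res d k ρ₀ m (Function.update ρ t⟦d⟧ k) m := by
    intro d k ρ₀ ρ m hl
    refine ⟨rfl, fun r hr => ?_, by simp⟩
    rw [← hl r hr]
    simp only [Low] at *
    simp (disch := omega) only [Function.update_of_ne]
  have res1 : ∀ {d k : ℕ} {ρ₀ m₀ ρ m : ℕ → ℕ}, Res d k ρ₀ m₀ ρ m →
      Res d k ρ₀ m₀ (Function.update ρ 1 0) m := by
    rintro d k ρ₀ m₀ ρ m ⟨rfl, hl, hv⟩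
    simp only [Low] at *
    refine ⟨rfl, fun r hr => ?_, ?_⟩
    · simp only [Low] at hr; rw [← hl r hr]
      simp (disch := omega) only [Function.update_of_ne]
    · simp (disch := omega) only [Function.update_of_ne]; exact hv
  induction e with
  | var x =>
    refine ⟨2, fun N d s ρ₀ m₀ hR => ?_⟩
    refine (Triple.seq (.const (B := fun ρ m => ρ = Function.update ρ₀ t⟦d⟧ 0 ∧ m = m₀) ?_)
      (.add ?_)).mono (fun _ _ => id) (fun _ _ => id) (by simp)
    · rintro ρ m ⟨rfl, rfl⟩; exact ⟨rfl, rfl⟩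
    · rintro ρ m ⟨rfl, rfl⟩
      rw [Function.update_of_ne (by omega), Function.update_self, Function.update_idem]
      rw [hR.var, add_zero]
      exact low fun _ _ => rfl
  | const c =>
    refine ⟨1, fun N d s ρ₀ m₀ hR => ?_⟩
    refine (Triple.const ?_).mono (fun _ _ => id) (fun _ _ => id) (by simp)
    rintro ρ m ⟨rfl, rfl⟩
    exact low fun _ _ => rfl
  | add e₁ e₂ ih₁ ih₂ =>
    obtain ⟨p₁, h₁⟩ := ih₁
    obtain ⟨p₂, h₂⟩ := ih₂
    refine ⟨p₁ + (p₂ + 1), fun N d s ρ₀ m₀ hR => ?_⟩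
    refine (binary_spec hR (h₁ N d s _ _) (h₂ N (d + 1) s _ _) (T := 1) ?_).mono
      (fun _ _ => id) (fun _ _ => id) (by simp)
    intro ρ hR' hl hv hv'
    refine .add ?_
    rintro _ _ ⟨rfl, rfl⟩
    rw [hv, hv']
    exact low hl
  | sub e₁ e₂ ih₁ ih₂ =>
    obtain ⟨p₁, h₁⟩ := ih₁
    obtain ⟨p₂, h₂⟩ := ih₂
    refine ⟨p₁ + (p₂ + 1), fun N d s ρ₀ m₀ hR => ?_⟩
    refine (binary_spec hR (h₁ N d s _ _) (h₂ N (d + 1) s _ _) (T := 1) ?_).mono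
      (fun _ _ => id) (fun _ _ => id) (by simp)
    intro ρ hR' hl hv hv'
    refine .sub ?_
    rintro _ _ ⟨rfl, rfl⟩
    rw [hv, hv']
    exact low hl
  | ite c e₁ e₂ ih₀ ih₁ ih₂ =>
    obtain ⟨p₀, h₀⟩ := ih₀
    obtain ⟨p₁, h₁⟩ := ih₁
    obtain ⟨p₂, h₂⟩ := ih₂
    refine ⟨p₀ + (p₂ + p₁ + 3), fun N d s ρ₀ m₀ hR => ?_⟩
    refine (Triple.seq (h₀ N d s _ _ hR) (.ifZero (T₁ := p₂.eval N) (T₂ := p₁.eval N)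
      (fun _ _ => res1) (From.triple ?_) (From.triple ?_))).mono
      (fun _ _ => id) (fun _ _ => id) (by simp)
    · rintro ρ m ⟨⟨rfl, hl, hv⟩, h0⟩
      refine (h₂ N d s ρ m (hR.of_low hl)).mono (fun _ _ => id) ?_ le_rfl
      rintro ρ' m' ⟨rfl, hl', hv'⟩
      exact ⟨rfl, fun r hr => (hl' r hr).trans (hl r hr), by rw [hv', Expr.eval, ← hv, if_pos h0]⟩
    · rintro ρ m ⟨⟨rfl, hl, hv⟩, h0⟩
      refine (h₁ N d s ρ m (hR.of_low hl)).mono (fun _ _ => id) ?_ le_rfl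
      rintro ρ' m' ⟨rfl, hl', hv'⟩
      exact ⟨rfl, fun r hr => (hl' r hr).trans (hl r hr), by rw [hv', Expr.eval, ← hv, if_neg h0]⟩
  | read A e₁ e₂ ih₁ ih₂ =>
    obtain ⟨p₁, h₁⟩ := ih₁
    obtain ⟨p₂, h₂⟩ := ih₂
    refine ⟨p₁ + (p₂ + (1 + (1 + (1 + (1 + ((Polynomial.X * 10 + 11) + 1) + 3)) + 3))),
      fun N d s ρ₀ m₀ hR => ?_⟩
    refine (binary_spec hR (h₁ N d s _ _) (h₂ N (d + 1) s _ _)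
      (T := 1 + (1 + (1 + (1 + ((N * 10 + 11) + 1) + 3)) + 3)) ?_).mono
      (fun _ _ => id) (fun _ _ => id) (by simp)
    intro ρ hR' hl hv hv'
    have upd : ∀ k, ∀ r, Low (d + 2) r → Function.update ρ t⟦d + 2⟧ k r = ρ r := by
      intro k r hr
      simp only [Low] at *
      simp (disch := omega) only [Function.update_of_ne]
    have low2 : ∀ {d r}, Low d r → Low (d + 2) r := by intro d r h; simp only [Low] at *; omega
    refine .seq (.sub (B := fun ρ' m' => ρ' = Function.update ρ t⟦d + 2⟧
      (N - e₁.eval N s) ∧ m' = m₀) ?_) (.ifZero (fun _ _ => res1) (.const ?_) ?_)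
    · rintro _ _ ⟨rfl, rfl⟩; rw [hR'.std.1, hv]; exact ⟨rfl, rfl⟩
    · rintro _ _ ⟨⟨rfl, rfl⟩, h0⟩
      rw [Function.update_self] at h0
      rw [Expr.eval, if_neg (by omega)]
      exact low fun r hr => (upd _ r (low2 hr)).trans (hl r hr)
    refine .seq (.sub (B := fun ρ' m' => ρ' = Function.update ρ t⟦d + 2⟧
      (N - e₂.eval N s) ∧ m' = m₀ ∧ e₁.eval N s < N) ?_) (.ifZero (fun _ _ => res1) (.const ?_) ?_)
    · rintro _ _ ⟨⟨rfl, rfl⟩, h0⟩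
      rw [Function.update_self] at h0
      rw [upd _ 3 (by unfold Low; omega), upd _ _ (by unfold Low; omega), hR'.std.1, hv',
        Function.update_idem]
      exact ⟨rfl, rfl, by omega⟩
    · rintro _ _ ⟨⟨rfl, rfl, h1⟩, h0⟩
      rw [Function.update_self] at h0
      rw [Expr.eval, if_neg (by omega)]
      exact low fun r hr => (upd _ r (low2 hr)).trans (hl r hr)
    refine From.triple ?_
    rintro ρ' m' ⟨⟨rfl, rfl, h1⟩, h0⟩
    rw [Function.update_self] at h0
    refine .seq (addr_spec (N := N) ⟨?_, ?_⟩ ?_ ?_) (.load ?_)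
    · rw [upd _ 3 (by unfold Low; omega), hR'.std.1]
    · rw [upd _ 5 (by unfold Low; omega), hR'.std.2]
    · simp only [Low]; omega
    · simp only [Low]; omega
    · rintro ρ' m ⟨rfl, hl', hv''⟩
      rw [upd _ t⟦d⟧ (by unfold Low; omega), upd _ t⟦d + 1⟧ (by unfold Low; omega),
        hv, hv'] at hv''
      rw [hv'', hR.mem _ _ _ h1 (by omega), Expr.eval, if_pos ⟨h1, by omega⟩]
      exact low fun r hr => by rw [hl' r (low2 hr), upd _ _ (low2 hr), hl r hr]
  | sum x e ih =>
    obtain ⟨p, h⟩ := ih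
    refine ⟨1 + (1 + (1 + (1 + ((Polynomial.X * (p + (1 + (1 + 1)) + 3) + 1) + 1)))),
      fun N d s ρ₀ m₀ hR => ?_⟩
    have h3 := hR.std.1
    have h5 := hR.std.2
    -- The register of `x` itself runs through `0, …, N - 1`. Its old value waits in temporary `d +
    -- 1` and is restored afterwards, so in the end the variables are unchanged.
    have key := Triple.countdown (r := t⟦d + 2⟧) (M := N) (T := p.eval N + (1 + (1 + 1)))
      (c := .seq (expr e (d + 3)) <|
        .seq (.add t⟦d⟧ t⟦d⟧ t⟦d + 3⟧) <| .seq (.add (2 * x) (2 * x) 5)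
        (.sub t⟦d + 2⟧ t⟦d + 2⟧ 5))
      (I := fun j ρ m => m = m₀ ∧ (∀ r, Low d r → r ≠ 2 * x → ρ r = ρ₀ r) ∧ ρ (2 * x) = j ∧
        ρ t⟦d⟧ = ∑ i ∈ Finset.range j, e.eval N (s.set x i) ∧ ρ t⟦d + 1⟧ = ρ₀ (2 * x) ∧
        ρ t⟦d + 2⟧ = N - j)
      (by
        rintro j ρ m ⟨hm, hl, h1, h2, h3, h4⟩
        refine ⟨hm, fun r hr hx => ?_, ?_, ?_, ?_, ?_⟩
        · rw [← hl r hr hx]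
          simp only [Low] at hr
          simp (disch := omega) only [Function.update_of_ne]
        all_goals simp (disch := omega) only [Function.update_of_ne, *])
      (by
        rintro j hj ρ m ⟨hm, hl, h1, h2, h3, h4⟩
        exact h4)
      (by
        intro j hj
        refine From.triple ?_
        rintro ρ m ⟨rfl, hl, h1, h2, hs, h4⟩
        have hRj : Rel N (s.set x j) ρ m := by
          refine ⟨fun y => ?_, ⟨?_, ?_⟩, hR.mem⟩
          · rcases eq_or_ne y x with rfl | hy
            · simp [Store.set, h1]
            · rw [hl _ (by unfold Low; omega) (by omega), hR.var]; simp [Store.set, hy]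
          · rw [hl _ (by unfold Low; omega) (by omega), h3]
          · rw [hl _ (by unfold Low; omega) (by omega), h5]
        -- Resetting the accumulator in the intermediate assertion says that no other low register
        -- has changed.
        refine .seq (h N (d + 3) _ ρ m hRj) (.seq (.add (B := fun ρ' m' => ∃ k,
          Res (d + 3) k ρ m (Function.update ρ' t⟦d⟧ (ρ t⟦d⟧)) m' ∧ ρ' t⟦d⟧ = ρ t⟦d⟧ +
          e.eval N (s.set x j)) ?_) ?_)
        · rintro ρ' m' ⟨rfl, hl', hv'⟩
          have := hl' t⟦d⟧ (by unfold Low; omega)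
          refine ⟨_, ⟨rfl, ?_, rfl⟩, ?_⟩
          · rw [← this, Function.update_idem, Function.update_eq_self]; exact hl'
          · rw [Function.update_self, hv', this]
        · refine From.triple ?_
          rintro ρ' m' ⟨k, ⟨rfl, hl', hv'⟩, hv⟩
          have hl'' : ∀ r, Low (d + 3) r → r ≠ t⟦d⟧ → ρ' r = ρ r := fun r hr hd => by
            rw [← hl' r hr, Function.update_of_ne hd]
          have h5' : ρ' 5 = 1 := by rw [hl'' _ (by unfold Low; omega) (by omega), hRj.std.2]
          refine .seq (.add (B := fun ρ'' m'' => m'' = m' ∧ ρ'' = Function.update ρ' (2 * x)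
            (ρ' (2 * x) + ρ' 5)) ?_) (.sub ?_)
          · rintro _ _ ⟨rfl, rfl⟩; exact ⟨rfl, rfl⟩
          · rintro _ _ ⟨rfl, rfl⟩
            refine ⟨rfl, fun r hr hx => ?_, ?_, ?_, ?_, ?_⟩
            · rw [← hl r hr hx, ← hl'' r (by unfold Low at *; omega)
                (by unfold Low at *; omega)]
              simp only [Low] at hr
              simp (disch := omega) only [Function.update_of_ne]
            · simp (disch := omega) only [Function.update_of_ne, Function.update_self, h5']
              rw [hl'' _ (by unfold Low; omega) (by omega), h1]
            · simp (disch := omega) only [Function.update_of_ne, hv, h2]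
              rw [Finset.sum_range_succ]
            · simp (disch := omega) only [Function.update_of_ne]
              rw [hl'' _ (by unfold Low; omega) (by omega), hs]
            · simp (disch := omega) only [Function.update_of_ne, Function.update_self, h5']
              rw [hl'' _ (by unfold Low; omega) (by omega), h4]; omega)
    refine (Triple.seq (.const (B := fun ρ m => ρ = Function.update ρ₀ t⟦d⟧ 0 ∧ m = m₀) ?_) <|
      .seq (.add (B := fun ρ m => ρ = Function.update (Function.update ρ₀ t⟦d⟧ 0)
        t⟦d + 1⟧ (ρ₀ (2 * x)) ∧ m = m₀) ?_) <|
      .seq (.add (B := fun ρ m => ρ = Function.update (Function.update (Function.update ρ₀ t⟦d⟧ 0)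
        t⟦d + 1⟧ (ρ₀ (2 * x))) t⟦d + 2⟧ N ∧ m = m₀) ?_) <|
      .seq (.const ?_) <| .seq key <| .add ?_).mono (fun _ _ => id) (fun _ _ => id) (by simp)
    · rintro ρ m ⟨rfl, rfl⟩; exact ⟨rfl, rfl⟩
    · rintro ρ m ⟨rfl, rfl⟩
      simp (disch := omega) only [Function.update_of_ne, Function.update_self, add_zero, and_self]
    · rintro ρ m ⟨rfl, rfl⟩
      simp (disch := omega) only [Function.update_of_ne, Function.update_self, add_zero, and_self, h3]
    · rintro ρ m ⟨rfl, rfl⟩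
      refine ⟨rfl, fun r hr hx => ?_, ?_, ?_, ?_, ?_⟩
      · simp only [Low] at hr
        simp (disch := omega) only [Function.update_of_ne]
      all_goals simp (disch := omega) only [Function.update_of_ne, Function.update_self,
        Finset.range_zero, Finset.sum_empty, Nat.sub_zero]
    · rintro ρ m ⟨rfl, hl, h1, h2, hs, h4⟩
      refine ⟨rfl, fun r hr => ?_, ?_⟩
      · rcases eq_or_ne r (2 * x) with rfl | hx
        · rw [Function.update_self, hs, h4]; simp
        · rw [Function.update_of_ne hx, hl r hr hx]
      · rw [Function.update_of_ne (by omega), h2, Expr.eval]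

end Compile
end RAM

/-! ### Array assignments and correctness of the compiler -/

namespace RAM
namespace Compile

open Code (Triple)
local notation "t⟦" d "⟧" => (2 * d + 7)

/-- `J i j` is what holds of the memory once all entries before `(i, j)` in row-major order have
been treated; `hJ` passes from the end of a row to the next row. Registers `2` and `4`, which hold
the index variables, are saved and restored. -/
theorem each_spec {N d T : ℕ} {b : Code} {ρ₀ m₀ : ℕ → ℕ} {J : ℕ → ℕ → (ℕ → ℕ) → Prop}
    (h : Std N ρ₀) (h₀ : J 0 0 m₀) (hJ : ∀ i < N, ∀ m, J i N m → J (i + 1) 0 m)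
    (hb : ∀ i < N, ∀ j < N, ∀ ρ m, (∀ r, Low d r → r ≠ 2 → r ≠ 4 → ρ r = ρ₀ r) → ρ 2 = i → ρ 4 = j →
      J i j m → From b T ρ m fun ρ' m' => (∀ r, Low (d + 4) r → ρ' r = ρ r) ∧ J i (j + 1) m') :
    From (each d b) (N * (N * (T + 5) + 9) + 9) ρ₀ m₀ fun ρ m =>
      (∀ r, Low d r → ρ r = ρ₀ r) ∧ J N 0 m := by
  obtain ⟨h3, h5⟩ := h
  let I := fun (i j : ℕ) (ρ m : ℕ → ℕ) => (∀ r, Low d r → r ≠ 2 → r ≠ 4 → ρ r = ρ₀ r) ∧ ρ 2 = i ∧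
    ρ t⟦d⟧ = ρ₀ 2 ∧ ρ t⟦d + 1⟧ = ρ₀ 4 ∧ ρ t⟦d + 2⟧ = N - i ∧ J i j m
  let I' := fun (i j : ℕ) (ρ m : ℕ → ℕ) => I i j ρ m ∧ ρ 4 = j ∧ ρ t⟦d + 3⟧ = N - j
  have upd : ∀ {i j i' j' ρ m m' k r}, I i j ρ m → (r = 1 ∨ r = 4 ∨ (t⟦d + 3⟧ ≤ r ∧ r % 2 = 1)) →
      i = i' → J i' j' m' → I i' j' (Function.update ρ r k) m' := by
    rintro i j i' j' ρ m m' k r ⟨h1, h2, h3, h4, h5, h6⟩ hr rfl hJ'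
    refine ⟨fun r' hr' h2 h4 => ?_, ?_, ?_, ?_, ?_, hJ'⟩
    · rw [← h1 r' hr' h2 h4]
      unfold Low at hr'
      rw [Function.update_of_ne (by omega)]
    all_goals rw [Function.update_of_ne (by omega)]; assumption
  have inner : ∀ i < N, (Code.while t⟦d + 3⟧ (.seq b <| .seq (.add 4 4 5)
      (.sub t⟦d + 3⟧ t⟦d + 3⟧ 5))).Triple (N * (T + 5) + 1) (I' i 0) (I' i N) := by
    intro i hi
    refine (Triple.countdown (r := t⟦d + 3⟧) (M := N) (T := T + (1 + 1)) (I := I' i) ?_ ?_ ?_).mono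
      (fun _ _ => id) (fun _ _ => id) (by simp [add_assoc])
    · rintro j ρ m ⟨hI, h4, hc⟩
      exact ⟨upd hI (by omega) rfl hI.2.2.2.2.2, by rw [Function.update_of_ne (by omega), h4],
        by rw [Function.update_of_ne (by omega), hc]⟩
    · exact fun j hj ρ m h => h.2.2
    · intro j hj
      refine From.triple ?_
      rintro ρ m ⟨hI, h4, hc⟩
      refine .seq (hb i hi j hj ρ m hI.1 hI.2.1 h4 hI.2.2.2.2.2) (From.triple ?_)
      rintro ρ' m' ⟨hl, hJ'⟩
      have hI' : I i (j + 1) ρ' m' := by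
        obtain ⟨h1, h2, h3, h4, h5, h6⟩ := hI
        refine ⟨fun r hr h2 h4 => by rw [hl _ (by unfold Low at *; omega), h1 r hr h2 h4], ?_, ?_, ?_,
          ?_, hJ'⟩ <;> rw [hl _ (by unfold Low; omega)] <;> assumption
      have h5' : ρ' 5 = 1 := by rw [hI'.1 5 (by unfold Low; omega) (by omega) (by omega), h5]
      refine .seq (.add (B := fun ρ m => (I i (j + 1) ρ m ∧ ρ 4 = j + 1 ∧ ρ t⟦d + 3⟧ = N - j) ∧
        ρ 5 = 1) ?_) (.sub ?_)
      · rintro _ _ ⟨rfl, rfl⟩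
        refine ⟨⟨upd hI' (by omega) rfl hJ', ?_, ?_⟩, ?_⟩
        · rw [Function.update_self, hl _ (by unfold Low; omega), h4, h5']
        · rw [Function.update_of_ne (by omega), hl _ (by unfold Low; omega), hc]
        · rw [Function.update_of_ne (by omega), h5']
      · rintro ρ m ⟨⟨hI, h4, hc⟩, h5⟩
        refine ⟨upd hI (by omega) rfl hI.2.2.2.2.2, ?_, ?_⟩
        · rw [Function.update_of_ne (by omega), h4]
        · rw [Function.update_self, hc, h5]; omega
  have outer := Triple.countdown (r := t⟦d + 2⟧) (M := N)
      (T := 1 + (1 + (1 + ((N * (T + 5) + 1) + (1 + 1)))))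
      (c := .seq (.const t⟦d + 4⟧ 0) <|
    .seq (.add t⟦d + 3⟧ 3 t⟦d + 4⟧) <| .seq (.const 4 0) <|
    .seq (.while t⟦d + 3⟧ (.seq b <| .seq (.add 4 4 5) (.sub t⟦d + 3⟧ t⟦d + 3⟧ 5))) <|
    .seq (.add 2 2 5) (.sub t⟦d + 2⟧ t⟦d + 2⟧ 5)) (I := fun i => I i 0)
    (fun j ρ m hI => upd hI (by omega) rfl hI.2.2.2.2.2) (fun j _ ρ m hI => hI.2.2.2.2.1) (by
      intro i hi
      refine .seq (.const (B := fun ρ m => I i 0 ρ m ∧ ρ t⟦d + 4⟧ = 0) ?_) <|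
        .seq (.add (B := fun ρ m => I i 0 ρ m ∧ ρ t⟦d + 3⟧ = N) ?_) <|
        .seq (.const (B := I' i 0) ?_) <| .seq (inner i hi) <| .seq (.add (B := fun ρ m =>
          (∀ r, Low d r → r ≠ 2 → r ≠ 4 → ρ r = ρ₀ r) ∧ ρ 2 = i + 1 ∧
          ρ t⟦d⟧ = ρ₀ 2 ∧ ρ t⟦d + 1⟧ = ρ₀ 4 ∧ ρ t⟦d + 2⟧ = N - i ∧ J (i + 1) 0 m) ?_) (.sub ?_)
      · rintro ρ m hI
        exact ⟨upd hI (by omega) rfl hI.2.2.2.2.2, by simp⟩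
      · rintro ρ m ⟨hI, h0⟩
        refine ⟨upd hI (by omega) rfl hI.2.2.2.2.2, ?_⟩
        rw [Function.update_self, h0, hI.1 3 (by unfold Low; omega) (by omega) (by omega), h3, add_zero]
      · rintro ρ m ⟨hI, h0⟩
        refine ⟨upd hI (by omega) rfl hI.2.2.2.2.2, by simp, ?_⟩
        rw [Function.update_of_ne (by omega), h0, Nat.sub_zero]
      · rintro ρ m ⟨⟨h1, h2, h3, h4, h6, h7⟩, -⟩
        refine ⟨fun r hr h2 h4 => ?_, ?_, ?_, ?_, ?_, hJ i hi m h7⟩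
        · rw [Function.update_of_ne h2, h1 r hr h2 h4]
        · rw [Function.update_self, h2, h1 5 (by unfold Low; omega) (by omega) (by omega), h5]
        all_goals rw [Function.update_of_ne (by omega)]; assumption
      · rintro ρ m ⟨h1, h2, h3, h4, h6, h7⟩
        refine ⟨fun r hr h2 h4 => ?_, ?_, ?_, ?_, ?_, h7⟩
        · rw [← h1 r hr h2 h4]; unfold Low at hr; rw [Function.update_of_ne (by omega)]
        · rw [Function.update_of_ne (by omega), h2]
        · rw [Function.update_of_ne (by omega), h3]
        · rw [Function.update_of_ne (by omega), h4]
        · rw [Function.update_self, h6, h1 5 (by unfold Low; omega) (by omega) (by omega), h5]; omega)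
  let K := fun (x y z : Prop) (ρ m : ℕ → ℕ) => (∀ r, Low d r → ρ r = ρ₀ r) ∧ m = m₀ ∧
    (x → ρ t⟦d + 4⟧ = 0) ∧ (y → ρ t⟦d⟧ = ρ₀ 2) ∧ (z → ρ t⟦d + 1⟧ = ρ₀ 4)
  refine (Triple.seq (.const (B := K True False False) ?_) <|
    .seq (.add (B := K True True False) ?_) <|
    .seq (.add (B := K True True True) ?_) <|
    .seq (.add (B := fun ρ m => K False True True ρ m ∧ ρ t⟦d + 2⟧ = N) ?_) <|
    .seq (.const (B := I 0 0) ?_) <| .seq outer <|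
    .seq (.const (B := fun ρ m => I N 0 ρ m ∧ ρ t⟦d + 4⟧ = 0) ?_) <|
    .seq (.add (B := fun ρ m => (∀ r, Low d r → r ≠ 4 → ρ r = ρ₀ r) ∧ ρ t⟦d + 1⟧ = ρ₀ 4 ∧ J N 0 m ∧
      ρ t⟦d + 4⟧ = 0) ?_)
    (.add ?_)).mono (fun _ _ => id) (fun _ _ => id) (le_of_eq (by ring))
  · rintro _ _ ⟨rfl, rfl⟩
    refine ⟨fun r hr => ?_, rfl, by simp, by simp, by simp⟩
    unfold Low at hr; rw [Function.update_of_ne (by omega)]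
  · rintro ρ m ⟨hl, rfl, h0, -, -⟩
    refine ⟨fun r hr => ?_, rfl, fun _ => ?_, fun _ => ?_, by simp⟩
    · rw [← hl r hr]; unfold Low at hr; rw [Function.update_of_ne (by omega)]
    · rw [Function.update_of_ne (by omega), h0 trivial]
    · rw [Function.update_self, h0 trivial, hl _ (by unfold Low; omega), add_zero]
  · rintro ρ m ⟨hl, rfl, h0, h1, -⟩
    refine ⟨fun r hr => ?_, rfl, fun _ => ?_, fun _ => ?_, fun _ => ?_⟩
    · rw [← hl r hr]; unfold Low at hr; rw [Function.update_of_ne (by omega)]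
    · rw [Function.update_of_ne (by omega), h0 trivial]
    · rw [Function.update_of_ne (by omega), h1 trivial]
    · rw [Function.update_self, h0 trivial, hl _ (by unfold Low; omega), add_zero]
  · rintro ρ m ⟨hl, rfl, h0, h1, h2⟩
    refine ⟨⟨fun r hr => ?_, rfl, by simp, fun _ => ?_, fun _ => ?_⟩, ?_⟩
    · rw [← hl r hr]; unfold Low at hr; rw [Function.update_of_ne (by omega)]
    · rw [Function.update_of_ne (by omega), h1 trivial]
    · rw [Function.update_of_ne (by omega), h2 trivial]
    · rw [Function.update_self, h0 trivial, hl _ (by unfold Low; omega), add_zero, h3]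
  · rintro ρ m ⟨⟨hl, rfl, h0, h1, h2⟩, h4⟩
    refine ⟨fun r hr hr2 hr4 => ?_, by simp, ?_, ?_, ?_, h₀⟩
    · rw [Function.update_of_ne hr2, hl r hr]
    · rw [Function.update_of_ne (by omega), h1 trivial]
    · rw [Function.update_of_ne (by omega), h2 trivial]
    · rw [Function.update_of_ne (by omega), h4, Nat.sub_zero]
  · rintro ρ m hI
    exact ⟨upd hI (by omega) rfl hI.2.2.2.2.2, by simp⟩
  · rintro ρ m ⟨⟨h1, h2, h3, h4, h6, h7⟩, h0⟩
    refine ⟨fun r hr hr4 => ?_, ?_, h7, ?_⟩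
    · rcases eq_or_ne r 2 with rfl | hr2
      · rw [Function.update_self, h3, h0, add_zero]
      · rw [Function.update_of_ne hr2, h1 r hr hr2 hr4]
    · rw [Function.update_of_ne (by omega), h4]
    · rw [Function.update_of_ne (by omega), h0]
  · rintro ρ m ⟨h1, h4, h7, h0⟩
    refine ⟨fun r hr => ?_, h7⟩
    rcases eq_or_ne r 4 with rfl | hr4
    · rw [Function.update_self, h4, h0, add_zero]
    · rw [Function.update_of_ne hr4, h1 r hr hr4]

/-- `i` and `j` are the last two digits of the address in base `N`. -/
theorem adr_inj {N q i j q' i' j' : ℕ} (hi : i < N) (hj : j < N) (hi' : i' < N) (hj' : j' < N)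
    (h : adr N q i j = adr N q' i' j') : q = q' ∧ i = i' ∧ j = j' := by
  have hN : 0 < N := by omega
  have h1 := congrArg (· % N) h
  have h2 := congrArg (· / N) h
  simp only [adr, Nat.add_comm _ j, Nat.add_comm _ j',
    Nat.add_mul_mod_self_right, Nat.mod_eq_of_lt hj, Nat.mod_eq_of_lt hj',
    Nat.add_mul_div_right _ _ hN, Nat.div_eq_of_lt hj, Nat.div_eq_of_lt hj', zero_add] at h1 h2
  have h3 := congrArg (· % N) h2
  have h4 := congrArg (· / N) h2
  simp only [Nat.add_comm _ i, Nat.add_comm _ i',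
    Nat.add_mul_mod_self_right, Nat.mod_eq_of_lt hi, Nat.mod_eq_of_lt hi',
    Nat.add_mul_div_right _ _ hN, Nat.div_eq_of_lt hi, Nat.div_eq_of_lt hi', zero_add] at h3 h4
  exact ⟨h4, h3, h1⟩

/-- The assignment is simultaneous, so the new entries are first computed into the scratch block `1`
while the old array can still be read, and are copied afterwards. Arrays occupy the even blocks `2 *
A`, so the scratch block meets none of them. `J₁` and `J₂` describe the progress of the two passes.
-/
theorem fill_spec (A : ℕ) (e : Expr) : ∃ p : Polynomial ℕ, ∀ (N d : ℕ) (s : Store) (ρ m : ℕ → ℕ),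
    Rel N s ρ m → From (cmd (.fill A e) d) (p.eval N) ρ m fun ρ' m' =>
      (∀ r, Low d r → ρ' r = ρ r) ∧ Rel N ((Cmd.fill A e).exec N s) ρ' m' := by
  obtain ⟨p, hp⟩ := expr_spec e
  refine ⟨(Polynomial.X * (Polynomial.X * ((p + (Polynomial.X * 10 + 11 + 1)) + 5) + 9) + 9) +
    (Polynomial.X * (Polynomial.X * (((Polynomial.X * 10 + 11) + (1 + ((Polynomial.X * 10 + 11) + 1)))
      + 5) + 9) + 9), fun N d s ρ₀ m₀ hR => ?_⟩
  set f : ℕ → ℕ → ℕ := fun i j => e.eval N ((s.set 1 i).set 2 j) with hf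
  let J₁ := fun (i j : ℕ) (m : ℕ → ℕ) => Mem N s.a m ∧
    ∀ i' j', i' < N → j' < N → (i' < i ∨ (i' = i ∧ j' < j)) → m (adr N 1 i' j') = f i' j'
  let J₂ := fun (i j : ℕ) (m : ℕ → ℕ) => (∀ B, B ≠ A → ∀ i' j', i' < N → j' < N →
    m (adr N (2 * B) i' j') = s.a B i' j') ∧
    (∀ i' j', i' < N → j' < N → m (adr N 1 i' j') = f i' j') ∧
    ∀ i' j', i' < N → j' < N → (i' < i ∨ (i' = i ∧ j' < j)) → m (adr N (2 * A) i' j') = f i' j'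
  refine (Triple.seq (each_spec (J := J₁) hR.std ⟨hR.mem, fun _ _ _ _ h => by omega⟩ ?_ ?_)
    (T₂ := (N * (N * (((N * 10 + 11) + (1 + ((N * 10 + 11) + 1))) + 5) + 9) + 9))
    (T₁ := (N * (N * ((p.eval N + (N * 10 + 11 + 1)) + 5) + 9) + 9))
    (From.triple ?_)).mono (fun _ _ => id) (fun _ _ => id) (by simp)
  · rintro i hi m ⟨h1, h2⟩
    exact ⟨h1, fun i' j' hi' hj' h => h2 i' j' hi' hj' (by omega)⟩
  · rintro i hi j hj ρ m hl h2 h4 ⟨hM, hJ⟩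
    have hR' : Rel N ((s.set 1 i).set 2 j) ρ m := by
      refine ⟨fun x => ?_, ⟨?_, ?_⟩, hM⟩
      · rcases eq_or_ne x 2 with rfl | hx2
        · simp [Store.set, h4]
        rcases eq_or_ne x 1 with rfl | hx1
        · simp [Store.set, h2]
        rw [hl _ (by unfold Low; omega) (by omega) (by omega), hR.var]
        simp [Store.set, hx2, hx1]
      · rw [hl _ (by unfold Low; omega) (by omega) (by omega), hR.std.1]
      · rw [hl _ (by unfold Low; omega) (by omega) (by omega), hR.std.2]
    refine .seq (hp N (d + 4) _ ρ m hR') (From.triple ?_)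
    rintro ρ' m ⟨rfl, hl', hv⟩
    have hR'' := hR'.of_low hl'
    refine .seq (addr_spec hR''.std (by unfold Low; omega) (by unfold Low; omega)) (.store ?_)
    rintro ρ'' m ⟨rfl, hl'', hv'⟩
    rw [hl' 2 (by unfold Low; omega), hl' 4 (by unfold Low; omega), h2, h4] at hv'
    rw [hv', hl'' _ (by unfold Low; omega), hv]
    refine ⟨fun r hr => by rw [hl'' _ (by unfold Low at *; omega), hl' r hr], ?_, ?_⟩
    · intro B i' j' hi' hj'
      rw [Function.update_of_ne, hM B i' j' hi' hj']
      intro h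
      have := (adr_inj hi' hj' hi hj h).1
      omega
    · intro i' j' hi' hj' h
      by_cases hij : i' = i ∧ j' = j
      · rw [hij.1, hij.2, Function.update_self]
      · rw [Function.update_of_ne, hJ i' j' hi' hj' (by omega)]
        exact fun h => hij (adr_inj hi' hj' hi hj h).2
  · rintro ρ m ⟨hl, hM, hJ⟩
    have hR' : Std N ρ := ⟨by rw [hl _ (by unfold Low; omega), hR.std.1],
      by rw [hl _ (by unfold Low; omega), hR.std.2]⟩
    refine (each_spec (J := J₂) hR' ⟨fun B _ i j hi hj => hM B i j hi hj,
      fun i' j' hi' hj' => hJ i' j' hi' hj' (by omega), fun _ _ _ _ h => by omega⟩ ?_ ?_).mono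
      (fun _ _ => id) ?_ le_rfl
    · rintro i hi m ⟨h1, h2, h3⟩
      exact ⟨h1, h2, fun i' j' hi' hj' h => h3 i' j' hi' hj' (by omega)⟩
    · rintro i hi j hj ρ₁ m hl₁ h2 h4 ⟨hB, hS, hA⟩
      have hs₁ : Std N ρ₁ := ⟨by rw [hl₁ _ (by unfold Low; omega) (by omega) (by omega), hR'.1],
        by rw [hl₁ _ (by unfold Low; omega) (by omega) (by omega), hR'.2]⟩
      refine .seq (addr_spec hs₁ (by unfold Low; omega) (by unfold Low; omega)) ?_
      refine .seq (.load (B := fun ρ m' => m' = m ∧ (∀ r, Low (d + 4) r → ρ r = ρ₁ r) ∧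
        ρ t⟦d + 4⟧ = f i j) ?_) (From.triple ?_)
      · rintro ρ' m ⟨rfl, hl', hv⟩
        refine ⟨rfl, fun r hr => ?_, ?_⟩
        · rw [← hl' r hr]; unfold Low at hr; rw [Function.update_of_ne (by omega)]
        · rw [Function.update_self, hv, h2, h4, hS i j hi hj]
      rintro ρ₂ m ⟨rfl, hl₂, hv⟩
      have hs₂ : Std N ρ₂ := ⟨by rw [hl₂ _ (by unfold Low; omega), hs₁.1],
        by rw [hl₂ _ (by unfold Low; omega), hs₁.2]⟩
      refine .seq (addr_spec hs₂ (by unfold Low; omega) (by unfold Low; omega)) (.store ?_)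
      rintro ρ'' m ⟨rfl, hl'', hv'⟩
      rw [hl₂ 2 (by unfold Low; omega), hl₂ 4 (by unfold Low; omega), h2, h4] at hv'
      rw [hv', hl'' _ (by unfold Low; omega), hv]
      refine ⟨fun r hr => by rw [hl'' _ (by unfold Low at *; omega), hl₂ r hr], ?_, ?_, ?_⟩
      · intro B hBA i' j' hi' hj'
        rw [Function.update_of_ne, hB B hBA i' j' hi' hj']
        intro h
        have := (adr_inj hi' hj' hi hj h).1
        omega
      · intro i' j' hi' hj'
        rw [Function.update_of_ne, hS i' j' hi' hj']
        intro h
        have := (adr_inj hi' hj' hi hj h).1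
        omega
      · intro i' j' hi' hj' h
        by_cases hij : i' = i ∧ j' = j
        · rw [hij.1, hij.2, Function.update_self]
        · rw [Function.update_of_ne, hA i' j' hi' hj' (by omega)]
          exact fun h => hij (adr_inj hi' hj' hi hj h).2
    · rintro ρ' m' ⟨hl', hB, hS, hA⟩
      have hl'' : ∀ r, Low d r → ρ' r = ρ₀ r := fun r hr => (hl' r hr).trans (hl r hr)
      have hR'' := hR.of_low hl''
      refine ⟨hl'', hR''.var, hR''.std, fun B i j hi hj => ?_⟩
      rcases eq_or_ne B A with rfl | hBA
      · rw [hA i j hi hj (by omega)]; simp [Cmd.exec, Store.setArr, hf]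
      · rw [hB B hBA i j hi hj]; simp [Cmd.exec, Store.setArr, hBA]

/-- Only odd low registers are claimed to be unchanged, since the even ones hold the variables. The
odd ones include the counters of the enclosing loops. -/
theorem cmd_spec (c : Cmd) : ∃ p : Polynomial ℕ, ∀ (N d : ℕ) (s : Store) (ρ m : ℕ → ℕ),
    Rel N s ρ m → From (cmd c d) (p.eval N) ρ m fun ρ' m' =>
      (∀ r, Low d r → r % 2 = 1 → ρ' r = ρ r) ∧ Rel N (c.exec N s) ρ' m' := by
  have rel1 : ∀ {N s ρ m d}, Rel N s ρ m → Rel N s (Function.update ρ (t⟦d⟧) 0) m ∧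
      Rel N s (Function.update ρ 1 0) m := fun {N s ρ m d} h => by
    constructor <;>
    exact ⟨fun x => by rw [Function.update_of_ne (by omega), h.var],
      ⟨by rw [Function.update_of_ne (by omega), h.std.1],
        by rw [Function.update_of_ne (by omega), h.std.2]⟩, h.mem⟩
  induction c with
  | set x e =>
    obtain ⟨p, hp⟩ := expr_spec e
    refine ⟨p + (1 + 1), fun N d s ρ₀ m₀ hR => ?_⟩
    refine (Triple.seq (hp N d s ρ₀ m₀ hR) (.seq (.const (B := fun ρ m => Res d (e.eval N s) ρ₀ m₀ ρ m ∧
      ρ t⟦d + 1⟧ = 0) ?_) (.add ?_))).mono (fun _ _ => id) (fun _ _ => id) (by simp)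
    · rintro ρ m ⟨rfl, hl, hv⟩
      refine ⟨⟨rfl, fun r hr => ?_, ?_⟩, by simp⟩
      · rw [← hl r hr]; unfold Low at hr; rw [Function.update_of_ne (by omega)]
      · rw [Function.update_of_ne (by omega), hv]
    · rintro ρ m ⟨⟨rfl, hl, hv⟩, h0⟩
      refine ⟨fun r hr h => by rw [Function.update_of_ne (by omega), hl r hr], fun y => ?_, ⟨?_, ?_⟩,
        hR.mem⟩
      · rcases eq_or_ne y x with rfl | hy
        · simp [hv, h0, Cmd.exec, Store.set]
        · rw [Function.update_of_ne (by omega), hl _ (by unfold Low; omega), hR.var]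
          simp [Cmd.exec, Store.set, hy]
      · rw [Function.update_of_ne (by omega), hl _ (by unfold Low; omega), hR.std.1]
      · rw [Function.update_of_ne (by omega), hl _ (by unfold Low; omega), hR.std.2]
  | fill A e =>
    obtain ⟨p, hp⟩ := fill_spec A e
    exact ⟨p, fun N d s ρ m hR => (hp N d s ρ m hR).mono (fun _ _ => id)
      (fun ρ' m' h => ⟨fun r hr _ => h.1 r hr, h.2⟩) le_rfl⟩
  | seq c₁ c₂ ih₁ ih₂ =>
    obtain ⟨p₁, h₁⟩ := ih₁
    obtain ⟨p₂, h₂⟩ := ih₂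
    refine ⟨p₁ + p₂, fun N d s ρ m hR => ?_⟩
    refine (Triple.seq (h₁ N d s ρ m hR) (From.triple (T := p₂.eval N) ?_)).mono (fun _ _ => id)
      (fun _ _ => id) (by simp)
    rintro ρ' m' ⟨hl, hR'⟩
    refine (h₂ N d _ ρ' m' hR').mono (fun _ _ => id) ?_ le_rfl
    rintro ρ'' m'' ⟨hl', hR''⟩
    exact ⟨fun r hr h => (hl' r hr h).trans (hl r hr h), hR''⟩
  | ite e c₁ c₂ ih₁ ih₂ =>
    obtain ⟨p₀, h₀⟩ := expr_spec e
    obtain ⟨p₁, h₁⟩ := ih₁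
    obtain ⟨p₂, h₂⟩ := ih₂
    refine ⟨p₀ + (p₂ + p₁ + 3), fun N d s ρ₀ m₀ hR => ?_⟩
    refine (Triple.seq (h₀ N d s _ _ hR) (.ifZero (T₁ := p₂.eval N) (T₂ := p₁.eval N)
      ?_ (From.triple ?_) (From.triple ?_))).mono
      (fun _ _ => id) (fun _ _ => id) (by simp)
    · rintro ρ m ⟨hl, hR'⟩
      exact ⟨fun r hr h => by rw [Function.update_of_ne (by unfold Low at hr; omega), hl r hr h],
        (rel1 (d := 0) hR').2⟩
    · rintro ρ m ⟨⟨rfl, hl, hv⟩, h0⟩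
      refine (h₂ N d s ρ m (hR.of_low hl)).mono (fun _ _ => id) ?_ le_rfl
      rintro ρ' m' ⟨hl', hR'⟩
      exact ⟨fun r hr h => (hl' r hr h).trans (hl r hr), by rwa [Cmd.exec, ← hv, if_pos h0]⟩
    · rintro ρ m ⟨⟨rfl, hl, hv⟩, h0⟩
      refine (h₁ N d s ρ m (hR.of_low hl)).mono (fun _ _ => id) ?_ le_rfl
      rintro ρ' m' ⟨hl', hR'⟩
      exact ⟨fun r hr h => (hl' r hr h).trans (hl r hr), by rwa [Cmd.exec, ← hv, if_neg h0]⟩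
  | loop c ih =>
    obtain ⟨p, hp⟩ := ih
    refine ⟨1 + (1 + (Polynomial.X * ((p + 1) + 3) + 1)), fun N d s ρ₀ m₀ hR => ?_⟩
    let I := fun (j : ℕ) (ρ m : ℕ → ℕ) => (∀ r, Low d r → r % 2 = 1 → ρ r = ρ₀ r) ∧
      Rel N ((c.exec N)^[j] s) ρ m ∧ ρ t⟦d⟧ = N - j
    refine (Triple.seq (.const (B := fun ρ m => ρ = Function.update ρ₀ t⟦d + 1⟧ 0 ∧ m = m₀) ?_) <|
      .seq (.add ?_) (Triple.countdown (M := N) (I := I) (T := p.eval N + 1) ?_ ?_ ?_)).mono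
      (fun _ _ => id) (fun ρ m h => ⟨h.1, h.2.1⟩) (by simp)
    · rintro _ _ ⟨rfl, rfl⟩; exact ⟨rfl, rfl⟩
    · rintro ρ m ⟨rfl, rfl⟩
      rw [Function.update_self, Function.update_of_ne (by omega), hR.std.1, add_zero]
      refine ⟨fun r hr h => ?_, ⟨fun x => ?_, ⟨?_, ?_⟩, hR.mem⟩, by simp⟩
      · unfold Low at hr
        rw [Function.update_of_ne (by omega), Function.update_of_ne (by omega)]
      · rw [Function.update_of_ne (by omega), Function.update_of_ne (by omega), hR.var]; rfl
      · rw [Function.update_of_ne (by omega), Function.update_of_ne (by omega), hR.std.1]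
      · rw [Function.update_of_ne (by omega), Function.update_of_ne (by omega), hR.std.2]
    · rintro j ρ m ⟨hl, hR', hc⟩
      exact ⟨fun r hr h => by rw [Function.update_of_ne (by unfold Low at hr; omega), hl r hr h],
        (rel1 (d := 0) hR').2, by rw [Function.update_of_ne (by omega), hc]⟩
    · exact fun j _ ρ m h => h.2.2
    · intro j hj
      refine From.triple ?_
      rintro ρ m ⟨hl, hR', hc⟩
      refine .seq (hp N (d + 1) _ ρ m hR') (.sub ?_)
      rintro ρ' m' ⟨hl', hR''⟩
      refine ⟨fun r hr h => ?_, ⟨fun x => ?_, ⟨?_, ?_⟩, ?_⟩, ?_⟩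
      · rw [← hl r hr h]
        unfold Low at hr
        rw [Function.update_of_ne (by omega), hl' r (by unfold Low; omega) h]
      · rw [Function.update_of_ne (by omega), hR''.var, Function.iterate_succ_apply']
      · rw [Function.update_of_ne (by omega), hR''.std.1]
      · rw [Function.update_of_ne (by omega), hR''.std.2]
      · rw [Function.iterate_succ_apply']; exact hR''.mem
      · rw [Function.update_self, hl' _ (by unfold Low; omega) (by omega), hc, hR''.std.2]; omega

end Compile

/-- The store at the start: the input stands in row `0` of array `0`, its length in variable `0`. -/
def Store.init (w : List ℕ) : Store where
  v := fun x => if x = 0 then w.length else 0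
  a := fun A i j => if A = 0 ∧ i = 0 then w.getD j 0 else 0

/-- A decision problem is solvable in polynomial time if it is solved by a program of the language
with bounded loops. -/
theorem polyTimeSolvableOn_of_cmd {α : Type} (enc : α → List ℕ) (C Q : α → Prop) (c : Cmd)
    (h : ∀ x, C x →
      (Q x → (c.exec (enc x).length (Store.init (enc x))).v 0 = 1) ∧
      (¬ Q x → (c.exec (enc x).length (Store.init (enc x))).v 0 = 0)) :
    PolyTimeSolvableOn enc C Q := by
  obtain ⟨p, hp⟩ := Compile.cmd_spec c
  refine ⟨(Code.seq (.const 5 1) (.seq (.add 3 0 1) (Compile.cmd c 0))).assemble 0, 1 + (1 + p),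
    fun x hx => ?_⟩
  set w := enc x
  set N := w.length with hN
  have hR : Compile.Rel N (Store.init w) (Function.update (Function.update
      (RAM.init w).reg 5 1) 3 N) (RAM.init w).mem := by
    refine ⟨fun x => ?_, ⟨by simp, by simp⟩, fun A i j hi hj => ?_⟩
    · rw [Function.update_of_ne (by omega), Function.update_of_ne (by omega)]
      simp [RAM.init, Store.init]
    · simp only [RAM.init, Store.init]
      split_ifs with hA
      · simp [Compile.adr, hA.1, hA.2]
      · rw [List.getD_eq_default]
        rw [← hN]
        -- All cells outside row `0` of array `0` lie at addresses at least `N`, beyond the input,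
        -- and hold `0`. So the initial memory already represents the initial store.
        have hAi : 1 ≤ 2 * A * N + i := by
          by_contra hcon
          have h0 : 2 * A * N = 0 := by omega
          simp at h0
          omega
        calc N = 1 * N := (one_mul N).symm
          _ ≤ (2 * A * N + i) * N := Nat.mul_le_mul_right N hAi
          _ ≤ _ := Nat.le_add_right _ _
  have key : (Code.seq (.const 5 1) (.seq (.add 3 0 1) (Compile.cmd c 0))).Triple
      ((1 + (1 + p)).eval N) (fun ρ m => ρ = (RAM.init w).reg ∧ m = (RAM.init w).mem)
      (fun ρ m => Compile.Rel N (c.exec N (Store.init w)) ρ m) := by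
    refine (Code.Triple.seq (.const (B := fun ρ m => ρ = Function.update (RAM.init w).reg 5 1 ∧
      m = (RAM.init w).mem) ?_) (.seq (.add ?_) (hp N 0 _ _ _ hR))).mono (fun _ _ => id)
      (fun _ _ h => h.2) (by simp)
    · rintro ρ m ⟨rfl, rfl⟩; exact ⟨rfl, rfl⟩
    · rintro ρ m ⟨rfl, rfl⟩
      refine ⟨?_, rfl⟩
      simp [RAM.init, hN]
  obtain ⟨ρ, m, t, ht, he, hR'⟩ := key _ _ ⟨rfl, rfl⟩
  have hrun := he.run _ 0 (fun i _ => by rw [Nat.zero_add])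
  refine ⟨t, ht, ?_, ?_⟩
  · rw [show RAM.init w = ⟨0, (RAM.init w).reg, (RAM.init w).mem⟩ from rfl, hrun]
    simp [Halted]
  · rw [show RAM.init w = ⟨0, (RAM.init w).reg, (RAM.init w).mem⟩ from rfl, hrun]
    have := hR'.var 0
    simp only [mul_zero] at this
    change (Q x → ρ 0 = 1) ∧ (¬ Q x → ρ 0 = 0)
    rw [this]
    exact h x hx

end RAM

/-! ### Perfect matchings -/

section PerfectMatchings

set_option linter.unusedSectionVars false

variable {V : Type*} [DecidableEq V] {E : V → V → Prop}

/-- `μ` is a perfect matching of the graph that `E` induces on `S`. -/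
def IsPM (E : V → V → Prop) (S : Finset V) (μ : V → V) : Prop :=
  ∀ v ∈ S, μ v ∈ S ∧ E v (μ v) ∧ μ (μ v) = v

/-- The graph that `E` induces on `S` has a perfect matching. -/
def HasPM (E : V → V → Prop) (S : Finset V) : Prop := ∃ μ, IsPM E S μ

theorem HasPM.mono {E' : V → V → Prop} {S : Finset V} (h : HasPM E S)
    (hE : ∀ a ∈ S, ∀ b ∈ S, E a b → E' a b) : HasPM E' S := by
  obtain ⟨μ, hμ⟩ := h
  exact ⟨μ, fun v hv => ⟨(hμ v hv).1, hE _ hv _ (hμ v hv).1 (hμ v hv).2.1, (hμ v hv).2.2⟩⟩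

theorem HasPM.empty : HasPM E ∅ := ⟨id, by simp [IsPM]⟩

theorem HasPM.union {S T : Finset V} (hS : HasPM E S) (hT : HasPM E T) (hd : Disjoint S T) :
    HasPM E (S ∪ T) := by
  obtain ⟨μ, hμ⟩ := hS
  obtain ⟨ν, hν⟩ := hT
  refine ⟨fun v => if v ∈ S then μ v else ν v, fun v hv => ?_⟩
  by_cases h : v ∈ S
  · obtain ⟨h1, h2, h3⟩ := hμ v h
    simp [h, h1, h2, h3]
  · obtain ⟨h1, h2, h3⟩ := hν v (by simpa [h] using hv)
    have : ν v ∉ S := fun h' => Finset.disjoint_left.mp hd h' h1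
    simp [h, h1, h2, h3, this]

theorem HasPM.pair {a b : V} (hab : E a b) (hba : E b a) (hne : a ≠ b) : HasPM E {a, b} := by
  refine ⟨fun v => if v = a then b else a, fun v hv => ?_⟩
  simp only [Finset.mem_insert, Finset.mem_singleton] at hv
  rcases hv with rfl | rfl
  · simp [hab, hne.symm]
  · simp [hba, hne.symm]

theorem HasPM.insert_pair {S T : Finset V} {a b : V} (h : HasPM E S) (hab : E a b) (hba : E b a)
    (hne : a ≠ b) (ha : a ∉ S) (hb : b ∉ S) (hT : ∀ v, v ∈ T ↔ v ∈ S ∨ v = a ∨ v = b) :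
    HasPM E T := by
  have := h.union (HasPM.pair hab hba hne) (by simp [Finset.disjoint_insert_right, ha, hb])
  convert this using 1
  ext v
  simp [hT, or_comm, or_assoc]

theorem HasPM.of_card_eq {S T : Finset V} (hd : Disjoint S T) (hc : S.card = T.card)
    (h : ∀ a ∈ S, ∀ b ∈ T, E a b ∧ E b a) : HasPM E (S ∪ T) := by
  induction S using Finset.induction_on generalizing T with
  | empty =>
    rw [Finset.card_empty, eq_comm, Finset.card_eq_zero] at hc
    subst hc
    exact HasPM.empty
  | insert a S ha ih =>
    have hpos : T.Nonempty := by
      rw [← Finset.card_pos, ← hc, Finset.card_insert_of_notMem ha]; omega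
    obtain ⟨b, hb⟩ := hpos
    rw [Finset.disjoint_insert_left] at hd
    have hab : a ≠ b := fun h => hd.1 (h ▸ hb)
    have hbS : b ∉ S := fun h => Finset.disjoint_left.mp hd.2 h hb
    refine (ih (T := T.erase b) (hd.2.mono_right (Finset.erase_subset _ _)) ?_
      fun a' ha' b' hb' => h a' (by simp [ha']) b' (Finset.mem_of_mem_erase hb')).insert_pair
      (h a (by simp) b hb).1 (h a (by simp) b hb).2 hab ?_ ?_ ?_
    · rw [Finset.card_erase_of_mem hb, ← hc, Finset.card_insert_of_notMem ha]; omega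
    · simp [ha, hab, hd.1]
    · simp [hbS]
    · intro v
      by_cases hv : v = b
      · simp [hv, hb]
      · simp [hv]; tauto

theorem IsPM.injOn {S : Finset V} {μ : V → V} (h : IsPM E S μ) : Set.InjOn μ S := by
  intro a ha b hb hab
  rw [← (h a ha).2.2, hab, (h b hb).2.2]

/-- The matching that arises when `w` is given the new partner `u`. -/
def exchange (μ : V → V) (u w : V) : V → V := Function.update (Function.update μ u w) w u

/-- `E` is the adjacency relation of a graph. -/
structure IsGraph (E : V → V → Prop) : Prop where
  symm : ∀ {a b}, E a b → E b a
  irrefl : ∀ a, ¬ E a a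

theorem IsGraph.ne (hE : IsGraph E) {a b : V} (h : E a b) : a ≠ b := by
  rintro rfl
  exact hE.irrefl a h

/-- The former partner `μ w` becomes unmatched in place of `u`; all other vertices keep their
partners. -/
theorem IsPM.exchange (hE : IsGraph E) {S T : Finset V} {μ : V → V} (h : IsPM E S μ) {u w : V}
    (hu : u ∉ S) (hw : w ∈ S) (huw : E u w) (hT : ∀ v, v ∈ T ↔ v ≠ μ w ∧ (v = u ∨ v ∈ S)) :
    IsPM E T (exchange μ u w) := by
  have hne : u ≠ w := hE.ne huw
  obtain ⟨hμw, hEw, hμμ⟩ := h w hw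
  have hwμ : w ≠ μ w := hE.ne hEw
  intro v hv
  obtain ⟨h1, h2⟩ := (hT v).1 hv
  rcases eq_or_ne v w with rfl | hvw
  · simp only [_root_.exchange, Function.update_self, hE.symm huw, Function.update_of_ne hne, and_self,
      and_true]
    exact (hT u).2 ⟨fun e => hu (e ▸ hμw), Or.inl rfl⟩
  rcases h2 with rfl | h2
  · simp only [_root_.exchange, Function.update_of_ne hvw, Function.update_self, huw, and_self,
      and_true]
    exact (hT w).2 ⟨hwμ, Or.inr hw⟩
  · have hvu : v ≠ u := fun e => hu (e ▸ h2)
    obtain ⟨h3, h4, h5⟩ := h v h2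
    have h6 : μ v ≠ w := fun e => h1 (by rw [← e, h5])
    have h7 : μ v ≠ u := fun e => hu (e ▸ h3)
    simp only [_root_.exchange, Function.update_of_ne hvw, Function.update_of_ne hvu,
      Function.update_of_ne h6, Function.update_of_ne h7, h4, h5, and_true]
    refine (hT _).2 ⟨fun e => ?_, Or.inr h3⟩
    exact hvw (h.injOn h2 hw e)

/-! ### Contraction of blossoms -/

/-- The graph that arises when the set `C` is contracted to its element `u`. -/
def contract (E : V → V → Prop) (C : Finset V) (u : V) (a b : V) : Prop :=
  (a ∉ C ∧ b ∉ C ∧ E a b) ∨ (a = u ∧ b ∉ C ∧ ∃ c ∈ C, E c b) ∨ (b = u ∧ a ∉ C ∧ ∃ c ∈ C, E c a)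

theorem IsGraph.contract (hE : IsGraph E) {C : Finset V} {u : V} (hu : u ∈ C) :
    IsGraph (contract E C u) where
  symm := by
    rintro a b (⟨ha, hb, h⟩ | h | h)
    · exact Or.inl ⟨hb, ha, hE.symm h⟩
    · exact Or.inr (Or.inr h)
    · exact Or.inr (Or.inl h)
  irrefl := by
    rintro a (⟨-, -, h⟩ | ⟨rfl, h, -⟩ | ⟨rfl, h, -⟩)
    · exact hE.irrefl a h
    · exact h hu
    · exact h hu

/-- The partner `w` of the contracted vertex is joined in `E` to some `c ∈ C`. Use the edge `c w`,
match the rest of `C` by factor-criticality, and keep all other partners. -/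
theorem HasPM.of_contract (hE : IsGraph E) {C L L' : Finset V} {u : V} (hu : u ∈ C) (hC : C ⊆ L)
    (hL : ∀ v, v ∈ L' ↔ v = u ∨ (v ∈ L ∧ v ∉ C)) (hfc : ∀ c ∈ C, HasPM E (C.erase c))
    (h : HasPM (contract E C u) L') : HasPM E L := by
  obtain ⟨μ, hμ⟩ := h
  obtain ⟨hw, hadj, huw⟩ := hμ u ((hL u).2 (Or.inl rfl))
  set w := μ u
  obtain ⟨hwC, c, hc, hcw⟩ : w ∉ C ∧ ∃ c ∈ C, E c w := by
    rcases hadj with ⟨h, -⟩ | ⟨-, h⟩ | ⟨-, h, -⟩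
    · exact absurd hu h
    · exact h
    · exact absurd hu h
  have hwL : w ∈ L := by
    rcases (hL w).1 hw with h | h
    · exact absurd (h ▸ hu) hwC
    · exact h.1
  have h1 : HasPM E ((L \ C).erase w) := by
    refine ⟨μ, fun v hv => ?_⟩
    simp only [Finset.mem_erase, Finset.mem_sdiff] at hv ⊢
    obtain ⟨h1, h2, h3⟩ := hμ v ((hL v).2 (Or.inr hv.2))
    have hvu : v ≠ u := fun e => hv.2.2 (e ▸ hu)
    have hne : μ v ≠ u := fun e => hv.1 (by rw [← h3, e])
    refine ⟨⟨fun e => hvu (by rw [← h3, e, huw]), ((hL _).1 h1).resolve_left hne⟩, ?_, h3⟩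
    rcases h2 with h | h | h
    · exact h.2.2
    · exact absurd h.1 hvu
    · exact absurd h.1 hne
  have h2 := h1.union (hfc c hc) (by
    rw [Finset.disjoint_left]
    intro v hv hv'
    exact (Finset.mem_sdiff.1 (Finset.mem_of_mem_erase hv)).2 (Finset.mem_of_mem_erase hv'))
  refine h2.insert_pair hcw (hE.symm hcw) (fun e => hwC (e ▸ hc)) ?_ ?_ ?_
  · simp [hc]
  · simp [hwC]
  · intro v
    simp only [Finset.mem_union, Finset.mem_erase, Finset.mem_sdiff]
    by_cases hvC : v ∈ C
    · have : v ∈ L := hC hvC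
      by_cases v = c <;> simp_all
    · by_cases v = w <;> by_cases v = c <;> simp_all

/-- Follow the path that alternates between `N` and `M` from `f`, the one vertex of `L \ C` missed
by `M`. If `N f` lies in `C`, an exit is found. Otherwise matching `f` to `N f` moves the missed
vertex to `M (N f)`, and fewer vertices are left on which the matching differs from `N`. -/
theorem exists_exit (hE : IsGraph E) {C L : Finset V} {N : V → V} (hN : IsPM E L N) :
    ∀ (k : ℕ) (f : V) (M : V → V), f ∈ L → f ∉ C → IsPM E ((L \ C).erase f) M →
      (((L \ C).erase f).filter fun v => M v ≠ N v).card = k →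
      ∃ c ∈ C, ∃ w ∈ L \ C, E c w ∧ HasPM E ((L \ C).erase w) := by
  intro k
  induction k using Nat.strong_induction_on with
  | _ k ih =>
    intro f M hf hfC hM hk
    obtain ⟨hy, hfy, hNy⟩ := hN f hf
    set y := N f
    by_cases hyC : y ∈ C
    · exact ⟨y, hyC, f, by simp [hf, hfC], hE.symm hfy, M, hM⟩
    have hyf : y ≠ f := (hE.ne hfy).symm
    have hyS : y ∈ (L \ C).erase f := by simp [hyf, hy, hyC]
    obtain ⟨hz, hyz, hMz⟩ := hM y hyS
    set z := M y
    have hzf : z ≠ f := Finset.ne_of_mem_erase hz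
    have hfS : f ∈ L \ C := by simp [hf, hfC]
    have hz' := Finset.mem_sdiff.1 (Finset.mem_of_mem_erase hz)
    have hM' : IsPM E ((L \ C).erase z) (exchange M f y) := by
      refine hM.exchange hE (by simp) hyS hfy fun v => ?_
      simp only [Finset.mem_erase]
      by_cases hvf : v = f
      · subst hvf; simp [hfS, z]
      · simp [hvf, z]
    refine ih _ ?_ z _ hz'.1 hz'.2 hM' rfl
    rw [← hk]
    refine Finset.card_lt_card (Finset.ssubset_iff_of_subset ?_ |>.2 ⟨y, ?_, ?_⟩)
    · intro v hv
      rw [Finset.mem_filter, Finset.mem_erase] at hv ⊢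
      simp only [exchange] at hv
      by_cases hvy : v = y
      · subst hvy; simp [hNy] at hv
      by_cases hvf : v = f
      · subst hvf; simp [hvy, y] at hv
      · simpa [hvy, hvf, hv.1.2] using hv.2
    · simp only [Finset.mem_filter]
      exact ⟨hyS, by rw [hNy]; exact hzf⟩
    · rw [Finset.mem_filter]; simp [exchange, hNy]

/-- A perfect matching of `L` may use many edges between `C` and its complement. By `exists_exit`
there is also an edge `c w` out of `C` such that the vertices outside `C` other than `w` can be
matched among themselves; it becomes the edge from `u` to `w`. -/
theorem HasPM.contract (hE : IsGraph E) {C L L' : Finset V} {u f : V} {M : V → V} (hu : u ∈ C)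
    (hL : ∀ v, v ∈ L' ↔ v = u ∨ (v ∈ L ∧ v ∉ C)) (hf : f ∈ L) (hfC : f ∉ C)
    (hM : IsPM (_root_.contract E C u) ((L'.erase u).erase f) M)
    (h : HasPM E L) : HasPM (_root_.contract E C u) L' := by
  obtain ⟨N, hN⟩ := h
  have hset : ∀ w, (L'.erase u).erase w = (L \ C).erase w := fun w => by
    ext v
    simp only [Finset.mem_erase, Finset.mem_sdiff, hL]
    by_cases hvu : v = u
    · subst hvu; simp [hu]
    · simp [hvu]
  have hEe : ∀ a ∈ L \ C, ∀ b ∈ L \ C, _root_.contract E C u a b ↔ E a b := by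
    intro a ha b hb
    have ha' := (Finset.mem_sdiff.1 ha).2
    have hb' := (Finset.mem_sdiff.1 hb).2
    have : a ≠ u := fun e => ha' (e ▸ hu)
    have : b ≠ u := fun e => hb' (e ▸ hu)
    simp [_root_.contract, *]
  rw [hset] at hM
  have hM' : IsPM E ((L \ C).erase f) M := fun v hv =>
    ⟨(hM v hv).1, (hEe _ (Finset.mem_of_mem_erase hv) _ (Finset.mem_of_mem_erase (hM v hv).1)).1
      (hM v hv).2.1, (hM v hv).2.2⟩
  obtain ⟨c, hc, w, hw, hcw, hPM⟩ := exists_exit hE hN _ f M hf hfC hM' rfl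
  have hw' := Finset.mem_sdiff.1 hw
  have huw : u ≠ w := fun e => hw'.2 (e ▸ hu)
  have hadj : _root_.contract E C u u w := Or.inr (Or.inl ⟨rfl, hw'.2, c, hc, hcw⟩)
  refine (hPM.mono (E' := _root_.contract E C u) fun a ha b hb hab =>
    (hEe _ (Finset.mem_of_mem_erase ha) _ (Finset.mem_of_mem_erase hb)).2 hab).insert_pair hadj
    ((hE.contract hu).symm hadj) huw (by simp [hu]) (by simp) fun v => ?_
  simp only [Finset.mem_erase, Finset.mem_sdiff, hL]
  by_cases v = u <;> by_cases v = w <;> simp_all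

/-! ### Search trees -/

/-- A search from the root `r` for an alternating path to `f`, where `m` is a perfect matching of
`L \ {r, f}`: for the vertices `u` in `D` a perfect matching `R u` of `L \ {u, f}` is known. -/
structure IsSearch (E : V → V → Prop) (L : Finset V) (r f : V) (m : V → V) (D : Finset V)
    (R : V → V → V) : Prop where
  root : r ∈ D
  sub : ∀ u ∈ D, u ∈ L ∧ u ≠ f
  pm : ∀ u ∈ D, IsPM E ((L.erase u).erase f) (R u)
  partner : ∀ u ∈ D, ∀ a ∈ L, a ≠ f → a ∉ D → R u a = m a ∨ m a ∈ D

theorem IsSearch.init {L : Finset V} {r f : V} {m : V → V} (hr : r ∈ L) (hrf : r ≠ f)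
    (hm : IsPM E ((L.erase r).erase f) m) {R : V → V → V} (hR : R r = m) :
    IsSearch E L r f m {r} R where
  root := by simp
  sub := by simp [hr, hrf]
  pm := by simpa [hR] using hm
  partner := by simp [hR]

/-- Matching `u` to `w` frees the partner `x` of `w`, so a matching that misses `x` and the goal is
known. The condition `partner` survives: the only vertex outside the enlarged set whose partner may
have changed is `w`, and `m w` is either `x` or already reached. -/
theorem IsSearch.insert (hE : IsGraph E) {L D : Finset V} {r f : V} {m : V → V} {R : V → V → V}
    (h : IsSearch E L r f m D R) {u w : V} (hu : u ∈ D) (hw : w ∈ L) (huw : E u w) (hwf : w ≠ f)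
    (hx : R u w ∉ D) :
    IsSearch E L r f m (insert (R u w) D) (Function.update R (R u w) (exchange (R u) u w)) := by
  have hwu : w ≠ u := (hE.ne huw).symm
  have hwS : w ∈ (L.erase u).erase f := by simp [hw, hwf, hwu]
  obtain ⟨hxS, hwx, hxw⟩ := h.pm u hu w hwS
  set x := R u w with hxdef
  simp only [Finset.mem_erase] at hxS
  refine ⟨by simp [h.root], fun v hv => ?_, fun v hv => ?_, fun v hv a ha haf haD => ?_⟩
  · rcases Finset.mem_insert.1 hv with rfl | hv
    · exact ⟨hxS.2.2, hxS.1⟩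
    · exact h.sub v hv
  · by_cases hvx : v = x
    · subst hvx
      rw [Function.update_self]
      refine (h.pm u hu).exchange hE (by simp) hwS huw fun v => ?_
      simp only [Finset.mem_erase]
      by_cases hvu : v = u
      · subst hvu
        simp [h.sub v hu, hxdef]
      · simp [hvu, hxdef]; tauto
    · rw [Function.update_of_ne hvx]
      exact h.pm v ((Finset.mem_insert.1 hv).resolve_left hvx)
  · simp only [Finset.mem_insert, not_or] at haD
    by_cases hvx : v = x
    · subst hvx
      rw [Function.update_self]
      have hau : a ≠ u := fun e => haD.2 (e ▸ hu)
      by_cases haw : a = w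
      · subst haw
        rcases h.partner u hu a ha haf haD.2 with h1 | h1
        · right; rw [← h1, hxdef]; simp
        · right; simp [h1]
      · simp only [exchange, Function.update_of_ne haw, Function.update_of_ne hau]
        exact (h.partner u hu a ha haf haD.2).imp_right fun h => Finset.mem_insert_of_mem h
    · rw [Function.update_of_ne hvx]
      exact (h.partner v ((Finset.mem_insert.1 hv).resolve_left hvx) a ha haf haD.2).imp_right
        fun h => Finset.mem_insert_of_mem h

theorem IsSearch.hasPM (hE : IsGraph E) {L D : Finset V} {r f : V} {m : V → V} {R : V → V → V}
    (h : IsSearch E L r f m D R) (hf : f ∈ L) {u : V} (hu : u ∈ D) (huf : E u f) : HasPM E L := by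
  refine HasPM.insert_pair ⟨R u, h.pm u hu⟩ huf (hE.symm huf) (hE.ne huf) (by simp) (by simp)
    fun v => ?_
  simp only [Finset.mem_erase]
  have := (h.sub u hu).1
  by_cases v = u <;> by_cases v = f <;> simp_all

/-- A perfect matching `N` would send every reached vertex `u` outside `D` and not to `f`. Closure
together with `partner` gives `m (N u) ∈ D`, and `m (N u) ≠ r` since `m` misses the root. So `u ↦ m
(N u)` would be an injection of `D` into `D \ {r}`. -/
theorem IsSearch.not_hasPM {L D : Finset V} {r f : V} {m : V → V} {R : V → V → V}
    (h : IsSearch E L r f m D R) (hm : IsPM E ((L.erase r).erase f) m)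
    (hf : ∀ u ∈ D, ¬ E u f) (hD : ∀ u ∈ D, ∀ w ∈ D, ¬ E u w)
    (hcl : ∀ u ∈ D, ∀ w ∈ L, E u w → w ≠ f → R u w ∈ D) : ¬ HasPM E L := by
  rintro ⟨N, hN⟩
  have hNL : ∀ u ∈ D, N u ∈ L ∧ N u ≠ f ∧ N u ∉ D ∧ E u (N u) := fun u hu => by
    obtain ⟨h1, h2, -⟩ := hN u (h.sub u hu).1
    exact ⟨h1, fun e => hf u hu (e ▸ h2), fun h' => hD u hu _ h' h2, h2⟩
  have hS : ∀ u ∈ D, N u ∈ (L.erase r).erase f := fun u hu => by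
    obtain ⟨h1, h2, h3, -⟩ := hNL u hu
    simp only [Finset.mem_erase]
    exact ⟨h2, fun e => h3 (e ▸ h.root), h1⟩
  have hcard : D.card ≤ (D.erase r).card := by
    refine Finset.card_le_card_of_injOn (fun u => m (N u)) (fun u hu => ?_) fun u hu v hv huv => ?_
    · obtain ⟨h1, h2, h3, h4⟩ := hNL u hu
      have h5 := (hm _ (hS u hu)).1
      simp only [Finset.mem_erase] at h5
      refine Finset.mem_coe.2 (Finset.mem_erase.2 ⟨h5.2.1, ?_⟩)
      have h6 := hcl u hu _ h1 h4 h2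
      rcases h.partner u hu _ h1 h2 h3 with h7 | h7
      · show m (N u) ∈ D
        rwa [← h7]
      · exact h7
    · have h1 := hm.injOn (hS u hu) (hS v hv) huv
      exact hN.injOn (h.sub u hu).1 (h.sub v hv).1 h1
  have := Finset.card_erase_lt_of_mem h.root
  omega

/-! ### Blossoms -/

/-- A set `C` that carries an alternating path from `u` to `x`. -/
structure IsBlossomPath (E : V → V → Prop) (C : Finset V) (u x : V) : Prop where
  left : u ∈ C
  right : x ∈ C
  pm : ∀ c ∈ C, HasPM E (C.erase c) ∨
    (c ≠ u ∧ c ≠ x ∧ u ≠ x ∧ HasPM E (((C.erase c).erase u).erase x))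

theorem IsBlossomPath.init (u : V) : IsBlossomPath E {u} u u :=
  ⟨by simp, by simp, by simp [HasPM.empty]⟩

/-- Number the vertices of the path from `u = v₀`. Removing a vertex of even index leaves two pieces
of even order, hence a perfect matching. Removing one of odd index leaves two odd pieces, which
become matchable once the ends `u` and `x` are dropped as well. The new `y` is of odd index and the
new end `z` of even index. -/
theorem IsBlossomPath.insert (hE : IsGraph E) {C : Finset V} {u x y z : V}
    (h : IsBlossomPath E C u x) (hxy : E x y) (hyz : E y z) (hy : y ∉ C) (hz : z ∉ C) :
    IsBlossomPath E (insert y (insert z C)) u z := by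
  have hu := h.left
  have hx := h.right
  have hyz' := hE.ne hyz
  have huy : u ≠ y := fun e => hy (e ▸ hu)
  have huz : u ≠ z := fun e => hz (e ▸ hu)
  have hxy' := hE.ne hxy
  have hxz : x ≠ z := fun e => hz (e ▸ hx)
  refine ⟨by simp [hu], by simp, fun c hc => ?_⟩
  rcases Finset.mem_insert.1 hc with rfl | hc
  · rcases h.pm u hu with h1 | h1
    · refine Or.inr ⟨huy.symm, hyz', huz, ?_⟩
      convert h1 using 1
      ext v
      simp only [Finset.mem_erase, Finset.mem_insert]
      by_cases v = z <;> by_cases v = c <;> simp_all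
    · exact absurd rfl h1.1
  rcases Finset.mem_insert.1 hc with rfl | hc
  · rcases h.pm x hx with h1 | h1
    · refine Or.inl (h1.insert_pair hxy (hE.symm hxy) hxy' (by simp) (by simp [hy]) fun v => ?_)
      simp only [Finset.mem_erase, Finset.mem_insert]
      by_cases v = c <;> by_cases v = y <;> by_cases v = x <;> simp_all
    · exact absurd rfl h1.2.1
  · have hcy : c ≠ y := fun e => hy (e ▸ hc)
    have hcz : c ≠ z := fun e => hz (e ▸ hc)
    rcases h.pm c hc with h1 | ⟨h1, h2, h3, h4⟩
    · refine Or.inl (h1.insert_pair hyz (hE.symm hyz) hyz' (by simp [hy]) (by simp [hz]) fun v => ?_)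
      simp only [Finset.mem_erase, Finset.mem_insert]
      by_cases v = c <;> by_cases v = y <;> by_cases v = z <;> simp_all
    · refine Or.inr ⟨h1, hcz, huz, h4.insert_pair hxy (hE.symm hxy) hxy' (by simp) (by simp [hy])
        fun v => ?_⟩
      simp only [Finset.mem_erase, Finset.mem_insert]
      by_cases v = z <;> by_cases v = y <;> by_cases v = x <;> by_cases v = c <;> by_cases v = u <;>
        simp_all

/-- The closing edge matches the two ends that had to be dropped when a vertex of odd index was
removed. -/
theorem IsBlossomPath.factorCritical (hE : IsGraph E) {C : Finset V} {u x : V}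
    (h : IsBlossomPath E C u x) (hux : E u x) : ∀ c ∈ C, HasPM E (C.erase c) := by
  intro c hc
  rcases h.pm c hc with h1 | ⟨h1, h2, h3, h4⟩
  · exact h1
  · refine h4.insert_pair hux (hE.symm hux) h3 (by simp) (by simp) fun v => ?_
    have := h.left
    have := h.right
    simp only [Finset.mem_erase]
    by_cases v = u <;> by_cases v = x <;> by_cases v = c <;> simp_all

/-- The path in the union of two matchings `M` and `M'` that starts in the vertex `u` missed by `M`,
followed up to `x`. -/
structure IsBlossomWalk (E : V → V → Prop) (M M' : V → V) (C : Finset V) (u x : V) : Prop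
    extends IsBlossomPath E C u x where
  closed : ∀ c ∈ C, c ≠ u → M c ∈ C ∧ M c ≠ u
  closed' : ∀ c ∈ C, c ≠ x → M' c ∈ C ∧ M' c ≠ x

theorem IsBlossomWalk.init (M M' : V → V) (u : V) : IsBlossomWalk E M M' {u} u u :=
  ⟨.init u, by simp, by simp⟩

/-- The two new vertices are fresh: `M'` maps `C` without `x` into itself, so the `M'`-partner of
`x` lies outside `C`, and `M` maps `C` without `u` into itself, so the `M`-partner of that vertex
lies outside as well. Neither can be `f`, which both matchings miss. -/
theorem IsBlossomWalk.step (hE : IsGraph E) {L C : Finset V} {M M' : V → V} {u z f x : V}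
    (h : IsBlossomWalk E M M' C u x) (hM : IsPM E ((L.erase u).erase f) M)
    (hM' : IsPM E ((L.erase z).erase f) M') (hC : ∀ c ∈ C, c ∈ L ∧ c ≠ f) (hxz : x ≠ z) :
    IsBlossomWalk E M M' (insert (M' x) (insert (M (M' x)) C)) u (M (M' x)) ∧
      (∀ c ∈ insert (M' x) (insert (M (M' x)) C), c ∈ L ∧ c ≠ f) ∧
      M' x ∉ C ∧ M (M' x) ∉ C ∧ M' x ≠ M (M' x) := by
  have hx := hC x h.right
  obtain ⟨h1, h2, h3⟩ := hM' x (by simp [hxz, hx])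
  set y := M' x with hy
  simp only [Finset.mem_erase] at h1
  have hyx := (hE.ne h2).symm
  have hyC : y ∉ C := fun hyC => (h.closed' y hyC hyx).2 h3
  have hyu : y ≠ u := fun e => hyC (e ▸ h.left)
  obtain ⟨h4, h5, h6⟩ := hM y (by simp [hyu, h1])
  set w := M y with hw
  simp only [Finset.mem_erase] at h4
  have hyw := hE.ne h5
  have hwC : w ∉ C := fun hwC => hyC (h6 ▸ (h.closed w hwC h4.2.1).1)
  refine ⟨⟨h.toIsBlossomPath.insert hE h2 h5 hyC hwC, fun c hc hcu => ?_, fun c hc hcw => ?_⟩,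
    fun c hc => ?_, hyC, hwC, hyw⟩
  · rcases Finset.mem_insert.1 hc with rfl | hc
    · rw [← hw]; simp [h4]
    rcases Finset.mem_insert.1 hc with rfl | hc
    · rw [h6]; simp [hyu]
    · exact ⟨by simp [(h.closed c hc hcu).1], (h.closed c hc hcu).2⟩
  · rcases Finset.mem_insert.1 hc with rfl | hc
    · rw [h3]
      exact ⟨by simp [h.right], fun e => hwC (e ▸ h.right)⟩
    have hc := (Finset.mem_insert.1 hc).resolve_left hcw
    by_cases hcx : c = x
    · subst hcx; rw [← hy]; exact ⟨by simp, hyw⟩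
    · have := (h.closed' c hc hcx).1
      exact ⟨by simp [this], fun e => hwC (e ▸ this)⟩
  · rcases Finset.mem_insert.1 hc with rfl | hc
    · exact ⟨h1.2.2, h1.1⟩
    rcases Finset.mem_insert.1 hc with rfl | hc
    · exact ⟨h4.2.2, h4.1⟩
    · exact hC c hc

/-- `M` misses `u` and matches the rest of `C` within `C`, so no edge of `M` leaves the blossom. -/
theorem IsBlossomWalk.contract {L L' C : Finset V} {M M' : V → V} {u f x : V}
    (h : IsBlossomWalk E M M' C u x) (hM : IsPM E ((L.erase u).erase f) M)
    (hL : ∀ v, v ∈ L' ↔ v = u ∨ (v ∈ L ∧ v ∉ C)) :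
    IsPM (contract E C u) ((L'.erase u).erase f) M := by
  intro v hv
  have hv' := hv
  simp only [Finset.mem_erase, hL] at hv'
  obtain ⟨hvf, hvu, hv'⟩ := hv'
  have hv' := hv'.resolve_left hvu
  obtain ⟨h1, h2, h3⟩ := hM v (by simp [hvf, hvu, hv'])
  simp only [Finset.mem_erase] at h1
  have h4 : M v ∉ C := fun hC => hv'.2 (h3 ▸ (h.closed _ hC h1.2.1).1)
  refine ⟨?_, Or.inl ⟨hv'.2, h4, h2⟩, h3⟩
  simp only [Finset.mem_erase, hL]
  exact ⟨h1.1, h1.2.1, Or.inr ⟨h1.2.2, h4⟩⟩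

end PerfectMatchings

/-! ### Graphs and vertex sets in a store -/

namespace RAM

namespace Store

@[simp] theorem set_v (s : Store) (x n y : ℕ) :
    (s.set x n).v y = if y = x then n else s.v y := by
  simp [Store.set, Function.update_apply]

@[simp] theorem set_a (s : Store) (x n : ℕ) : (s.set x n).a = s.a := rfl

@[simp] theorem setArr_v (s : Store) (A : ℕ) (f : ℕ → ℕ → ℕ) : (s.setArr A f).v = s.v := rfl

@[simp] theorem setArr_a (s : Store) (A : ℕ) (f : ℕ → ℕ → ℕ) (B : ℕ) :
    (s.setArr A f).a B = if B = A then f else s.a B := by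
  simp [Store.setArr, Function.update_apply]

/-- The graph whose adjacency matrix is the array `A`. -/
def adj (N : ℕ) (s : Store) (A : ℕ) (i j : ℕ) : Prop := i < N ∧ j < N ∧ s.a A i j ≠ 0

/-- The set whose characteristic function is row `0` of the array `A`. -/
def toSet (N : ℕ) (s : Store) (A : ℕ) : Finset ℕ := (Finset.range N).filter fun i => s.a A 0 i ≠ 0

@[simp] theorem mem_toSet {N : ℕ} {s : Store} {A i : ℕ} :
    i ∈ s.toSet N A ↔ i < N ∧ s.a A 0 i ≠ 0 := by simp [toSet]

end Store

/-! ### Derived expressions -/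

namespace Expr

/-- `a < b` -/
def lt (a b : Expr) : Expr := .sub b a

/-- `a = b` -/
def eq (a b : Expr) : Expr := .sub (.const 1) (.add (.sub a b) (.sub b a))

def not (a : Expr) : Expr := .sub (.const 1) a

def and (a b : Expr) : Expr := .ite a b (.const 0)

/-- The entry `e` of row `0` of the array `A`. -/
def get (A : ℕ) (e : Expr) : Expr := .read A (.const 0) e

/-- The least value of `x` for which `e` is not `0`, or `N`. The variable `7` must not occur in `e`. -/
def least (x : ℕ) (e : Expr) : Expr :=
  .sum 7 (.not (.sum x (.and (.not (.lt (.var 7) (.var x))) e)))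

variable {N : ℕ} {s : Store} {a b e : Expr} {x A : ℕ}

@[simp] theorem eval_var : (var x).eval N s = s.v x := rfl
@[simp] theorem eval_const : (const x).eval N s = x := rfl
@[simp] theorem eval_add : (add a b).eval N s = a.eval N s + b.eval N s := rfl

@[simp] theorem eval_ite : (ite e a b).eval N s = if e.eval N s = 0 then b.eval N s else a.eval N s :=
  rfl

@[simp] theorem eval_read :
    (read A a b).eval N s = if a.eval N s < N ∧ b.eval N s < N then s.a A (a.eval N s) (b.eval N s)
      else 0 := rfl

@[simp] theorem eval_get :
    (get A a).eval N s = if a.eval N s < N then s.a A 0 (a.eval N s) else 0 := by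
  by_cases h : a.eval N s < N
  · have : 0 < N := by omega
    simp [get, h, this]
  · simp [get, h]

@[simp] theorem eval_sum : (sum x e).eval N s = 0 ↔ ∀ i < N, e.eval N (s.set x i) = 0 := by
  simp [Expr.eval]

@[simp] theorem eval_lt : (lt a b).eval N s = 0 ↔ ¬ a.eval N s < b.eval N s := by
  simp only [lt, Expr.eval]; omega

@[simp] theorem eval_eq : (eq a b).eval N s = 0 ↔ ¬ a.eval N s = b.eval N s := by
  simp only [eq, Expr.eval]; omega

@[simp] theorem eval_not : (not a).eval N s = 0 ↔ ¬ a.eval N s = 0 := by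
  simp only [not, Expr.eval]; omega

@[simp] theorem eval_and : (and a b).eval N s = 0 ↔ ¬ (a.eval N s ≠ 0 ∧ b.eval N s ≠ 0) := by
  simp only [and, Expr.eval]
  split_ifs <;> simp_all

/-- The variables that occur in an expression. -/
def vars : Expr → List ℕ
  | .var x => [x]
  | .const _ => []
  | .add a b => a.vars ++ b.vars
  | .sub a b => a.vars ++ b.vars
  | .ite c a b => c.vars ++ (a.vars ++ b.vars)
  | .read _ a b => a.vars ++ b.vars
  | .sum _ e => e.vars

theorem eval_congr {s s' : Store} (h : ∀ y ∈ e.vars, s.v y = s'.v y) (ha : s.a = s'.a) :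
    e.eval N s = e.eval N s' := by
  induction e generalizing s s' with
  | var x => exact h x (by simp [vars])
  | const c => rfl
  | add a b iha ihb | sub a b iha ihb | read A a b iha ihb =>
    simp only [vars, List.mem_append] at h
    simp only [Expr.eval, iha (fun y hy => h y (Or.inl hy)) ha, ihb (fun y hy => h y (Or.inr hy)) ha, ha]
  | ite c a b ihc iha ihb =>
    simp only [vars, List.mem_append] at h
    simp only [Expr.eval, ihc (fun y hy => h y (Or.inl hy)) ha,
      iha (fun y hy => h y (Or.inr (Or.inl hy))) ha, ihb (fun y hy => h y (Or.inr (Or.inr hy))) ha]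
  | sum x e ih =>
    simp only [Expr.eval]
    refine Finset.sum_congr rfl fun i _ => ih (fun y hy => ?_) ha
    rw [Store.set_v, Store.set_v, h y hy]

/-- The double sum counts the `j < N` such that `e` vanishes at every `i ≤ j`. This number is the
first position where `e` is nonzero, or `N` if there is none. -/
theorem eval_least (hfresh : 7 ∉ e.vars) (hx : x ≠ 7) :
    ((least x e).eval N s < N ∧ e.eval N (s.set x ((least x e).eval N s)) ≠ 0) ∨
      ((least x e).eval N s = N ∧ ∀ i < N, e.eval N (s.set x i) = 0) := by
  have h : ∀ i j, e.eval N ((s.set 7 j).set x i) = e.eval N (s.set x i) := fun i j =>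
    eval_congr (fun y hy => by
      have : y ≠ 7 := fun e => hfresh (e ▸ hy)
      simp [this]) rfl
  have key : (least x e).eval N s = ((Finset.range N).filter
      fun j => ∀ i < N, i ≤ j → e.eval N (s.set x i) = 0).card := by
    rw [Finset.card_filter, least, Expr.eval]
    refine Finset.sum_congr rfl fun j _ => ?_
    have h0 : (not (sum x (and (not (lt (var 7) (var x))) e))).eval N (s.set 7 j) =
        1 - (sum x (and (not (lt (var 7) (var x))) e)).eval N (s.set 7 j) := rfl
    have h1 : (sum x (and (not (lt (var 7) (var x))) e)).eval N (s.set 7 j) = 0 ↔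
        ∀ i < N, i ≤ j → e.eval N (s.set x i) = 0 := by
      simp [h, hx.symm]
    rw [h0]
    split_ifs with h2
    · rw [h1.2 h2]
    · have := mt h1.1 h2
      omega
  by_cases hex : ∃ i, i < N ∧ e.eval N (s.set x i) ≠ 0
  · left
    classical
    have hf := Nat.find_spec hex
    have : (least x e).eval N s = Nat.find hex := by
      rw [key, ← Finset.card_range (Nat.find hex)]
      congr 1
      ext j
      simp only [Finset.mem_filter, Finset.mem_range]
      constructor
      · rintro ⟨h1, h2⟩
        by_contra hcon
        exact hf.2 (h2 _ hf.1 (by omega))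
      · intro hj
        refine ⟨by omega, fun i hi hij => ?_⟩
        by_contra hcon
        exact Nat.find_min hex (by omega : i < Nat.find hex) ⟨hi, hcon⟩
    rw [this]
    exact hf
  · right
    push Not at hex
    refine ⟨?_, hex⟩
    rw [key, Finset.filter_true_of_mem fun j _ i hi _ => hex i hi, Finset.card_range]

end Expr

/-! ### Reasoning about programs -/

namespace Cmd

/-- `c` if `e` is not `0`. The variable `9` serves as a dummy. -/
def when (e : Expr) (c : Cmd) : Cmd := .ite e c (.set 9 (.const 0))

/-- The variables that a program may change. -/
def vars : Cmd → List ℕ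
  | .set x _ => [x]
  | .fill _ _ => []
  | .seq c₁ c₂ => c₁.vars ++ c₂.vars
  | .ite _ c₁ c₂ => c₁.vars ++ c₂.vars
  | .loop c => c.vars

/-- The arrays that a program may change. -/
def arrs : Cmd → List ℕ
  | .set _ _ => []
  | .fill A _ => [A]
  | .seq c₁ c₂ => c₁.arrs ++ c₂.arrs
  | .ite _ c₁ c₂ => c₁.arrs ++ c₂.arrs
  | .loop c => c.arrs

theorem exec_v (N : ℕ) (c : Cmd) (s : Store) {x : ℕ} (hx : x ∉ c.vars) :
    (c.exec N s).v x = s.v x := by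
  induction c generalizing s with
  | set y e =>
    have : x ≠ y := by simpa [vars] using hx
    simp [exec, Store.set, this]
  | fill A e => rfl
  | seq c₁ c₂ ih₁ ih₂ =>
    simp only [vars, List.mem_append, not_or] at hx
    rw [exec, ih₂ _ hx.2, ih₁ _ hx.1]
  | ite e c₁ c₂ ih₁ ih₂ =>
    simp only [vars, List.mem_append, not_or] at hx
    rw [exec]
    split_ifs
    · exact ih₂ _ hx.2
    · exact ih₁ _ hx.1
  | loop c ih =>
    rw [exec]
    generalize N = M at ih ⊢
    suffices ∀ k (s : Store), ((c.exec M)^[k] s).v x = s.v x from this _ _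
    intro k
    induction k with
    | zero => exact fun _ => rfl
    | succ k ih' => exact fun s => by rw [Function.iterate_succ_apply, ih', ih _ hx]

theorem exec_a (N : ℕ) (c : Cmd) (s : Store) {A : ℕ} (hA : A ∉ c.arrs) :
    (c.exec N s).a A = s.a A := by
  induction c generalizing s with
  | set y e => rfl
  | fill B e =>
    have : A ≠ B := by simpa [arrs] using hA
    simp [exec, Store.setArr, this]
  | seq c₁ c₂ ih₁ ih₂ =>
    simp only [arrs, List.mem_append, not_or] at hA
    rw [exec, ih₂ _ hA.2, ih₁ _ hA.1]
  | ite e c₁ c₂ ih₁ ih₂ =>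
    simp only [arrs, List.mem_append, not_or] at hA
    rw [exec]
    split_ifs
    · exact ih₂ _ hA.2
    · exact ih₁ _ hA.1
  | loop c ih =>
    rw [exec]
    generalize N = M at ih ⊢
    suffices ∀ k (s : Store), ((c.exec M)^[k] s).a A = s.a A from this _ _
    intro k
    induction k with
    | zero => exact fun _ => rfl
    | succ k ih' => exact fun s => by rw [Function.iterate_succ_apply, ih', ih _ hA]

/-- The step may also use that whatever the body never assigns still has its value from before the
loop, so that invariants need not mention it. -/
theorem loop_inv {N : ℕ} {c : Cmd} {s : Store} (I : ℕ → Store → Prop) (h0 : I 0 s)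
    (h : ∀ j < N, ∀ s', (∀ x, x ∉ c.vars → s'.v x = s.v x) → (∀ A, A ∉ c.arrs → s'.a A = s.a A) →
      I j s' → I (j + 1) (c.exec N s')) : I N ((Cmd.loop c).exec N s) := by
  suffices H : ∀ k ≤ N, I k ((c.exec N)^[k] s) ∧ (∀ x, x ∉ c.vars → ((c.exec N)^[k] s).v x = s.v x) ∧
      ∀ A, A ∉ c.arrs → ((c.exec N)^[k] s).a A = s.a A from (H N le_rfl).1
  intro k
  induction k with
  | zero => exact fun _ => ⟨h0, fun _ _ => rfl, fun _ _ => rfl⟩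
  | succ k ih =>
    intro hk
    obtain ⟨h1, h2, h3⟩ := ih (by omega)
    rw [Function.iterate_succ_apply']
    exact ⟨h k (by omega) _ h2 h3 h1, fun x hx => by rw [exec_v N c _ hx, h2 x hx],
      fun A hA => by rw [exec_a N c _ hA, h3 A hA]⟩

end Cmd

end RAM

namespace RAM

theorem Store.adj_congr {N : ℕ} {s s' : Store} {A : ℕ} (h : s'.a A = s.a A) :
    s'.adj N A = s.adj N A := by
  funext i j; simp [Store.adj, h]

theorem Store.toSet_congr {N : ℕ} {s s' : Store} {A : ℕ} (h : s'.a A = s.a A) :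
    s'.toSet N A = s.toSet N A := by
  ext i; simp [h]

/-- The value of the variable `x` is less than `N`. -/
def Expr.inRange (x : ℕ) : Expr := .sum 6 (.eq (.var 6) (.var x))

@[simp] theorem Expr.eval_inRange {N x : ℕ} {s : Store} (hx : x ≠ 6 := by decide) :
    (Expr.inRange x).eval N s = 0 ↔ ¬ s.v x < N := by
  simp only [inRange, eval_sum, eval_eq, eval_var, Store.set_v, if_true, if_neg hx]
  constructor
  · exact fun h hx => h _ hx rfl
  · rintro h i hi rfl
    exact h hi

@[simp] theorem Cmd.exec_set {N x : ℕ} {e : Expr} {s : Store} :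
    (Cmd.set x e).exec N s = s.set x (e.eval N s) := rfl

@[simp] theorem Cmd.exec_fill {N A : ℕ} {e : Expr} {s : Store} :
    (Cmd.fill A e).exec N s = s.setArr A fun i j => e.eval N ((s.set 1 i).set 2 j) := rfl

@[simp] theorem Cmd.exec_seq {N : ℕ} {c₁ c₂ : Cmd} {s : Store} :
    (Cmd.seq c₁ c₂).exec N s = c₂.exec N (c₁.exec N s) := rfl

@[simp] theorem Cmd.exec_ite {N : ℕ} {e : Expr} {c₁ c₂ : Cmd} {s : Store} :
    (Cmd.ite e c₁ c₂).exec N s = if e.eval N s = 0 then c₂.exec N s else c₁.exec N s := rfl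

@[simp] theorem Cmd.exec_when {N : ℕ} {e : Expr} {c : Cmd} {s : Store} :
    (Cmd.when e c).exec N s = if e.eval N s = 0 then s.set 9 0 else c.exec N s := rfl

end RAM

/-! ### Congruence -/

theorem IsPM.congr {V : Type*} {E : V → V → Prop} {S : Finset V} {μ ν : V → V}
    (h : IsPM E S μ) (hν : ∀ v ∈ S, ν v = μ v) : IsPM E S ν := by
  intro v hv
  obtain ⟨h1, h2, h3⟩ := h v hv
  rw [hν v hv, hν _ h1]
  exact ⟨h1, h2, h3⟩

theorem IsSearch.congr {V : Type*} [DecidableEq V] {E : V → V → Prop} {L D D' : Finset V} {r f : V}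
    {m : V → V} {R R' : V → V → V} (h : IsSearch E L r f m D R) (hD : D' = D)
    (hR : ∀ u ∈ D, ∀ a ∈ L, R' u a = R u a) : IsSearch E L r f m D' R' := by
  subst hD
  refine ⟨h.root, h.sub, fun u hu => (h.pm u hu).congr fun v hv => hR u hu v ?_,
    fun u hu a ha haf haD => ?_⟩
  · exact Finset.mem_of_mem_erase (Finset.mem_of_mem_erase hv)
  · rw [hR u hu a ha]
    exact h.partner u hu a ha haf haD

namespace RAM

/-! ### The search for a perfect matching

The variable `15` holds the vertex that shall be reached, `20` the root of the search. Array `7` holds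
the graph, array `8` a matching that misses these two vertices, array `9` the set of reached vertices
and array `10` their matchings. -/

namespace Search

open _root_.RAM.Expr _root_.RAM.Cmd

/-- The edge from the reached vertex `3` to vertex `4` leads to a new vertex. -/
def growExpr (u : ℕ) : Expr :=
  and (read 7 (var u) (var 4)) (and (not (eq (var 4) (var 15))) (not (get 9 (read 10 (var u) (var 4)))))

/-- Variables `22` and `23` hold the edge `u w` along which the search grows, and `24` the vertex
freed by it. Row `24` of array `10` becomes the matching of `22` after the exchange. -/
def grow : Cmd :=
  .seq (.set 22 (least 3 (and (get 9 (var 3)) (sum 4 (growExpr 3))))) <|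
  .seq (.set 23 (least 4 (growExpr 22))) <|
  .when (inRange 22) <|
  .seq (.set 24 (read 10 (var 22) (var 23))) <|
  .seq (.fill 10 (ite (eq (var 1) (var 24)) (ite (eq (var 2) (var 23)) (var 22)
    (ite (eq (var 2) (var 22)) (var 23) (read 10 (var 22) (var 2)))) (read 10 (var 1) (var 2))))
  (.fill 9 (ite (eq (var 2) (var 24)) (const 1) (get 9 (var 2))))

/-- The edge exhibited in the second case shows that the old set was not closed. So once closure is
reached, that case is excluded for the rest of the loop. -/
theorem grow_spec {N : ℕ} {s : Store} {L : Finset ℕ} {r : ℕ} {m : ℕ → ℕ}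
    (hL : ∀ v ∈ L, v < N) (hE : IsGraph (s.adj N 7)) (hsupp : ∀ a b, s.adj N 7 a b → a ∈ L ∧ b ∈ L)
    (h : IsSearch (s.adj N 7) L r (s.v 15) m (s.toSet N 9) (s.a 10)) :
    ((∀ u ∈ s.toSet N 9, ∀ w ∈ L, s.adj N 7 u w → w ≠ s.v 15 → s.a 10 u w ∈ s.toSet N 9) ∧
      (grow.exec N s).a = s.a) ∨
    (IsSearch (s.adj N 7) L r (s.v 15) m ((grow.exec N s).toSet N 9) ((grow.exec N s).a 10) ∧
      ((grow.exec N s).toSet N 9).card = (s.toSet N 9).card + 1 ∧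
      ∃ u ∈ s.toSet N 9, ∃ w ∈ L, s.adj N 7 u w ∧ w ≠ s.v 15 ∧ s.a 10 u w ∉ s.toSet N 9) := by
  have h1 := eval_least (N := N) (s := s) (x := 3)
    (e := and (get 9 (var 3)) (sum 4 (growExpr 3))) (by decide) (by decide)
  simp only [grow, Cmd.exec_seq, Cmd.exec_set]
  generalize (least 3 (and (get 9 (var 3)) (sum 4 (growExpr 3)))).eval N s = u at h1
  have h2 := eval_least (N := N) (s := s.set 22 u) (x := 4) (e := growExpr 22) (by decide) (by decide)
  generalize (least 4 (growExpr 22)).eval N (s.set 22 u) = w at h2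
  -- Partners are vertices, hence less than `N`, and the bounds test in `read` does not interfere.
  have hval : ∀ a b, s.adj N 7 a b → b ≠ s.v 15 → a ∈ s.toSet N 9 → s.a 10 a b < N := by
    intro a b hab hb ha
    refine hL _ (Finset.mem_of_mem_erase (Finset.mem_of_mem_erase (h.pm a ha b ?_).1))
    simp [hb, (hE.ne hab).symm, (hsupp a b hab).2]
  rcases h1 with ⟨hu, h1⟩ | ⟨rfl, h1⟩
  · right
    simp [growExpr, hu] at h1
    obtain ⟨huD, w', hw', hadj', hwf', hD'⟩ := h1
    simp only [if_pos hw'] at hD'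
    rcases h2 with ⟨hw, h2⟩ | ⟨rfl, h2⟩
    · simp [growExpr, hu, hw] at h2
      obtain ⟨hadj, hwf, hD⟩ := h2
      have huD' : u ∈ s.toSet N 9 := by simp [hu, huD]
      have huw : s.adj N 7 u w := ⟨hu, hw, hadj⟩
      have hx := hval u w huw hwf huD'
      have hxD : s.a 10 u w ∉ s.toSet N 9 := by
        simp only [Store.mem_toSet, not_and, not_not]
        exact hD
      have key := h.insert hE huD' (hsupp u w huw).2 huw hwf hxD
      simp [hu, hw]
      have hset : ∀ s' : Store, (∀ j < N, s'.a 9 0 j = if j = s.a 10 u w then 1 else s.a 9 0 j) →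
          s'.toSet N 9 = insert (s.a 10 u w) (s.toSet N 9) := by
        intro s' hs'
        ext j
        simp only [Store.mem_toSet, Finset.mem_insert]
        by_cases hj : j < N
        · rw [hs' j hj]
          by_cases hjx : j = s.a 10 u w <;> simp [hj, hjx, hx]
        · simp only [hj, false_and, or_false, false_iff]
          rintro rfl
          exact hj hx
      rw [hset]
      · refine ⟨key.congr rfl fun a ha b hb => ?_, Finset.card_insert_of_notMem hxD,
          u, ⟨hu, huD⟩, w, (hsupp u w huw).2, huw, hwf, hD⟩
        have ha' : a < N := hL _ (key.sub a ha).1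
        have hb' := hL b hb
        by_cases hax : a = s.a 10 u w
        · subst hax
          by_cases hbw : b = w
          · simp [hbw, exchange]
          · by_cases hbu : b = u
            · subst hbu; simp [hbw, exchange]
            · simp [hbw, hbu, exchange, hb']
        · simp [hax, ha', hb']
      · intro j hj
        simp [hj]
    · exact absurd (h2 w' hw') (by simp [growExpr, hu, hw', hadj', hwf']; simpa using hD')
  · left
    refine ⟨fun u hu w hw huw hwf => ?_, ?_⟩
    · have := h1 u huw.1
      simp at hu
      simp [growExpr, hu] at this
      have := this w huw.2.1 huw.2.2 hwf
      have hx := hval u w huw hwf (by simp [hu])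
      rw [if_pos huw.2.1] at this
      simpa using this
    · simp

/-- The state of the search: `L` is the set of the vertices of the current graph. -/
structure Near (N : ℕ) (s : Store) (L : Finset ℕ) : Prop where
  lt : ∀ v ∈ L, v < N
  graph : IsGraph (s.adj N 7)
  supp : ∀ a b, s.adj N 7 a b → a ∈ L ∧ b ∈ L
  root : s.v 20 ∈ L
  goal : s.v 15 ∈ L
  ne : s.v 20 ≠ s.v 15
  pm : IsPM (s.adj N 7) ((L.erase (s.v 20)).erase (s.v 15)) (s.a 8 0)

theorem card_toSet_le (N : ℕ) (s : Store) (A : ℕ) : (s.toSet N A).card ≤ N := by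
  exact (Finset.card_filter_le (Finset.range N) _).trans (Finset.card_range N).le

def closure : Cmd :=
  .seq (.fill 9 (eq (var 2) (var 20))) <| .seq (.fill 10 (get 8 (var 2))) (.loop grow)

/-- As long as the set is not closed, each step adds a vertex. After `N` steps without closure it
would have more than `N` elements. -/
theorem closure_spec {N : ℕ} {s : Store} {L : Finset ℕ} (h : Near N s L) :
    IsSearch (s.adj N 7) L (s.v 20) (s.v 15) (s.a 8 0) ((closure.exec N s).toSet N 9)
      ((closure.exec N s).a 10) ∧
    ∀ u ∈ (closure.exec N s).toSet N 9, ∀ w ∈ L, s.adj N 7 u w → w ≠ s.v 15 →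
      (closure.exec N s).a 10 u w ∈ (closure.exec N s).toSet N 9 := by
  simp only [closure, Cmd.exec_seq]
  set s₁ := (Cmd.fill 10 (get 8 (var 2))).exec N ((Cmd.fill 9 (eq (var 2) (var 20))).exec N s) with hs₁
  have hv : s₁.v = s.v := rfl
  have h7 : s₁.a 7 = s.a 7 := rfl
  have hadj : s₁.adj N 7 = s.adj N 7 := Store.adj_congr h7
  have hinit : IsSearch (s.adj N 7) L (s.v 20) (s.v 15) (s.a 8 0) (s₁.toSet N 9) (s₁.a 10) := by
    refine (IsSearch.init (R := fun _ => s.a 8 0) h.root h.ne h.pm rfl).congr ?_ ?_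
    · ext i
      have h1 : s₁.a 9 0 i = (eq (var 2) (var 20)).eval N ((s.set 1 0).set 2 i) := rfl
      have h2 := (eval_eq (N := N) (s := (s.set 1 0).set 2 i) (a := var 2) (b := var 20)).not
      have := h.lt _ h.root
      rw [Store.mem_toSet, h1, ne_eq, h2]
      simp
      rintro rfl; exact this
    · intro u hu a ha
      have := h.lt a ha
      simp [hs₁, this]
  have key := Cmd.loop_inv (N := N) (c := grow) (s := s₁)
    (fun j s' => IsSearch (s.adj N 7) L (s.v 20) (s.v 15) (s.a 8 0) (s'.toSet N 9) (s'.a 10) ∧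
      (j + 1 ≤ (s'.toSet N 9).card ∨ ∀ u ∈ s'.toSet N 9, ∀ w ∈ L, s.adj N 7 u w → w ≠ s.v 15 →
        s'.a 10 u w ∈ s'.toSet N 9))
    ⟨hinit, Or.inl (Finset.card_pos.2 ⟨_, hinit.root⟩)⟩ (by
      rintro j hj s' hv' ha' ⟨hS, hc⟩
      have hadj' : s'.adj N 7 = s.adj N 7 := by rw [← hadj, Store.adj_congr (ha' 7 (by decide))]
      have hf : s'.v 15 = s.v 15 := by rw [hv' 15 (by decide), hv]
      rcases grow_spec (s := s') (r := s.v 20) (m := s.a 8 0) h.lt (by rw [hadj']; exact h.graph)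
        (by rw [hadj']; exact h.supp) (by rw [hadj', hf]; exact hS) with ⟨h1, h2⟩ | ⟨h1, h2, u, hu, w, hw, huw, hwf, hx⟩
      · rw [hadj', hf] at h1
        rw [Store.toSet_congr (congrFun h2 9), h2]
        exact ⟨hS, Or.inr h1⟩
      · rw [hadj', hf] at h1
        refine ⟨h1, ?_⟩
        rcases hc with hc | hc
        · left; omega
        · exact absurd (hc u hu w hw (hadj' ▸ huw) (hf ▸ hwf)) hx)
  refine ⟨key.1, key.2.resolve_left fun hcon => ?_⟩
  have := card_toSet_le N ((Cmd.loop grow).exec N s₁) 9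
  omega

def walkStep : Cmd :=
  .when (not (eq (var 24) (var 23))) <|
  .seq (.set 25 (read 10 (var 23) (var 24))) <|
  .seq (.set 24 (read 10 (var 22) (var 25)))
  (.fill 11 (ite (eq (var 2) (var 25)) (const 1) (ite (eq (var 2) (var 24)) (const 1)
    (get 11 (var 2)))))

/-- Follow the alternating path from vertex `22` to vertex `23`. -/
def walk : Cmd :=
  .seq (.fill 11 (eq (var 2) (var 22))) <| .seq (.set 24 (var 22)) (.loop walkStep)

/-- Each step before `z` is reached adds two new vertices, so `N` iterations suffice. From `z` on
the loop is idle. -/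
theorem walk_spec {N : ℕ} {s : Store} {L : Finset ℕ} {E : ℕ → ℕ → Prop} {f u z : ℕ} (hE : IsGraph E)
    (hL : ∀ v ∈ L, v < N) (hu : s.v 22 = u) (hz : s.v 23 = z)
    (hM : IsPM E ((L.erase u).erase f) (s.a 10 u)) (hM' : IsPM E ((L.erase z).erase f) (s.a 10 z))
    (huL : u ∈ L) (huf : u ≠ f) (hzL : z ∈ L) :
    IsBlossomWalk E (s.a 10 u) (s.a 10 z) ((walk.exec N s).toSet N 11) u z ∧
      ∀ c ∈ (walk.exec N s).toSet N 11, c ∈ L ∧ c ≠ f := by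
  simp only [walk, Cmd.exec_seq]
  set s₁ := (Cmd.set 24 (var 22)).exec N ((Cmd.fill 11 (eq (var 2) (var 22))).exec N s) with hs₁
  have huN := hL u huL
  have hzN := hL z hzL
  have hC₁ : s₁.toSet N 11 = {u} := by
    ext i
    have h1 : s₁.a 11 0 i = (eq (var 2) (var 22)).eval N ((s.set 1 0).set 2 i) := rfl
    have h2 := (eval_eq (N := N) (s := (s.set 1 0).set 2 i) (a := var 2) (b := var 22)).not
    rw [Store.mem_toSet, h1, ne_eq, h2]
    simp [hu]
    rintro rfl; exact huN
  have h24 : s₁.v 24 = u := by simp [hs₁, hu]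
  have key := Cmd.loop_inv (N := N) (c := walkStep) (s := s₁)
    (fun j s' => IsBlossomWalk E (s.a 10 u) (s.a 10 z) (s'.toSet N 11) u (s'.v 24) ∧
      (∀ c ∈ s'.toSet N 11, c ∈ L ∧ c ≠ f) ∧ (s'.v 24 = z ∨ j + 1 ≤ (s'.toSet N 11).card))
    ⟨by rw [hC₁, h24]; exact .init _ _ _, by rw [hC₁]; simp [huL, huf], by rw [hC₁]; simp⟩ (by
      rintro j hj s' hv' ha' ⟨hW, hC, hc⟩
      have h22 : s'.v 22 = u := by rw [hv' 22 (by decide), ← hu]; rfl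
      have h23 : s'.v 23 = z := by rw [hv' 23 (by decide), ← hz]; rfl
      have h10 : s'.a 10 = s.a 10 := by rw [ha' 10 (by decide)]; rfl
      by_cases hxz : s'.v 24 = z
      · have : walkStep.exec N s' = s'.set 9 0 := by simp [walkStep, h23, hxz]
        rw [this]
        exact ⟨hW, hC, Or.inl hxz⟩
      · have hx := hC _ hW.right
        have hxN := hL _ hx.1
        obtain ⟨h1, h2, h3, h4, h5⟩ := hW.step hE hM hM' hC hxz
        set x := s'.v 24 with hxdef
        have hyN : s.a 10 z x < N := hL _ (h2 _ (by simp)).1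
        have hwN : s.a 10 u (s.a 10 z x) < N := hL _ (h2 _ (by simp)).1
        have hv24 : (walkStep.exec N s').v 24 = s.a 10 u (s.a 10 z x) := by
          simp [walkStep, h23, h22, ← hxdef, hxz, hxN, hzN, huN, hyN, h10]
        have hset : (walkStep.exec N s').toSet N 11 =
            insert (s.a 10 z x) (insert (s.a 10 u (s.a 10 z x)) (s'.toSet N 11)) := by
          ext i
          simp only [walkStep, Cmd.exec_when, eval_not, eval_eq, eval_var, h23, ← hxdef, hxz]
          simp [h23, h22, ← hxdef, hxN, hzN, huN, hyN, h10]
          by_cases hi : i < N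
          · by_cases hi1 : i = s.a 10 z x
            · simp [hi1, hyN]
            · by_cases hi2 : i = s.a 10 u (s.a 10 z x)
              · simp [hi2, hwN]
              · simp [hi1, hi2, hi]
          · have hi1 : i ≠ s.a 10 z x := fun e => hi (e ▸ hyN)
            have hi2 : i ≠ s.a 10 u (s.a 10 z x) := fun e => hi (e ▸ hwN)
            simp [hi, hi1, hi2]
        rw [hv24, hset]
        refine ⟨h1, h2, ?_⟩
        right
        rw [Finset.card_insert_of_notMem (by simp [h3, h5]), Finset.card_insert_of_notMem h4]
        have := hc.resolve_left hxz
        omega)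
  have := card_toSet_le N ((Cmd.loop walkStep).exec N s₁) 11
  obtain ⟨h1, h2, h3⟩ := key
  rw [h3.resolve_right (by omega)] at h1
  exact ⟨h1, h2⟩

/-- Contract the blossom. -/
def shrink : Cmd :=
  .seq (.fill 7 (add (and (not (get 11 (var 1))) (and (not (get 11 (var 2))) (read 7 (var 1) (var 2))))
    (add (and (eq (var 1) (var 22)) (and (not (get 11 (var 2)))
      (sum 3 (and (get 11 (var 3)) (read 7 (var 3) (var 2))))))
    (and (eq (var 2) (var 22)) (and (not (get 11 (var 1)))
      (sum 3 (and (get 11 (var 3)) (read 7 (var 3) (var 1))))))))) <|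
  .seq (.fill 8 (read 10 (var 22) (var 2))) (.set 20 (var 22))

/-- The new matching is the one stored for `u`, which misses `u`. So the base of the blossom becomes
the root of the next search, and no stem has to be treated. -/
theorem shrink_spec {N : ℕ} {s : Store} (hu : s.v 22 < N) :
    (shrink.exec N s).adj N 7 = contract (s.adj N 7) (s.toSet N 11) (s.v 22) ∧
    (∀ v < N, (shrink.exec N s).a 8 0 v = s.a 10 (s.v 22) v) ∧ (shrink.exec N s).v 20 = s.v 22 := by
  refine ⟨?_, fun v hv => ?_, ?_⟩
  · have hlt : ∀ a b, contract (s.adj N 7) (s.toSet N 11) (s.v 22) a b → a < N ∧ b < N := by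
      rintro a b (⟨-, -, h⟩ | ⟨rfl, -, c, -, h⟩ | ⟨rfl, -, c, -, h⟩)
      · exact ⟨h.1, h.2.1⟩
      · exact ⟨hu, h.2.1⟩
      · exact ⟨h.2.1, hu⟩
    have key : ∀ a < N, ∀ b < N, (shrink.exec N s).a 7 a b ≠ 0 ↔
        contract (s.adj N 7) (s.toSet N 11) (s.v 22) a b := by
      intro a ha b hb
      simp [shrink, contract, Store.adj, ha, hb]
      have key : ∀ d, (∃ c, (c < N ∧ ¬ s.a 11 0 c = 0) ∧ c < N ∧ ¬ s.a 7 c d = 0) ↔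
          ¬ ∀ i < N, ¬ s.a 11 0 i = 0 → i < N → s.a 7 i d = 0 := by
        intro d
        push Not
        exact exists_congr fun c => by tauto
      have key' : (∃ x < N, ¬ s.a 11 0 x = 0 ∧ x < N ∧ ¬ s.a 7 x a = 0) ↔
          (∃ c, (c < N ∧ ¬ s.a 11 0 c = 0) ∧ c < N ∧ ¬ s.a 7 c a = 0) :=
        exists_congr fun c => by tauto
      rw [key', key b]
      generalize (∃ c, (c < N ∧ ¬ s.a 11 0 c = 0) ∧ c < N ∧ ¬ s.a 7 c a = 0) = Q
      generalize (∀ i < N, ¬ s.a 11 0 i = 0 → i < N → s.a 7 i b = 0) = P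
      by_cases h1 : s.a 11 0 a = 0 <;> by_cases h2 : s.a 11 0 b = 0 <;> by_cases h3 : s.a 7 a b = 0 <;>
        by_cases h4 : P <;> simp [h1, h2, h3, h4]
      tauto
    funext a b
    refine propext ⟨fun h => (key a h.1 b h.2.1).1 h.2.2, fun h => ?_⟩
    obtain ⟨ha, hb⟩ := hlt a b h
    exact ⟨ha, hb, (key a ha b hb).2 h⟩
  · simp [shrink, hu, hv]
  · simp [shrink]

end Search
end RAM

namespace RAM
namespace Search
open _root_.RAM.Expr _root_.RAM.Cmd

/-- One round of the search: the answer goes to variable `21`, as `1` or `2`, unless a blossom is found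
and contracted. -/
def round : Cmd :=
  .seq closure <|
  .ite (sum 3 (and (get 9 (var 3)) (read 7 (var 3) (var 15)))) (.set 21 (const 1)) <|
  .seq (.set 22 (least 3 (and (get 9 (var 3))
    (sum 4 (and (get 9 (var 4)) (read 7 (var 3) (var 4))))))) <|
  .ite (inRange 22)
    (.seq (.set 23 (least 4 (and (get 9 (var 4)) (read 7 (var 22) (var 4))))) (.seq walk shrink))
    (.set 21 (const 2))

/-- After closure there are three cases: a reached vertex is adjacent to the goal, and the matching
can be completed; no two reached vertices are adjacent, and counting excludes a perfect matching; or
an edge `u z` between reached vertices closes a blossom. In the last case the matchings of `u` and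
`z` yield the path from `u` to `z`. -/
theorem round_spec {N : ℕ} {s : Store} {L : Finset ℕ} (h : Near N s L) (h0 : s.v 21 = 0) :
    ((round.exec N s).v 21 = 1 ∧ HasPM (s.adj N 7) L) ∨
    ((round.exec N s).v 21 = 2 ∧ ¬ HasPM (s.adj N 7) L) ∨
    ((round.exec N s).v 21 = 0 ∧ ∃ L', Near N (round.exec N s) L' ∧ L'.card < L.card ∧
      (HasPM ((round.exec N s).adj N 7) L' ↔ HasPM (s.adj N 7) L)) := by
  obtain ⟨hS, hcl⟩ := closure_spec h
  simp only [round, Cmd.exec_seq]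
  have hv : ∀ x, x ∉ closure.vars → (closure.exec N s).v x = s.v x := fun x hx => exec_v N _ s hx
  have ha : ∀ A, A ∉ closure.arrs → (closure.exec N s).a A = s.a A := fun A hA => exec_a N _ s hA
  generalize closure.exec N s = s₁ at *
  have h7 : s₁.a 7 = s.a 7 := ha 7 (by decide)
  have h15 : s₁.v 15 = s.v 15 := hv 15 (by decide)
  have h21 : s₁.v 21 = 0 := by rw [hv 21 (by decide), h0]
  have hfN := h.lt _ h.goal
  rw [Cmd.exec_ite]
  split_ifs with h1
  swap
  · left
    simp [h7, h15, hfN] at h1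
    obtain ⟨u, hu, huD, huf⟩ := h1
    simp only [hu, true_and] at huD huf
    exact ⟨by simp, hS.hasPM h.graph h.goal (u := u) (by simpa [hu] using huD) ⟨hu, hfN, by simpa using huf⟩⟩
  right
  have h1' : ∀ u ∈ s₁.toSet N 9, ¬ s.adj N 7 u (s.v 15) := by
    intro u hu hadj
    rw [Store.mem_toSet] at hu
    simp [h7, h15, hfN] at h1
    have := h1 u hu.1
    simp [hu.1] at this
    exact hadj.2.2 (this hu.2)
  have h2 := eval_least (N := N) (s := s₁) (x := 3)
    (e := and (get 9 (var 3)) (sum 4 (and (get 9 (var 4)) (read 7 (var 3) (var 4))))) (by decide)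
    (by decide)
  simp only [Cmd.exec_seq, Cmd.exec_set]
  generalize (least 3 (and (get 9 (var 3))
    (sum 4 (and (get 9 (var 4)) (read 7 (var 3) (var 4)))))).eval N s₁ = u at h2
  rw [Cmd.exec_ite]
  have hr : (inRange 22).eval N (s₁.set 22 u) = 0 ↔ ¬ u < N := by simp
  rcases h2 with ⟨hu, h2⟩ | ⟨rfl, h2⟩
  swap
  · left
    rw [if_pos (hr.2 (lt_irrefl _))]
    refine ⟨by simp, hS.not_hasPM h.pm h1' (fun a ha b hb hab => ?_) hcl⟩
    have h3 := h2 a hab.1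
    rw [Store.mem_toSet] at ha hb
    simp [ha.1, h7] at h3
    have h4 := h3 ha.2 b hb.1
    simp [hb.1] at h4
    exact hab.2.2 (h4 hb.2)
  right
  rw [if_neg (fun h => (hr.1 h) hu)]
  have h3 := eval_least (N := N) (s := s₁.set 22 u) (x := 4)
    (e := and (get 9 (var 4)) (read 7 (var 22) (var 4))) (by decide) (by decide)
  simp only [Cmd.exec_seq, Cmd.exec_set]
  generalize (least 4 (and (get 9 (var 4)) (read 7 (var 22) (var 4)))).eval N (s₁.set 22 u) = z at h3
  simp [hu, h7] at h2
  obtain ⟨huD, z', hz', hzD', huz'⟩ := h2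
  simp only [hz', true_and] at hzD' huz'
  rcases h3 with ⟨hz, h3⟩ | ⟨rfl, h3⟩
  swap
  · have := h3 z' hz'
    simp [hu, hz', hzD', h7] at this
    exact absurd this huz'
  simp [hu, hz, h7] at h3
  obtain ⟨hzD, huz⟩ := h3
  have huD' : u ∈ s₁.toSet N 9 := by simp [hu, huD]
  have hzD' : z ∈ s₁.toSet N 9 := by simp [hz, hzD]
  have hadj : s.adj N 7 u z := ⟨hu, hz, huz⟩
  obtain ⟨hW, hC⟩ := walk_spec (s := (s₁.set 22 u).set 23 z) (E := s.adj N 7) (L := L) (f := s.v 15)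
    (u := u) (z := z) h.graph h.lt (by simp) (by simp) (hS.pm u huD') (hS.pm z hzD') (hS.sub u huD').1
    (hS.sub u huD').2 (hS.sub z hzD').1
  have hv₂ : ∀ x, x ∉ walk.vars → (walk.exec N ((s₁.set 22 u).set 23 z)).v x =
    ((s₁.set 22 u).set 23 z).v x := fun x hx => exec_v N _ _ hx
  have ha₂ : ∀ A, A ∉ walk.arrs → (walk.exec N ((s₁.set 22 u).set 23 z)).a A = s₁.a A :=
    fun A hA => exec_a N _ _ hA
  generalize walk.exec N ((s₁.set 22 u).set 23 z) = s₂ at *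
  simp only [Store.set_a] at hW
  have hv22 : s₂.v 22 = u := by rw [hv₂ 22 (by decide)]; simp
  have hadj₂ : s₂.adj N 7 = s.adj N 7 := Store.adj_congr (by rw [ha₂ 7 (by decide), h7])
  obtain ⟨h4, h5, h6⟩ := shrink_spec (s := s₂) (N := N) (by rw [hv22]; exact hu)
  have hv₃ : ∀ x, x ∉ shrink.vars → (shrink.exec N s₂).v x = s₂.v x := fun x hx => exec_v N _ _ hx
  generalize shrink.exec N s₂ = s₃ at *
  rw [hadj₂, hv22] at h4
  rw [hv22] at h5 h6
  set C := s₂.toSet N 11 with hCdef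
  have huC : u ∈ C := hW.left
  have hL' : ∀ v, v ∈ insert u (L \ C) ↔ v = u ∨ (v ∈ L ∧ v ∉ C) := fun v => by simp
  have h15' : s₃.v 15 = s.v 15 := by
    rw [hv₃ 15 (by decide), hv₂ 15 (by decide), ← h15]; simp
  have hpm := hW.contract (hS.pm u huD') hL'
  have hfC : s.v 15 ∉ C := fun hf => (hC _ hf).2 rfl
  refine ⟨by rw [hv₃ 21 (by decide), hv₂ 21 (by decide)]; simpa using h21, insert u (L \ C), ?_, ?_, ?_⟩
  · refine ⟨fun v hv => ?_, ?_, fun a b hab => ?_, ?_, ?_, ?_, ?_⟩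
    · rcases (hL' v).1 hv with rfl | hv
      · exact hu
      · exact h.lt v hv.1
    · rw [h4]; exact h.graph.contract huC
    · rw [h4] at hab
      rw [hL', hL']
      rcases hab with ⟨ha, hb, hab⟩ | ⟨rfl, hb, c, -, hab⟩ | ⟨rfl, hb, c, -, hab⟩
      · exact ⟨Or.inr ⟨(h.supp a b hab).1, ha⟩, Or.inr ⟨(h.supp a b hab).2, hb⟩⟩
      · exact ⟨Or.inl rfl, Or.inr ⟨(h.supp c b hab).2, hb⟩⟩
      · exact ⟨Or.inr ⟨(h.supp c a hab).2, hb⟩, Or.inl rfl⟩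
    · rw [h6]; simp
    · rw [h15']; simp [h.goal, hfC]
    · rw [h6, h15']; exact (hS.sub u huD').2
    · rw [h4, h6, h15']
      refine hpm.congr fun v hv => ?_
      have hvN : v < N := by
        have := (hL' v).1 (Finset.mem_of_mem_erase (Finset.mem_of_mem_erase hv))
        rcases this with rfl | h'
        · exact hu
        · exact h.lt v h'.1
      rw [h5 v hvN, ha₂ 10 (by decide)]
  · have hzC : z ∈ C := hW.right
    have hne := h.graph.ne hadj
    refine Finset.card_lt_card (Finset.ssubset_iff_of_subset ?_ |>.2 ⟨z, (hC z hzC).1, ?_⟩)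
    · intro v hv
      rcases (hL' v).1 hv with rfl | hv
      · exact (hS.sub v huD').1
      · exact hv.1
    · simp [hne.symm, hzC]
  · rw [h4]
    refine ⟨HasPM.of_contract h.graph huC (fun c hc => (hC c hc).1) hL'
      (hW.factorCritical h.graph hadj), HasPM.contract h.graph huC hL' h.goal hfC hpm⟩

/-- Decide whether the graph in array `7` has a perfect matching. -/
def decide : Cmd := .seq (.set 21 (const 0)) (.loop (.when (not (var 21)) round))

/-- Every undecided round shrinks the vertex set, which never becomes empty as it contains the root.
Hence `N` rounds decide. -/
theorem decide_spec {N : ℕ} {s : Store} {L : Finset ℕ} (h : Near N s L) :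
    ((decide.exec N s).v 21 = 1 ∧ HasPM (s.adj N 7) L) ∨
    ((decide.exec N s).v 21 = 2 ∧ ¬ HasPM (s.adj N 7) L) := by
  simp only [decide, Cmd.exec_seq, Cmd.exec_set, eval_const]
  have key := Cmd.loop_inv (N := N) (c := .when (not (var 21)) round) (s := s.set 21 0)
    (fun j s' => (s'.v 21 = 1 ∧ HasPM (s.adj N 7) L) ∨ (s'.v 21 = 2 ∧ ¬ HasPM (s.adj N 7) L) ∨
      (s'.v 21 = 0 ∧ ∃ L', Near N s' L' ∧ L'.card + j ≤ N ∧
        (HasPM (s'.adj N 7) L' ↔ HasPM (s.adj N 7) L)))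
    (by
      refine Or.inr (Or.inr ⟨by simp, L, ⟨h.lt, h.graph, h.supp, by simpa using h.root,
        by simpa using h.goal, by simpa using h.ne, h.pm⟩, ?_, Iff.rfl⟩)
      have : L ⊆ Finset.range N := fun v hv => Finset.mem_range.2 (h.lt v hv)
      simpa using Finset.card_le_card this)
    (by
      rintro j hj s' hv ha (⟨h1, h2⟩ | ⟨h1, h2⟩ | ⟨h1, L', h2, h3, h4⟩)
      · left; simp [h1, h2]
      · right; left; simp [h1, h2]
      · rw [Cmd.exec_when, if_neg (by simp [h1])]
        rcases round_spec h2 h1 with ⟨h5, h6⟩ | ⟨h5, h6⟩ | ⟨h5, L'', h6, h7, h8⟩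
        · exact Or.inl ⟨h5, h4.1 h6⟩
        · exact Or.inr (Or.inl ⟨h5, fun h => h6 (h4.2 h)⟩)
        · exact Or.inr (Or.inr ⟨h5, L'', h6, by omega, h8.trans h4⟩))
  rcases key with h1 | h1 | ⟨-, L', h2, h3, -⟩
  · exact Or.inl h1
  · exact Or.inr h1
  · have := Finset.card_pos.2 ⟨_, h2.root⟩
    omega

end Search
end RAM

/-! ### Removing and adding one edge of a perfect matching -/

section
variable {V : Type*} [DecidableEq V] {E : V → V → Prop} {S T : Finset V} {μ : V → V}

theorem IsPM.restrict (h : IsPM E S μ) {w : V} (hw : w ∈ S)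
    (hT : ∀ v, v ∈ T ↔ v ∈ S ∧ v ≠ w ∧ v ≠ μ w) : IsPM E T μ := by
  intro v hv
  obtain ⟨h1, h2, h3⟩ := (hT v).1 hv
  obtain ⟨h4, h5, h6⟩ := h v h1
  exact ⟨(hT _).2 ⟨h4, fun e => h3 (by rw [← e, h6]), fun e => h2 (h.injOn h1 hw e)⟩, h5, h6⟩

theorem IsPM.add_pair (hE : IsGraph E) (h : IsPM E S μ) {a b : V} (ha : a ∉ S) (hb : b ∉ S)
    (hab : E a b) (hT : ∀ v, v ∈ T ↔ v ∈ S ∨ v = a ∨ v = b) : IsPM E T (_root_.exchange μ a b) := by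
  have hne := hE.ne hab
  intro v hv
  by_cases hvb : v = b
  · subst hvb
    simp only [_root_.exchange, Function.update_self, Function.update_of_ne hne, hE.symm hab, hT, true_or,
      or_true, and_self]
  by_cases hva : v = a
  · subst hva
    simp only [_root_.exchange, Function.update_self, Function.update_of_ne hvb, hab, hT, or_true, and_self]
  have hvS : v ∈ S := by
    rcases (hT v).1 hv with h | h | h
    · exact h
    · exact absurd h hva
    · exact absurd h hvb
  obtain ⟨h1, h2, h3⟩ := h v hvS
  have h4 : μ v ≠ a := fun e => ha (e ▸ h1)
  have h5 : μ v ≠ b := fun e => hb (e ▸ h1)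
  simp only [_root_.exchange, Function.update_of_ne hva, Function.update_of_ne hvb, Function.update_of_ne h4,
    Function.update_of_ne h5, h2, h3, hT, h1, true_or, and_self]

end

namespace RAM
namespace Search
open _root_.RAM.Expr _root_.RAM.Cmd

/-! ### Augmentation

Array `4` holds the graph, array `6` a matching, row `0` of array `12` the set of vertices and row `0` of
array `5` a subset of it that contains the unmatched vertices `14` and `15`. -/

/-- Variable `18` records success, `19` the chosen partner. Later iterations are idle once `18` is
set. -/
def found : Cmd := .seq (.set 18 (const 1)) (.set 19 (var 17))

/-- The call of the search on the graph without the vertices `14` and `17`. -/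
def callDecide : Cmd :=
  .seq (.fill 7 (and (and (get 5 (var 1)) (get 5 (var 2))) (and (and (not (eq (var 1) (var 14)))
    (not (eq (var 1) (var 17)))) (and (and (not (eq (var 2) (var 14))) (not (eq (var 2) (var 17))))
    (read 4 (var 1) (var 2)))))) <|
  .seq (.fill 8 (get 6 (var 2))) <| .seq (.set 20 (get 6 (var 17))) decide

/-- Without `r` and `w`, the known matching misses exactly the old partner of `w` and the goal `f`,
as the search requires. The arrays `4` and `6` are not touched; the search works on copies. -/
theorem callDecide_spec {N : ℕ} {s : Store} {S : Finset ℕ} {r f w : ℕ} (hS : s.toSet N 5 = S)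
    (hE : IsGraph (s.adj N 4)) (hr : s.v 14 = r) (hf : s.v 15 = f) (hw : s.v 17 = w)
    (hfS : f ∈ S) (hrf : r ≠ f) (hpm : IsPM (s.adj N 4) ((S.erase r).erase f) (s.a 6 0)) (hwS : w ∈ S)
    (hwr : w ≠ r) (hwf : w ≠ f) :
    ((callDecide.exec N s).v 21 = 1 ∧ HasPM (s.adj N 4) ((S.erase r).erase w)) ∨
    ((callDecide.exec N s).v 21 = 2 ∧ ¬ HasPM (s.adj N 4) ((S.erase r).erase w)) := by
  have hlt : ∀ v ∈ S, v < N := fun v hv => by rw [← hS, Store.mem_toSet] at hv; exact hv.1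
  simp only [callDecide, Cmd.exec_seq]
  set s₁ := (Cmd.set 20 (get 6 (var 17))).exec N ((Cmd.fill 8 (get 6 (var 2))).exec N ((Cmd.fill 7
    (and (and (get 5 (var 1)) (get 5 (var 2))) (and (and (not (eq (var 1) (var 14)))
    (not (eq (var 1) (var 17)))) (and (and (not (eq (var 2) (var 14))) (not (eq (var 2) (var 17))))
    (read 4 (var 1) (var 2)))))).exec N s)) with hs₁
  have h20 : s₁.v 20 = s.a 6 0 w := by simp [hs₁, hw, hlt w hwS]
  have h15 : s₁.v 15 = f := by simp [hs₁, hf]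
  have hadj : ∀ a b, s₁.adj N 7 a b ↔ a ∈ (S.erase r).erase w ∧ b ∈ (S.erase r).erase w ∧
      s.adj N 4 a b := by
    intro a b
    by_cases ha : a < N <;> by_cases hb : b < N
    · simp [hs₁, Store.adj, hr, hw, ← hS, ha, hb]; tauto
    all_goals simp [Store.adj, ha, hb]
  obtain ⟨h1, h2, h3⟩ := hpm w (by simp [hwS, hwr, hwf])
  simp only [Finset.mem_erase] at h1
  have hne := hE.ne h2
  have hiff : HasPM (s₁.adj N 7) ((S.erase r).erase w) ↔ HasPM (s.adj N 4) ((S.erase r).erase w) :=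
    ⟨fun h => h.mono fun a _ b _ hab => ((hadj a b).1 hab).2.2,
      fun h => h.mono fun a ha b hb hab => (hadj a b).2 ⟨ha, hb, hab⟩⟩
  have hN : Near N s₁ ((S.erase r).erase w) := by
    refine ⟨fun v hv => ?_, ⟨fun {a b} hab => ?_, fun a haa => ?_⟩, fun a b hab => ?_, ?_, ?_, ?_, ?_⟩
    · exact hlt v (Finset.mem_of_mem_erase (Finset.mem_of_mem_erase hv))
    · rw [hadj] at hab ⊢
      exact ⟨hab.2.1, hab.1, hE.symm hab.2.2⟩
    · exact hE.irrefl a ((hadj a a).1 haa).2.2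
    · exact ⟨((hadj a b).1 hab).1, ((hadj a b).1 hab).2.1⟩
    · rw [h20]; simp [h1, hne.symm]
    · rw [h15]; simp [hfS, hrf.symm, hwf.symm]
    · rw [h20, h15]; exact h1.1
    · rw [h20, h15]
      have hres := hpm.restrict (w := w) (by simp [hwS, hwr, hwf])
        (T := (((S.erase r).erase w).erase (s.a 6 0 w)).erase f)
        fun v => by simp only [Finset.mem_erase]; tauto
      intro v hv
      have hvN : v < N := hlt v (by simp only [Finset.mem_erase] at hv; tauto)
      obtain ⟨h4, h5, h6⟩ := hres v hv
      have hvN' : s.a 6 0 v < N := hlt _ (by simp only [Finset.mem_erase] at h4; tauto)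
      have h8 : ∀ v < N, s₁.a 8 0 v = s.a 6 0 v := fun v hv => by simp [hs₁, hv]
      rw [h8 v hvN, h8 _ hvN', hadj]
      simp only [Finset.mem_erase] at *
      tauto
  have := decide_spec hN
  rwa [hiff] at this

/-- Test whether the vertex `14` can be matched to the vertex `17`. -/
def tryStep : Cmd :=
  .seq (.when (and (not (var 18)) (and (get 5 (var 17)) (read 4 (var 14) (var 17))))
    (.ite (eq (var 17) (var 15)) found (.seq callDecide (.when (eq (var 21) (const 1)) found))))
  (.set 17 (add (var 17) (const 1)))

def tryAll : Cmd := .seq (.set 17 (const 0)) (.seq (.set 18 (const 0)) (.loop tryStep))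

/-- The situation before an augmentation step. -/
structure Unfinished (N : ℕ) (s : Store) : Prop where
  graph : IsGraph (s.adj N 4)
  left : s.v 14 ∈ s.toSet N 5
  right : s.v 15 ∈ s.toSet N 5
  ne : s.v 14 ≠ s.v 15
  pm : IsPM (s.adj N 4) (((s.toSet N 5).erase (s.v 14)).erase (s.v 15)) (s.a 6 0)

/-- A perfect matching of `S` gives `r` some partner `w` and matches the rest of `S`. So if every
neighbour is rejected, there is none. -/
theorem tryAll_spec {N : ℕ} {s : Store} (h : Unfinished N s) :
    ((tryAll.exec N s).v 18 = 0 ∧ ¬ HasPM (s.adj N 4) (s.toSet N 5)) ∨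
    ((tryAll.exec N s).v 18 = 1 ∧ (tryAll.exec N s).v 19 ∈ s.toSet N 5 ∧
      s.adj N 4 (s.v 14) ((tryAll.exec N s).v 19) ∧ ((tryAll.exec N s).v 19 = s.v 15 ∨
      HasPM (s.adj N 4) (((s.toSet N 5).erase (s.v 14)).erase ((tryAll.exec N s).v 19)))) := by
  have key := Cmd.loop_inv (N := N) (c := tryStep) (s := (s.set 17 0).set 18 0)
    (fun j s' => s'.v 17 = j ∧ ((s'.v 18 = 0 ∧ ∀ w < j, w ∈ s.toSet N 5 → s.adj N 4 (s.v 14) w →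
        w ≠ s.v 15 ∧ ¬ HasPM (s.adj N 4) (((s.toSet N 5).erase (s.v 14)).erase w)) ∨
      (s'.v 18 = 1 ∧ s'.v 19 ∈ s.toSet N 5 ∧ s.adj N 4 (s.v 14) (s'.v 19) ∧ (s'.v 19 = s.v 15 ∨
        HasPM (s.adj N 4) (((s.toSet N 5).erase (s.v 14)).erase (s'.v 19))))))
    ⟨by simp, Or.inl ⟨by simp, by simp⟩⟩ (by
      rintro j hj s' hv ha ⟨h17, hI⟩
      have h4 : s'.a 4 = s.a 4 := ha 4 (by decide)
      have h5 : s'.a 5 = s.a 5 := ha 5 (by decide)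
      have h6 : s'.a 6 = s.a 6 := ha 6 (by decide)
      have h14 : s'.v 14 = s.v 14 := hv 14 (by decide)
      have h15 : s'.v 15 = s.v 15 := hv 15 (by decide)
      have hrN : s.v 14 < N := (Store.mem_toSet.1 h.left).1
      simp only [tryStep, Cmd.exec_seq, Cmd.exec_set, Cmd.exec_when]
      rcases hI with ⟨h18, hI⟩ | hI
      · split_ifs with hc
        · refine ⟨by simp [h17], Or.inl ⟨by simp [h18], fun w hw hwS hadj => ?_⟩⟩
          rcases Nat.lt_succ_iff_lt_or_eq.1 hw with hw | rfl
          · exact hI w hw hwS hadj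
          · simp [h18, h17, h4, h5, h14, hrN, hj] at hc
            exact absurd (hc (Store.mem_toSet.1 hwS).2) hadj.2.2
        · simp [h18, h17, h4, h5, h14, hrN, hj] at hc
          have hjS : j ∈ s.toSet N 5 := Store.mem_toSet.2 ⟨hj, hc.1⟩
          have hadj : s.adj N 4 (s.v 14) j := ⟨hrN, hj, hc.2⟩
          rw [Cmd.exec_ite]
          split_ifs with hjf
          swap
          · simp [h17, h15] at hjf
            refine ⟨by simp [found, h17], Or.inr ⟨by simp [found], ?_⟩⟩
            simp [found, h17]
            exact ⟨by simpa using hjS, hadj, Or.inl hjf⟩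
          · simp [h17, h15] at hjf
            have hcall := callDecide_spec (N := N) (s := s') (S := s.toSet N 5) (r := s.v 14)
              (f := s.v 15) (w := j) (Store.toSet_congr h5)
              (by rw [Store.adj_congr h4]; exact h.graph) h14 h15 h17 h.right h.ne
              (by rw [Store.adj_congr h4, h6]; exact h.pm) hjS (h.graph.ne hadj).symm hjf
            rw [Store.adj_congr h4] at hcall
            simp only [Cmd.exec_seq, Cmd.exec_when]
            have hv' : ∀ x, x ∉ callDecide.vars → (callDecide.exec N s').v x = s'.v x :=
              fun x hx => exec_v N _ _ hx
            generalize callDecide.exec N s' = s₁ at *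
            have h17' : s₁.v 17 = j := by rw [hv' 17 (by decide), h17]
            have h18' : s₁.v 18 = 0 := by rw [hv' 18 (by decide), h18]
            rcases hcall with ⟨h21, hP⟩ | ⟨h21, hP⟩
            · rw [if_neg (by simp [h21])]
              refine ⟨by simp [found, h17'], Or.inr ⟨by simp [found], ?_⟩⟩
              simp [found, h17']
              exact ⟨by simpa using hjS, hadj, Or.inr hP⟩
            · rw [if_pos (by simp [h21])]
              refine ⟨by simp [h17'], Or.inl ⟨by simp [h18'], fun w hw hwS hadj => ?_⟩⟩
              rcases Nat.lt_succ_iff_lt_or_eq.1 hw with hw | rfl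
              · exact hI w hw hwS hadj
              · exact ⟨hjf, hP⟩
      · rw [if_pos (by simp [hI.1])]
        exact ⟨by simp [h17], Or.inr (by simpa using hI)⟩)
  obtain ⟨-, ⟨h18, hI⟩ | hI⟩ := key
  · refine Or.inl ⟨h18, fun hP => ?_⟩
    obtain ⟨ν, hν⟩ := hP
    obtain ⟨h1, h2, h3⟩ := hν _ h.left
    refine (hI _ (Store.mem_toSet.1 h1).1 h1 h2).2 ⟨ν, hν.restrict h.left fun v => ?_⟩
    simp only [Finset.mem_erase]; tauto
  · exact Or.inr hI

/-- Fix the edge from `r` to the partner that was found, and continue on the smaller set with the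
old partner of that vertex as the new `r`. Variable `16` signals completion and `13` failure. -/
def augStep : Cmd :=
  .seq tryAll <|
  .ite (var 18)
    -- If the goal itself is the partner, variable `24` is not assigned; the value then copied to
    -- `14` is irrelevant, since `16` stops the loop.
    (.seq (.ite (eq (var 19) (var 15)) (.set 16 (const 1)) (.set 24 (get 6 (var 19)))) <|
    .seq (.fill 6 (ite (eq (var 2) (var 19)) (var 14) (ite (eq (var 2) (var 14)) (var 19)
      (get 6 (var 2))))) <|
    .seq (.fill 5 (and (not (eq (var 2) (var 14))) (and (not (eq (var 2) (var 19))) (get 5 (var 2)))))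
    (.set 14 (var 24)))
  (.set 13 (const 1))

theorem augStep_spec {N : ℕ} {s : Store} (h : Unfinished N s) (h13 : s.v 13 = 0) (h16 : s.v 16 = 0) :
    ((augStep.exec N s).v 13 = 1 ∧ ¬ HasPM (s.adj N 4) (s.toSet N 5)) ∨
    ((augStep.exec N s).v 13 = 0 ∧ (augStep.exec N s).v 16 = 1 ∧ s.adj N 4 (s.v 14) (s.v 15) ∧
      ∀ v < N, (augStep.exec N s).a 6 0 v = exchange (s.a 6 0) (s.v 14) (s.v 15) v) ∨
    ((augStep.exec N s).v 13 = 0 ∧ (augStep.exec N s).v 16 = 0 ∧ ∃ w, Unfinished N (augStep.exec N s) ∧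
      w ∈ s.toSet N 5 ∧ s.adj N 4 (s.v 14) w ∧
      (augStep.exec N s).toSet N 5 = ((s.toSet N 5).erase (s.v 14)).erase w ∧
      HasPM (s.adj N 4) (((s.toSet N 5).erase (s.v 14)).erase w) ∧
      ∀ v < N, (augStep.exec N s).a 6 0 v = exchange (s.a 6 0) (s.v 14) w v) := by
  have ht := tryAll_spec h
  simp only [augStep, Cmd.exec_seq]
  have hv' : ∀ x, x ∉ tryAll.vars → (tryAll.exec N s).v x = s.v x :=
    fun x hx => exec_v N _ _ hx
  have ha' : ∀ A, A ∉ tryAll.arrs → (tryAll.exec N s).a A = s.a A :=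
    fun A hA => exec_a N _ _ hA
  generalize tryAll.exec N s = s₁ at *
  have h4 : s₁.a 4 = s.a 4 := ha' 4 (by decide)
  have h5 : s₁.a 5 = s.a 5 := ha' 5 (by decide)
  have h6 : s₁.a 6 = s.a 6 := ha' 6 (by decide)
  have h14 : s₁.v 14 = s.v 14 := hv' 14 (by decide)
  have h15 : s₁.v 15 = s.v 15 := hv' 15 (by decide)
  have h13' : s₁.v 13 = 0 := by rw [hv' 13 (by decide), h13]
  have h16' : s₁.v 16 = 0 := by rw [hv' 16 (by decide), h16]
  rcases ht with ⟨h18, hP⟩ | ⟨h18, hwS, hadj, hw⟩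
  · left
    simp [h18, hP]
  right
  have hmu : ∀ v < N, ∀ w, (if v = w then s.v 14 else if v = s.v 14 then w else s.a 6 0 v) =
      exchange (s.a 6 0) (s.v 14) w v := by
    intro v _ w
    simp [exchange, Function.update_apply]
  by_cases hwf : s₁.v 19 = s.v 15
  · left
    refine ⟨by simp [h18, hwf, h15, h13'], by simp [h18, hwf, h15], hwf ▸ hadj, fun v hv => ?_⟩
    rw [← hmu v hv]
    simp [h18, hwf, h15, h14, h6, hv]
  right
  have hw := hw.resolve_left hwf
  generalize h19 : s₁.v 19 = w at hwS hadj hw hwf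
  have hwN : w < N := (Store.mem_toSet.1 hwS).1
  have hwr : w ≠ s.v 14 := (h.graph.ne hadj).symm
  obtain ⟨h1, h2, h3⟩ := h.pm w (by simp only [Finset.mem_erase]; exact ⟨hwf, hwr, hwS⟩)
  have hne := h.graph.ne h2
  simp only [Finset.mem_erase] at h1
  rw [Cmd.exec_ite, if_neg (by simp [h18])]
  simp only [Cmd.exec_seq]
  set s₂ := (Cmd.ite (eq (var 19) (var 15)) (.set 16 (const 1)) (.set 24 (get 6 (var 19)))).exec N s₁
    with hs₂
  have e19 : s₁.v 19 = w := h19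
  have hs₂' : s₂ = s₁.set 24 (s.a 6 0 w) := by
    rw [hs₂, Cmd.exec_ite, if_pos (by simp [e19, h15, hwf])]
    simp [e19, hwN, h6]
  rw [hs₂']
  clear_value s₂
  set s₃ := (Cmd.set 14 (var 24)).exec N ((Cmd.fill 5 (and (not (eq (var 2) (var 14)))
    (and (not (eq (var 2) (var 19))) (get 5 (var 2))))).exec N ((Cmd.fill 6 (ite (eq (var 2) (var 19))
    (var 14) (ite (eq (var 2) (var 14)) (var 19) (get 6 (var 2))))).exec N
    (s₁.set 24 (s.a 6 0 w)))) with hs₃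
  have g13 : s₃.v 13 = 0 := by simp [hs₃, h13']
  have g16 : s₃.v 16 = 0 := by simp [hs₃, h16']
  have g14 : s₃.v 14 = s.a 6 0 w := by simp [hs₃]
  have g15 : s₃.v 15 = s.v 15 := by simp [hs₃, h15]
  have g4 : s₃.a 4 = s.a 4 := by simp [hs₃, h4]
  have g6 : ∀ v < N, s₃.a 6 0 v = exchange (s.a 6 0) (s.v 14) w v := by
    intro v hv
    rw [← hmu v hv]
    simp [hs₃, e19, h14, h6, hv]
  have g5 : s₃.toSet N 5 = ((s.toSet N 5).erase (s.v 14)).erase w := by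
    ext v
    by_cases hv : v < N
    · simp [hs₃, e19, h14, h5, hv]; tauto
    · simp [hv]
  clear_value s₃
  refine ⟨g13, g16, w, ⟨?_, ?_, ?_, ?_, ?_⟩, hwS, hadj, g5, hw, g6⟩
  · rw [Store.adj_congr g4]; exact h.graph
  · rw [g14, g5]; simp only [Finset.mem_erase]; exact ⟨hne.symm, h1.2⟩
  · rw [g15, g5]; simp only [Finset.mem_erase]; exact ⟨Ne.symm hwf, h.ne.symm, h.right⟩
  · rw [g14, g15]; exact h1.1
  · rw [g14, g15, g5, Store.adj_congr g4]
    refine (h.pm.restrict (w := w) (by simp only [Finset.mem_erase]; exact ⟨hwf, hwr, hwS⟩)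
      fun v => by simp only [Finset.mem_erase]; tauto).congr fun v hv => ?_
    simp only [Finset.mem_erase] at hv
    rw [g6 v (Store.mem_toSet.1 hv.2.2.2.2).1, exchange, Function.update_of_ne hv.2.2.1,
      Function.update_of_ne hv.2.2.2.1]

/-- Given a matching of the graph in array `4` that misses only the vertices `14` and `15`, find a
perfect matching, or set the variable `13` if there is none. -/
def aug : Cmd :=
  .seq (.fill 5 (get 12 (var 2))) <| .seq (.set 16 (const 0)) <|
  .loop (.when (and (not (var 13)) (not (var 16))) augStep)

/-- Invariant: array `6` perfectly matches the vertices already removed from the working set, as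
well as the working set without its two unmatched vertices, and the working set has a perfect
matching if the whole graph has one. The working set shrinks in every step, so `N` iterations
suffice. -/
theorem aug_spec {N : ℕ} {s : Store} (hE : IsGraph (s.adj N 4)) (hr : s.v 14 ∈ s.toSet N 12)
    (hf : s.v 15 ∈ s.toSet N 12) (hrf : s.v 14 ≠ s.v 15) (h13 : s.v 13 = 0)
    (hpm : IsPM (s.adj N 4) (((s.toSet N 12).erase (s.v 14)).erase (s.v 15)) (s.a 6 0)) :
    ((aug.exec N s).v 13 = 0 ∧ IsPM (s.adj N 4) (s.toSet N 12) ((aug.exec N s).a 6 0)) ∨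
    ((aug.exec N s).v 13 = 1 ∧ ¬ HasPM (s.adj N 4) (s.toSet N 12)) := by
  simp only [aug, Cmd.exec_seq]
  set s₁ := (Cmd.set 16 (const 0)).exec N ((Cmd.fill 5 (get 12 (var 2))).exec N s) with hs₁
  have e4 : s₁.a 4 = s.a 4 := by simp [hs₁]
  have e5 : s₁.toSet N 5 = s.toSet N 12 := by
    ext v
    by_cases hv : v < N <;> simp [hs₁, hv]
  have e6 : s₁.a 6 = s.a 6 := by simp [hs₁]
  have e13 : s₁.v 13 = 0 := by simp [hs₁, h13]
  have e14 : s₁.v 14 = s.v 14 := by simp [hs₁]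
  have e15 : s₁.v 15 = s.v 15 := by simp [hs₁]
  have e16 : s₁.v 16 = 0 := by simp [hs₁]
  clear_value s₁
  set E := s.adj N 4
  set L := s.toSet N 12
  have hLN : L.card ≤ N := card_toSet_le N s 12
  have key := Cmd.loop_inv (N := N) (c := .when (and (not (var 13)) (not (var 16))) augStep) (s := s₁)
    (fun j s' => (s'.v 13 = 0 ∧ s'.v 16 = 0 ∧ Unfinished N s' ∧ s'.toSet N 5 ⊆ L ∧
        IsPM E (L \ s'.toSet N 5) (s'.a 6 0) ∧ (HasPM E L → HasPM E (s'.toSet N 5)) ∧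
        (s'.toSet N 5).card + j ≤ N) ∨
      (s'.v 13 = 0 ∧ s'.v 16 = 1 ∧ IsPM E L (s'.a 6 0)) ∨ (s'.v 13 = 1 ∧ ¬ HasPM E L))
    (by
      refine Or.inl ⟨e13, e16, ⟨?_, ?_, ?_, ?_, ?_⟩, e5.le, ?_, ?_, ?_⟩
      · rw [Store.adj_congr e4]; exact hE
      · rw [e14, e5]; exact hr
      · rw [e15, e5]; exact hf
      · rw [e14, e15]; exact hrf
      · rw [e14, e15, e5, e6, Store.adj_congr e4]; exact hpm
      · rw [e5, Finset.sdiff_self]; intro v hv; simp at hv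
      · rw [e5]; exact id
      · rw [e5]; exact hLN)
    (by
      rintro j hj s' hv ha (⟨h1, h2, h3, h4, h5, h6, h7⟩ | ⟨h1, h2, h3⟩ | h1)
      · have hadj : s'.adj N 4 = E := by rw [Store.adj_congr (ha 4 (by decide)), Store.adj_congr e4]
        rw [Cmd.exec_when, if_neg (by simp [h1, h2])]
        have key := augStep_spec h3 h1 h2
        have ha' : (augStep.exec N s').a 4 = s'.a 4 := exec_a N _ _ (by decide)
        generalize augStep.exec N s' = s'' at *
        rw [hadj] at key
        have hd : ∀ v, v ∈ s'.toSet N 5 → v ∉ L \ s'.toSet N 5 := fun v hv => by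
          simp only [Finset.mem_sdiff, hv, not_true, and_false, not_false_iff]
        have hLlt : ∀ v ∈ L, v < N := fun v hv => (Store.mem_toSet.1 hv).1
        rcases key with ⟨g1, g2⟩ | ⟨g1, g2, g3, g4⟩ | ⟨g1, g2, w, g3, g4, g5, g6, g7, g8⟩
        · exact Or.inr (Or.inr ⟨g1, fun h => g2 (h6 h)⟩)
        · refine Or.inr (Or.inl ⟨g1, g2, ?_⟩)
          have p1 : IsPM E (((s'.toSet N 5).erase (s'.v 14)).erase (s'.v 15)) (s'.a 6 0) :=
            hadj ▸ h3.pm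
          have p2 : IsPM E (L \ {s'.v 14, s'.v 15}) (s'.a 6 0) := by
            intro v hv
            simp only [Finset.mem_sdiff, Finset.mem_insert, Finset.mem_singleton, not_or] at hv ⊢
            by_cases hvS : v ∈ s'.toSet N 5
            · obtain ⟨q1, q2, q3⟩ := p1 v (by simp only [Finset.mem_erase]; tauto)
              simp only [Finset.mem_erase] at q1
              exact ⟨⟨h4 q1.2.2, q1.2.1, q1.1⟩, q2, q3⟩
            · obtain ⟨q1, q2, q3⟩ := h5 v (Finset.mem_sdiff.2 ⟨hv.1, hvS⟩)
              rw [Finset.mem_sdiff] at q1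
              exact ⟨⟨q1.1, fun e => q1.2 (e ▸ h3.left), fun e => q1.2 (e ▸ h3.right)⟩, q2, q3⟩
          refine (p2.add_pair (hadj ▸ h3.graph) (T := L) (by simp) (by simp) g3 fun v => ?_).congr
            fun v hv => g4 v (hLlt v hv)
          simp only [Finset.mem_sdiff, Finset.mem_insert, Finset.mem_singleton, not_or]
          by_cases q1 : v = s'.v 14
          · simp [q1, h4 h3.left]
          by_cases q2 : v = s'.v 15
          · simp [q2, h4 h3.right]
          tauto
        · refine Or.inl ⟨g1, g2, g3, ?_, ?_, fun _ => g6 ▸ g7, ?_⟩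
          · rw [g6]
            exact ((Finset.erase_subset _ _).trans (Finset.erase_subset _ _)).trans h4
          · refine (h5.add_pair (hadj ▸ h3.graph) (T := L \ s''.toSet N 5) (hd _ h3.left)
              (hd _ g4) g5 fun v => ?_).congr fun v hv => g8 v (hLlt v (Finset.mem_sdiff.1 hv).1)
            rw [g6]
            simp only [Finset.mem_sdiff, Finset.mem_erase]
            have a1 := h4 h3.left
            have a2 := h4 g4
            by_cases q1 : v = s'.v 14
            · subst q1; simp [a1]
            by_cases q2 : v = w
            · subst q2; simp [a2]
            simp only [q1, q2, ne_eq, not_false_iff, true_and, or_false]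
          · have c1 : (s''.toSet N 5).card < (s'.toSet N 5).card := by
              rw [g6]
              refine (Finset.card_le_card (Finset.erase_subset _ _)).trans_lt ?_
              exact Finset.card_erase_lt_of_mem h3.left
            omega
      · rw [Cmd.exec_when, if_pos (by simp [h2])]
        exact Or.inr (Or.inl ⟨by simpa using h1, by simpa using h2, h3⟩)
      · rw [Cmd.exec_when, if_pos (by simp [h1.1])]
        exact Or.inr (Or.inr ⟨by simpa using h1.1, h1.2⟩))
  rcases key with ⟨-, -, h3, -, -, -, h7⟩ | ⟨h1, -, h2⟩ | h1
  · have := Finset.card_pos.2 ⟨_, h3.left⟩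
    omega
  · exact Or.inl ⟨h1, h2⟩
  · exact Or.inr h1

end Search
end RAM

/-! ### The matching problem for the active pairs -/

/-- A numerical description of an instance: `G` is the graph on `{0, …, n - 1}`, and `c` a colouring of
its vertices. -/
structure Layout where
  n : ℕ
  k : ℕ
  s : ℕ → ℕ
  t : ℕ → ℕ
  G : ℕ → ℕ → Prop
  c : ℕ → ℕ

namespace Layout
variable (L : Layout)

structure WF : Prop where
  s_lt : ∀ i < L.k, L.s i < L.n
  t_lt : ∀ i < L.k, L.t i < L.n
  ss : ∀ i < L.k, ∀ j < L.k, L.s i = L.s j → i = j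
  st : ∀ i < L.k, ∀ j < L.k, L.s i = L.t j → i = j
  tt : ∀ i < L.k, ∀ j < L.k, L.t i = L.t j → i = j

/-- The pair `i` is neither trivial nor adjacent. -/
def Act (i : ℕ) : Prop := i < L.k ∧ L.s i ≠ L.t i ∧ ¬ L.G (L.s i) (L.t i)

/-- `v` is a nonterminal. -/
def Nt (v : ℕ) : Prop := v < L.n ∧ ∀ i < L.k, L.s i ≠ v ∧ L.t i ≠ v

/-- `v` is the number of a padding vertex. There is one for every nonterminal. -/
def Pad (v : ℕ) : Prop := L.n ≤ v ∧ L.Nt (v - L.n)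

/-- `v` is the number of a vertex of the matching problem. -/
def Live (v : ℕ) : Prop := L.Nt v ∨ L.Pad v ∨ ∃ i, L.Act i ∧ (L.s i = v ∨ L.t i = v)

/-- One orientation of each edge: crossing edges between nonterminals, edges from a common neighbour
to the vertex that represents its pair, and edges from padding vertices to everything else. No edge
joins two padding vertices. -/
def Half (u v : ℕ) : Prop :=
  (L.Nt u ∧ L.Nt v ∧ L.c u ≠ L.c v ∧ L.G u v) ∨
  (L.Nt u ∧ ∃ i, L.Act i ∧ L.s i = v ∧ L.G u (L.s i) ∧ L.G u (L.t i)) ∨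
  (L.Pad u ∧ L.Live v ∧ ¬ L.Pad v)

/-- The edges of the matching problem. Here `s i` stands for a vertex that is to be matched to a common
neighbour of `s i` and `t i`, and `t i` for a vertex that takes one padding vertex away. -/
def Edge (u v : ℕ) : Prop := L.Half u v ∨ L.Half v u

/-- The edges of the matching problem and auxiliary edges for the pairs with number at least `j`. -/
def Aux (j u v : ℕ) : Prop :=
  L.Edge u v ∨ ∃ i, j ≤ i ∧ L.Act i ∧ ((L.s i = u ∧ L.t i = v) ∨ (L.t i = u ∧ L.s i = v))

variable {L}

theorem Nt.not_pad {v : ℕ} (h : L.Nt v) : ¬ L.Pad v := fun h' => by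
  have := h.1
  have := h'.1
  omega

theorem WF.not_pad_s (h : L.WF) {i : ℕ} (hi : L.Act i) : ¬ L.Pad (L.s i) := fun h' => by
  have := h.s_lt i hi.1
  have := h'.1
  omega

theorem WF.not_pad_t (h : L.WF) {i : ℕ} (hi : L.Act i) : ¬ L.Pad (L.t i) := fun h' => by
  have := h.t_lt i hi.1
  have := h'.1
  omega

theorem Nt.ne_s {v i : ℕ} (h : L.Nt v) (hi : L.Act i) : L.s i ≠ v := (h.2 i hi.1).1
theorem Nt.ne_t {v i : ℕ} (h : L.Nt v) (hi : L.Act i) : L.t i ≠ v := (h.2 i hi.1).2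

theorem WF.not_half_s (h : L.WF) {i v : ℕ} (hi : L.Act i) : ¬ L.Half (L.s i) v := by
  rintro (⟨h1, -⟩ | ⟨h1, -⟩ | ⟨h1, -⟩)
  · exact h1.ne_s hi rfl
  · exact h1.ne_s hi rfl
  · exact h.not_pad_s hi h1

theorem WF.not_half_t (h : L.WF) {i v : ℕ} (hi : L.Act i) : ¬ L.Half (L.t i) v := by
  rintro (⟨h1, -⟩ | ⟨h1, -⟩ | ⟨h1, -⟩)
  · exact h1.ne_t hi rfl
  · exact h1.ne_t hi rfl
  · exact h.not_pad_t hi h1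

theorem WF.not_edge (h : L.WF) {i : ℕ} (hi : L.Act i) : ¬ L.Edge (L.s i) (L.t i) := by
  rintro (h1 | h1)
  · exact h.not_half_s hi h1
  · exact h.not_half_t hi h1

theorem Edge.symm {u v : ℕ} (h : L.Edge u v) : L.Edge v u := Or.symm h

theorem isGraph_aux (j : ℕ) : IsGraph (L.Aux j) where
  symm := by
    rintro a b (h | ⟨i, h1, h2, h3⟩)
    · exact Or.inl h.symm
    · exact Or.inr ⟨i, h1, h2, by tauto⟩
  irrefl := by
    rintro a (h | ⟨i, -, h2, h3⟩)
    · rw [Edge, or_self] at h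
      rcases h with ⟨-, -, h, -⟩ | ⟨h, i, hi, rfl, -⟩ | ⟨h, -, h'⟩
      · exact h rfl
      · exact h.ne_s hi rfl
      · exact h' h
    · rcases h3 with ⟨h3, h4⟩ | ⟨h4, h3⟩ <;> exact h2.2.1 (h3.trans h4.symm)

theorem aux_succ_of_not {j : ℕ} (h : ¬ L.Act j) : L.Aux (j + 1) = L.Aux j := by
  funext u v
  simp only [Aux, eq_iff_iff]
  refine or_congr Iff.rfl ⟨fun ⟨i, h1, h2⟩ => ⟨i, by omega, h2⟩, fun ⟨i, h1, h2⟩ => ⟨i, ?_, h2⟩⟩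
  rcases Nat.eq_or_lt_of_le h1 with rfl | h1
  · exact absurd h2.1 h
  · exact h1

/-- `s j` and `t j` are not joined by a proper edge, nor by the auxiliary edge of another pair,
since pairs are disjoint. So deleting one matrix entry and its transpose is enough. -/
theorem WF.aux_succ (hL : L.WF) {j u v : ℕ} (h : L.Act j) : L.Aux (j + 1) u v ↔ L.Aux j u v ∧
    ¬ ((u = L.s j ∧ v = L.t j) ∨ (u = L.t j ∧ v = L.s j)) := by
  constructor
  · rintro (h1 | ⟨i, h1, h2, h3⟩)
    · refine ⟨Or.inl h1, ?_⟩
      rintro (⟨rfl, rfl⟩ | ⟨rfl, rfl⟩)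
      · exact hL.not_edge h h1
      · exact hL.not_edge h h1.symm
    · refine ⟨Or.inr ⟨i, by omega, h2, h3⟩, ?_⟩
      have hij : i ≠ j := by omega
      have := hL.ss i h2.1 j h.1
      have := hL.st i h2.1 j h.1
      have := hL.tt i h2.1 j h.1
      rintro (⟨rfl, rfl⟩ | ⟨rfl, rfl⟩) <;> rcases h3 with ⟨h3, -⟩ | ⟨-, h3⟩ <;> tauto
  · rintro ⟨h1 | ⟨i, h1, h2, h3⟩, h4⟩
    · exact Or.inl h1
    · refine Or.inr ⟨i, ?_, h2, h3⟩
      rcases Nat.eq_or_lt_of_le h1 with rfl | h1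
      · exfalso
        apply h4
        rcases h3 with ⟨h5, h6⟩ | ⟨h5, h6⟩
        · exact Or.inl ⟨h5.symm, h6.symm⟩
        · exact Or.inr ⟨h5.symm, h6.symm⟩
      · exact h1

theorem aux_of_le {j u v : ℕ} (h : L.k ≤ j) : L.Aux j u v ↔ L.Edge u v := by
  refine ⟨?_, Or.inl⟩
  rintro (h1 | ⟨i, h1, h2, -⟩)
  · exact h1
  · have := h2.1
    omega

end Layout

namespace RAM
open _root_.RAM.Expr _root_.RAM.Cmd

@[simp] theorem Expr.eval_sub {N : ℕ} {s : Store} {a b : Expr} :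
    (sub a b).eval N s = a.eval N s - b.eval N s := rfl

def Expr.or (a b : Expr) : Expr := .ite a (.const 1) b

@[simp] theorem Expr.eval_or {N : ℕ} {s : Store} {a b : Expr} :
    (Expr.or a b).eval N s = 0 ↔ ¬ (a.eval N s ≠ 0 ∨ b.eval N s ≠ 0) := by
  simp only [Expr.or, Expr.eval]
  split_ifs <;> simp_all

namespace Main
open Search

/-! ### The main loop

Row `0` of array `3` marks the active pairs, and row `0` of the arrays `13` and `14` holds the
terminals. -/

/-- Delete the auxiliary edge of one pair. A repair is needed only if the current matching uses that
edge, and then exactly its two ends are unmatched. -/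
def cut : Cmd :=
  .seq (.set 14 (get 13 (var 12))) <| .seq (.set 15 (get 14 (var 12))) <|
  .seq (.fill 4 (ite (Expr.or (and (eq (var 1) (var 14)) (eq (var 2) (var 15)))
    (and (eq (var 1) (var 15)) (eq (var 2) (var 14)))) (const 0) (read 4 (var 1) (var 2))))
  (.when (eq (get 6 (var 14)) (var 15)) aug)

def mainStep : Cmd :=
  .seq (.when (and (not (var 13)) (get 3 (var 12))) cut) (.set 12 (add (var 12) (const 1)))

def mainLoop : Cmd := .loop mainStep

structure Ready (N : ℕ) (s : Store) (L : Layout) : Prop where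
  adj : s.adj N 4 = L.Aux 0
  live : ∀ v, v ∈ s.toSet N 12 ↔ L.Live v
  act : ∀ i < N, s.a 3 0 i ≠ 0 ↔ L.Act i
  fst : ∀ i < N, L.Act i → s.a 13 0 i = L.s i
  snd : ∀ i < N, L.Act i → s.a 14 0 i = L.t i
  pm : IsPM (L.Aux 0) (s.toSet N 12) (s.a 6 0)
  index : s.v 12 = 0
  fail : s.v 13 = 0

theorem cut_spec {N : ℕ} {s : Store} {L : Layout} (hL : L.WF) {i : ℕ} (hi : i < N) (hact : L.Act i)
    (h12 : s.v 12 = i) (hs : s.a 13 0 i = L.s i) (ht : s.a 14 0 i = L.t i) (h13 : s.v 13 = 0)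
    (hadj : s.adj N 4 = L.Aux i) (hlive : ∀ v, v ∈ s.toSet N 12 ↔ L.Live v)
    (hpm : IsPM (L.Aux i) (s.toSet N 12) (s.a 6 0)) :
    ((cut.exec N s).v 13 = 0 ∧ (cut.exec N s).adj N 4 = L.Aux (i + 1) ∧
      IsPM (L.Aux (i + 1)) (s.toSet N 12) ((cut.exec N s).a 6 0)) ∨
    ((cut.exec N s).v 13 = 1 ∧ ¬ HasPM (L.Aux (i + 1)) (s.toSet N 12)) := by
  simp only [cut, Cmd.exec_seq]
  set s₁ := (Cmd.fill 4 (ite (Expr.or (and (eq (var 1) (var 14)) (eq (var 2) (var 15)))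
    (and (eq (var 1) (var 15)) (eq (var 2) (var 14)))) (const 0) (read 4 (var 1) (var 2)))).exec N
    ((Cmd.set 15 (get 14 (var 12))).exec N ((Cmd.set 14 (get 13 (var 12))).exec N s)) with hs₁
  have e14 : s₁.v 14 = L.s i := by simp [hs₁, h12, hi, hs]
  have e15 : s₁.v 15 = L.t i := by simp [hs₁, h12, hi, ht]
  have e13 : s₁.v 13 = 0 := by simp [hs₁, h13]
  have e6 : s₁.a 6 = s.a 6 := by simp [hs₁]
  have e12 : s₁.toSet N 12 = s.toSet N 12 := Store.toSet_congr (by simp [hs₁])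
  have e4 : s₁.adj N 4 = L.Aux (i + 1) := by
    funext u v
    rw [eq_iff_iff, hL.aux_succ hact, ← hadj]
    by_cases hu : u < N <;> by_cases hv : v < N
    · simp [hs₁, Store.adj, hu, hv, h12, hi, hs, ht]; tauto
    all_goals simp [Store.adj, hu, hv]
  clear_value s₁
  rw [Cmd.exec_when]
  have hsl : L.s i ∈ s.toSet N 12 := (hlive _).2 (Or.inr (Or.inr ⟨i, hact, Or.inl rfl⟩))
  have htl : L.t i ∈ s.toSet N 12 := (hlive _).2 (Or.inr (Or.inr ⟨i, hact, Or.inr rfl⟩))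
  have hsN : L.s i < N := (Store.mem_toSet.1 hsl).1
  split_ifs with hc
  · simp [e14, e15, hsN, e6] at hc
    left
    refine ⟨by simpa using e13, by rw [← e4]; exact Store.adj_congr rfl, fun v hv => ?_⟩
    simp only [Store.set_a, e6]
    obtain ⟨h1, h2, h3⟩ := hpm v hv
    refine ⟨h1, (hL.aux_succ hact).2 ⟨h2, ?_⟩, h3⟩
    rintro (⟨rfl, h⟩ | ⟨rfl, h⟩)
    · exact hc h
    · exact hc (by rw [← h, h3])
  · simp [e14, e15, hsN, e6] at hc
    have key := aug_spec (N := N) (s := s₁) (by rw [e4]; exact L.isGraph_aux _)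
      (by rw [e12, e14]; exact hsl) (by rw [e12, e15]; exact htl) (by rw [e14, e15]; exact hact.2.1)
      e13 (by
        rw [e4, e12, e14, e15, e6]
        intro v hv
        have := hpm.restrict (w := L.s i) hsl (T := ((s.toSet N 12).erase (L.s i)).erase (L.t i))
          (fun v => by rw [hc]; simp only [Finset.mem_erase]; tauto) v hv
        refine ⟨this.1, (hL.aux_succ hact).2 ⟨this.2.1, ?_⟩, this.2.2⟩
        simp only [Finset.mem_erase] at hv
        tauto)
    rw [e12, e4] at key
    have ha : (aug.exec N s₁).a 4 = s₁.a 4 := exec_a N _ _ (by decide)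
    rcases key with ⟨k1, k2⟩ | k1
    · exact Or.inl ⟨k1, by rw [Store.adj_congr ha, e4], k2⟩
    · exact Or.inr k1

/-- A failure at any stage is final: the proper edges are contained in each of the intermediate
graphs. -/
theorem mainLoop_spec {N : ℕ} {s : Store} {L : Layout} (hL : L.WF) (hk : L.k ≤ N) (h : Ready N s L) :
    ((mainLoop.exec N s).v 13 = 0 ∧ HasPM L.Edge (s.toSet N 12)) ∨
    ((mainLoop.exec N s).v 13 = 1 ∧ ¬ HasPM L.Edge (s.toSet N 12)) := by
  have key := Cmd.loop_inv (N := N) (c := mainStep) (s := s)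
    (fun j s' => s'.v 12 = j ∧ ((s'.v 13 = 0 ∧ s'.adj N 4 = L.Aux j ∧
      IsPM (L.Aux j) (s.toSet N 12) (s'.a 6 0)) ∨ (s'.v 13 = 1 ∧ ¬ HasPM L.Edge (s.toSet N 12))))
    ⟨h.index, Or.inl ⟨h.fail, h.adj, h.pm⟩⟩ (by
      rintro j hj s' hv ha ⟨h12, hI⟩
      have a3 : s'.a 3 = s.a 3 := ha 3 (by decide)
      have a12 : s'.toSet N 12 = s.toSet N 12 := Store.toSet_congr (ha 12 (by decide))
      have a13 : s'.a 13 = s.a 13 := ha 13 (by decide)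
      have a14 : s'.a 14 = s.a 14 := ha 14 (by decide)
      simp only [mainStep, Cmd.exec_seq, Cmd.exec_when]
      rcases hI with ⟨h13, hadj, hpm⟩ | ⟨h13, hI⟩
      · split_ifs with hc
        · simp [h13, h12, hj, a3] at hc
          have hna : ¬ L.Act j := fun h' => (h.act j hj).2 h' hc
          refine ⟨by simp [h12], Or.inl ⟨by simp [h13], ?_, ?_⟩⟩
          · rw [L.aux_succ_of_not hna, ← hadj]; exact Store.adj_congr rfl
          · rw [L.aux_succ_of_not hna]; exact hpm
        · simp [h13, h12, hj, a3] at hc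
          have hact := (h.act j hj).1 hc
          have key := cut_spec hL hj hact h12 (by rw [a13, h.fst j hj hact])
            (by rw [a14, h.snd j hj hact]) h13 hadj (by rw [a12]; exact h.live) (by rw [a12]; exact hpm)
          have hv' : (cut.exec N s').v 12 = s'.v 12 := exec_v N _ _ (by decide)
          rw [a12] at key
          refine ⟨by simp [hv', h12], ?_⟩
          rcases key with ⟨k1, k2, k3⟩ | ⟨k1, k2⟩
          · exact Or.inl ⟨by simp [k1], by rw [← k2]; exact Store.adj_congr rfl, k3⟩
          · refine Or.inr ⟨by simp [k1], fun hP => k2 (hP.mono fun a _ b _ hab => Or.inl hab)⟩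
      · rw [if_pos (by simp [h13])]
        exact ⟨by simp [h12], Or.inr ⟨by simp [h13], hI⟩⟩)
  obtain ⟨-, ⟨h1, -, h2⟩ | h1⟩ := key
  · exact Or.inl ⟨h1, _, fun v hv => ⟨(h2 v hv).1, (L.aux_of_le hk).1 (h2 v hv).2.1, (h2 v hv).2.2⟩⟩
  · exact Or.inr h1

end Main
end RAM

namespace RAM
open _root_.RAM.Expr _root_.RAM.Cmd

namespace Main
open Search

/-! ### Colouring the complement

Array `1` holds the graph on the vertices less than variable `10`, row `0` of array `2` the colours. -/

/-- The coloured vertex `b` forces the colour of the vertex `a`. -/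
def forces (a b : ℕ) : Expr :=
  and (lt (var b) (var 10)) (and (not (eq (var b) (var a)))
    (and (get 2 (var b)) (not (read 1 (var a) (var b)))))

def uncoloured (a : ℕ) : Expr := and (lt (var a) (var 10)) (not (get 2 (var a)))

/-- Colour `0` means uncoloured. A vertex with a coloured non-neighbour receives the other colour;
only if nothing is forced is a fresh vertex given the colour `1`. -/
def colourStep : Cmd :=
  .seq (.set 22 (least 3 (and (uncoloured 3) (sum 4 (forces 3 4))))) <|
  .ite (inRange 22)
    (.seq (.set 23 (least 4 (forces 22 4)))
      (.fill 2 (ite (eq (var 2) (var 22)) (sub (const 3) (get 2 (var 23))) (get 2 (var 2)))))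
    (.seq (.set 22 (least 3 (uncoloured 3)))
      (.fill 2 (ite (eq (var 2) (var 22)) (const 1) (get 2 (var 2)))))

def colour : Cmd := .seq (.fill 2 (const 0)) (.loop colourStep)

/-- `c` is a colouring with the colours `1` and `2` such that nonadjacent vertices differ. -/
def IsColouring (n : ℕ) (G : ℕ → ℕ → Prop) (c : ℕ → ℕ) : Prop :=
  (∀ v < n, c v = 1 ∨ c v = 2) ∧ ∀ u < n, ∀ v < n, u ≠ v → ¬ G u v → c u ≠ c v

/-- The partial colouring always extends to a full one, but not always to the same one, so the
witness `c'` may change. -/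
theorem colourStep_spec {N : ℕ} {s : Store} {n : ℕ} (hn : n ≤ N) (h10 : s.v 10 = n)
    (hsymm : ∀ u v, s.a 1 u v ≠ 0 → s.a 1 v u ≠ 0) {c : ℕ → ℕ}
    (hc : IsColouring n (fun u v => s.a 1 u v ≠ 0) c) (hcol : ∀ v < n, s.a 2 0 v = 0 ∨ s.a 2 0 v = c v) :
    ∃ c' w, IsColouring n (fun u v => s.a 1 u v ≠ 0) c' ∧
      (∀ v < n, (colourStep.exec N s).a 2 0 v = if v = w then c' w else s.a 2 0 v) ∧
      (∀ v < n, s.a 2 0 v = 0 ∨ s.a 2 0 v = c' v) ∧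
      ((w < n ∧ s.a 2 0 w = 0) ∨ ∀ v < n, s.a 2 0 v ≠ 0) := by
  have h1 := eval_least (N := N) (s := s) (x := 3) (e := and (uncoloured 3) (sum 4 (forces 3 4)))
    (by decide) (by decide)
  simp only [colourStep, Cmd.exec_seq, Cmd.exec_set]
  generalize (least 3 (and (uncoloured 3) (sum 4 (forces 3 4)))).eval N s = w at h1
  rcases h1 with ⟨hw, h1⟩ | ⟨rfl, h1⟩
  · have h2 := eval_least (N := N) (s := s.set 22 w) (x := 4) (e := forces 22 4) (by decide) (by decide)
    rw [Cmd.exec_ite, if_neg (by simp [hw])]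
    simp only [Cmd.exec_seq, Cmd.exec_set]
    generalize (least 4 (forces 22 4)).eval N (s.set 22 w) = u at h2
    simp [uncoloured, forces, hw, h10] at h1
    obtain ⟨hwn, hw0, x, hx, hx1, hx2, -, hx3, hx4⟩ := h1
    rcases h2 with ⟨hu, h2⟩ | ⟨rfl, h2⟩
    · simp [forces, hu, hw, h10] at h2
      obtain ⟨hun, huw, hu0, huG⟩ := h2
      refine ⟨c, w, hc, fun v hv => ?_, hcol, Or.inl ⟨hwn, hw0⟩⟩
      have e1 : s.a 2 0 u = c u := (hcol u hun).resolve_left hu0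
      have e2 := hc.1 u hun
      have e3 := hc.1 w hwn
      have e4 := hc.2 w hwn u hun (Ne.symm huw) (by simpa using huG)
      by_cases hvw : v = w
      · simp [hvw, hu, e1]; omega
      · simp [hvw, hv.trans_le hn]
    · have := h2 x hx
      simp [forces, h10, hx1, hx2, hx, hw] at this
      exact absurd (hx4 hx) (this hx3)
  · rw [Cmd.exec_ite, if_pos (by simp)]
    simp only [Cmd.exec_seq, Cmd.exec_set]
    -- In this case no vertex is forced and the first search returned the bound, so that `w` now
    -- denotes `N`.
    have h2 := eval_least (N := w) (s := s.set 22 w) (x := 3) (e := uncoloured 3) (by decide) (by decide)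
    generalize (least 3 (uncoloured 3)).eval w (s.set 22 w) = u at h2
    have hfill : ∀ v < n, ((Cmd.fill 2 (ite (eq (var 2) (var 22)) (const 1) (get 2 (var 2)))).exec w
        ((s.set 22 w).set 22 u)).a 2 0 v = if v = u then 1 else s.a 2 0 v := by
      intro v hv
      by_cases hvu : v = u
      · simp [hvu]
      · simp [hvu, hv.trans_le hn]
    rcases h2 with ⟨hu, h2⟩ | ⟨rfl, h2⟩
    swap
    · refine ⟨c, u, hc, fun v hv => ?_, hcol, Or.inr fun v hv => ?_⟩
      · have : v ≠ u := by omega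
        rw [hfill v hv, if_neg this, if_neg this]
      · have := h2 v (by omega)
        simpa [uncoloured, h10, hv, hv.trans_le hn] using this
    simp [uncoloured, hu, h10] at h2
    obtain ⟨hun, hu0⟩ := h2
    have hG : ∀ a < n, ∀ b < n, s.a 2 0 a = 0 → s.a 2 0 b ≠ 0 → s.a 1 a b ≠ 0 := by
      intro a ha b hb ha0 hb0
      have := h1 a (by omega)
      simp [uncoloured, forces, ha, ha.trans_le hn, h10, ha0] at this
      have := this b (by omega) hb (fun e => hb0 (e ▸ ha0))
      simp [hb.trans_le hn] at this
      exact this hb0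
    by_cases hcu : c u = 1
    · refine ⟨c, u, hc, fun v hv => by rw [hfill v hv, hcu], hcol, Or.inl ⟨hun, hu0⟩⟩
    -- No coloured vertex is nonadjacent to an uncoloured one. So both colours may be exchanged on
    -- the whole uncoloured part, which makes the choice of `1` for `u` correct.
    · refine ⟨fun v => if s.a 2 0 v = 0 then 3 - c v else c v, u, ⟨fun v hv => ?_, ?_⟩, fun v hv => ?_,
        fun v hv => ?_, Or.inl ⟨hun, hu0⟩⟩
      · have := hc.1 v hv
        dsimp only
        split_ifs <;> omega
      · intro a ha b hb hab hG'
        have := hc.1 a ha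
        have := hc.1 b hb
        have := hc.2 a ha b hb hab hG'
        dsimp only
        split_ifs with g1 g2 g2
        · omega
        · exact absurd (hG a ha b hb g1 g2) hG'
        · exact absurd (hsymm _ _ (hG b hb a ha g2 g1)) hG'
        · exact this
      · rw [hfill v hv]
        have := hc.1 u hun
        simp only [hu0, if_true]
        have : 3 - c u = 1 := by omega
        rw [this]
      · by_cases hv0 : s.a 2 0 v = 0
        · exact Or.inl hv0
        · have := hcol v hv
          simp only [if_neg hv0]; tauto

theorem colour_spec {N : ℕ} {s : Store} {n : ℕ} (hn : n ≤ N) (h10 : s.v 10 = n)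
    (hsymm : ∀ u v, s.a 1 u v ≠ 0 → s.a 1 v u ≠ 0) {c : ℕ → ℕ}
    (hc : IsColouring n (fun u v => s.a 1 u v ≠ 0) c) :
    IsColouring n (fun u v => s.a 1 u v ≠ 0) ((colour.exec N s).a 2 0) := by
  simp only [colour, Cmd.exec_seq]
  have key := Cmd.loop_inv (N := N) (c := colourStep) (s := (Cmd.fill 2 (const 0)).exec N s)
    (fun j s' => ∃ c, IsColouring n (fun u v => s.a 1 u v ≠ 0) c ∧
      (∀ v < n, s'.a 2 0 v = 0 ∨ s'.a 2 0 v = c v) ∧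
      ((((Finset.range n).filter fun v => s'.a 2 0 v = 0).card + j ≤ n) ∨ ∀ v < n, s'.a 2 0 v ≠ 0))
    ⟨c, hc, fun v _ => Or.inl (by simp), Or.inl (by simp)⟩ (by
      rintro j hj s' hv ha ⟨c, hc, hcol, hcard⟩
      have a1 : s'.a 1 = s.a 1 := by rw [ha 1 (by decide)]; simp
      have h10' : s'.v 10 = n := by rw [hv 10 (by decide)]; simp [h10]
      obtain ⟨c', w, g1, g2, g3, g4⟩ := colourStep_spec hn h10' (by rw [a1]; exact hsymm)
        (by rw [a1]; exact hc) hcol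
      generalize colourStep.exec N s' = s'' at *
      rw [a1] at g1
      refine ⟨c', g1, fun v hv => ?_, ?_⟩
      · rw [g2 v hv]
        split_ifs with hvw
        · exact Or.inr (hvw ▸ rfl)
        · exact g3 v hv
      · have hne : ∀ v < n, s'.a 2 0 v ≠ 0 → s''.a 2 0 v ≠ 0 := by
          intro v hv h0
          rw [g2 v hv]
          split_ifs with hvw
          · subst hvw
            have := g1.1 v hv
            omega
          · exact h0
        rcases hcard with hcard | hcard
        swap
        · exact Or.inr fun v hv => hne v hv (hcard v hv)
        rcases g4 with ⟨hw, hw0⟩ | g4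
        swap
        · exact Or.inr fun v hv => hne v hv (g4 v hv)
        left
        have : ((Finset.range n).filter fun v => s''.a 2 0 v = 0).card <
            ((Finset.range n).filter fun v => s'.a 2 0 v = 0).card := by
          refine Finset.card_lt_card (Finset.ssubset_iff_of_subset ?_ |>.2 ⟨w, ?_, ?_⟩)
          · intro v hv
            simp only [Finset.mem_filter, Finset.mem_range] at hv ⊢
            exact ⟨hv.1, by_contra fun h => hne v hv.1 h hv.2⟩
          · simp [hw, hw0]
          · have := g1.1 w hw
            simp only [Finset.mem_filter, g2 w hw, if_true]
            omega
        omega)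
  obtain ⟨c, hc, hcol, hcard⟩ := key
  generalize (Cmd.loop colourStep).exec N ((Cmd.fill 2 (const 0)).exec N s) = s₁ at *
  have hfull : ∀ v < n, s₁.a 2 0 v ≠ 0 := by
    rcases hcard with hcard | hcard
    · have : ((Finset.range n).filter fun v => s₁.a 2 0 v = 0) = ∅ := by
        rw [← Finset.card_eq_zero]; omega
      intro v hv h0
      have h' : v ∈ (Finset.range n).filter fun v => s₁.a 2 0 v = 0 := by simp [hv, h0]
      rw [this] at h'
      simp at h'
    · exact hcard
  have heq : ∀ v < n, s₁.a 2 0 v = c v := fun v hv => (hcol v hv).resolve_left (hfull v hv)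
  exact ⟨fun v hv => by rw [heq v hv]; exact hc.1 v hv,
    fun u hu v hv => by rw [heq u hu, heq v hv]; exact hc.2 u hu v hv⟩

end Main
end RAM

theorem Layout.WF.live_lt {L : Layout} (h : L.WF) {v : ℕ} (hv : L.Live v) : v < 2 * L.n := by
  rcases hv with hv | hv | ⟨i, hi, rfl | rfl⟩
  · have := hv.1; omega
  · have := hv.1; have := hv.2.1; omega
  · have := h.s_lt i hi.1; omega
  · have := h.t_lt i hi.1; omega

namespace RAM
open _root_.RAM.Expr _root_.RAM.Cmd

namespace Main
open Search

/-! ### Setting up the matching problem -/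

/-- The terminals and the active pairs. -/
def pairs : Cmd :=
  .seq (.fill 13 (get 0 (add (const 2) (var 2)))) <|
  .seq (.fill 14 (get 0 (add (const 2) (add (var 11) (var 2)))))
  (.fill 3 (and (lt (var 2) (var 11)) (and (not (eq (get 13 (var 2)) (get 14 (var 2))))
    (not (read 1 (get 13 (var 2)) (get 14 (var 2)))))))

/-- The vertices of the matching problem. -/
def vertices : Cmd :=
  .seq (.fill 15 (and (lt (var 2) (var 10)) (not (sum 3 (and (lt (var 3) (var 11))
    (Expr.or (eq (get 13 (var 3)) (var 2)) (eq (get 14 (var 3)) (var 2)))))))) <|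
  .seq (.fill 16 (and (not (lt (var 2) (var 10))) (get 15 (sub (var 2) (var 10)))))
  (.fill 12 (Expr.or (get 15 (var 2)) (Expr.or (get 16 (var 2)) (sum 3 (and (get 3 (var 3))
    (Expr.or (eq (get 13 (var 3)) (var 2)) (eq (get 14 (var 3)) (var 2))))))))

/-- The matching that consists of auxiliary edges. -/
def startMatching : Cmd :=
  .seq (.fill 17 (least 3 (and (get 3 (var 3))
    (Expr.or (eq (get 13 (var 3)) (var 2)) (eq (get 14 (var 3)) (var 2))))))
  (.fill 6 (ite (get 15 (var 2)) (add (var 2) (var 10)) (ite (get 16 (var 2)) (sub (var 2) (var 10))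
    (ite (eq (get 13 (get 17 (var 2))) (var 2)) (get 14 (get 17 (var 2))) (get 13 (get 17 (var 2)))))))

def half (a b : ℕ) : Expr :=
  Expr.or (and (get 15 (var a)) (and (get 15 (var b)) (and (not (eq (get 2 (var a)) (get 2 (var b))))
    (read 1 (var a) (var b))))) <|
  Expr.or (and (get 15 (var a)) (sum 3 (and (get 3 (var 3)) (and (eq (get 13 (var 3)) (var b))
    (and (read 1 (var a) (get 13 (var 3))) (read 1 (var a) (get 14 (var 3)))))))) <|
  and (get 16 (var a)) (and (get 12 (var b)) (not (get 16 (var b))))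

def edges : Cmd :=
  .fill 4 (Expr.or (Expr.or (half 1 2) (half 2 1)) (sum 3 (and (get 3 (var 3))
    (Expr.or (and (eq (get 13 (var 3)) (var 1)) (eq (get 14 (var 3)) (var 2)))
    (and (eq (get 14 (var 3)) (var 1)) (eq (get 13 (var 3)) (var 2)))))))

theorem pairs_spec {N : ℕ} {s : Store} {L : Layout} (hL : L.WF) (hn : L.n ≤ N) (hk : 2 + 2 * L.k ≤ N)
    (h11 : s.v 11 = L.k) (hs : ∀ i < L.k, s.a 0 0 (2 + i) = L.s i)
    (ht : ∀ i < L.k, s.a 0 0 (2 + (L.k + i)) = L.t i)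
    (hG : ∀ u < N, ∀ v < N, s.a 1 u v ≠ 0 ↔ L.G u v) :
    (∀ i < L.k, (pairs.exec N s).a 13 0 i = L.s i) ∧ (∀ i < L.k, (pairs.exec N s).a 14 0 i = L.t i) ∧
    ∀ i < N, (pairs.exec N s).a 3 0 i ≠ 0 ↔ L.Act i := by
  simp only [pairs, Cmd.exec_seq]
  set s₁ := (Cmd.fill 14 (get 0 (add (const 2) (add (var 11) (var 2))))).exec N
    ((Cmd.fill 13 (get 0 (add (const 2) (var 2)))).exec N s) with hs₁
  have e1 : s₁.a 1 = s.a 1 := by simp [hs₁]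
  have e11 : s₁.v 11 = L.k := by simp [hs₁, h11]
  have e13 : ∀ i < L.k, s₁.a 13 0 i = L.s i := by
    intro i hi
    have : 2 + i < N := by omega
    simp [hs₁, this, hs i hi]
  have e14 : ∀ i < L.k, s₁.a 14 0 i = L.t i := by
    intro i hi
    have : 2 + (L.k + i) < N := by omega
    simp [hs₁, h11, this, ht i hi]
  clear_value s₁
  refine ⟨fun i hi => by simpa using e13 i hi, fun i hi => by simpa using e14 i hi, fun i hi => ?_⟩
  by_cases hik : i < L.k
  · have h1 := (hL.s_lt i hik).trans_le hn
    have h2 := (hL.t_lt i hik).trans_le hn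
    simp [e11, hik, e13, e14, hi, e1, h1, h2, Layout.Act, ← hG _ h1 _ h2]
  · simp [e11, hik, Layout.Act]

theorem vertices_spec {N : ℕ} {s : Store} {L : Layout} (hL : L.WF) (hn : 2 * L.n ≤ N)
    (hk : L.k ≤ N) (h10 : s.v 10 = L.n) (h11 : s.v 11 = L.k) (hs : ∀ i < L.k, s.a 13 0 i = L.s i)
    (ht : ∀ i < L.k, s.a 14 0 i = L.t i) (hact : ∀ i < N, s.a 3 0 i ≠ 0 ↔ L.Act i) :
    (∀ v < N, (vertices.exec N s).a 15 0 v ≠ 0 ↔ L.Nt v) ∧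
    (∀ v < N, (vertices.exec N s).a 16 0 v ≠ 0 ↔ L.Pad v) ∧
    ∀ v, v ∈ (vertices.exec N s).toSet N 12 ↔ L.Live v := by
  simp only [vertices, Cmd.exec_seq]
  set s₁ := (Cmd.fill 15 (and (lt (var 2) (var 10)) (not (sum 3 (and (lt (var 3) (var 11))
    (Expr.or (eq (get 13 (var 3)) (var 2)) (eq (get 14 (var 3)) (var 2)))))))).exec N s with hs₁
  have f15 : ∀ v < N, s₁.a 15 0 v ≠ 0 ↔ L.Nt v := by
    intro v hv
    simp only [hs₁, Layout.Nt]
    simp [h10, h11]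
    intro hvn
    refine ⟨fun h i hi => ?_, fun h i hi hik => ?_⟩
    · have := h i (by omega) hi
      simp [hs i hi, ht i hi, hi.trans_le hk] at this
      exact this
    · simp [hs i hik, ht i hik, hi]
      exact h i hik
  have e10 : s₁.v 10 = L.n := by simp [hs₁, h10]
  have e3 : s₁.a 3 = s.a 3 := by simp [hs₁]
  have e13 : s₁.a 13 = s.a 13 := by simp [hs₁]
  have e14 : s₁.a 14 = s.a 14 := by simp [hs₁]
  clear_value s₁
  set s₂ := (Cmd.fill 16 (and (not (lt (var 2) (var 10)))
    (get 15 (sub (var 2) (var 10))))).exec N s₁ with hs₂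
  have f16 : ∀ v < N, s₂.a 16 0 v ≠ 0 ↔ L.Pad v := by
    intro v hv
    have : v - L.n < N := by omega
    simp [hs₂, e10, Layout.Pad, this, ← f15 _ this]
  have g3 : s₂.a 3 = s.a 3 := by simp [hs₂, e3]
  have g13 : s₂.a 13 = s.a 13 := by simp [hs₂, e13]
  have g14 : s₂.a 14 = s.a 14 := by simp [hs₂, e14]
  have g15 : s₂.a 15 = s₁.a 15 := by simp [hs₂]
  clear_value s₂
  refine ⟨fun v hv => ?_, fun v hv => ?_, fun v => ?_⟩
  · rw [← f15 v hv, ← g15]; simp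
  · rw [← f16 v hv]; simp
  · by_cases hv : v < N
    swap
    · simp only [Store.mem_toSet, hv, false_and, false_iff]
      exact fun h => hv ((hL.live_lt h).trans_le hn)
    have hsum : (sum 3 (and (get 3 (var 3)) (Expr.or (eq (get 13 (var 3)) (var 2))
        (eq (get 14 (var 3)) (var 2))))).eval N ((s₂.set 1 0).set 2 v) = 0 ↔
        ¬ ∃ i, L.Act i ∧ (L.s i = v ∨ L.t i = v) := by
      push Not
      rw [eval_sum]
      refine ⟨fun h i hi => ?_, fun h i hi => ?_⟩
      · have hiN : i < N := hi.1.trans_le hk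
        have := h i hiN
        simpa [hiN, g3, g13, g14, hs i hi.1, ht i hi.1, (hact i hiN).2 hi] using this
      · by_cases hA : L.Act i
        · simpa [hi, g3, g13, g14, hs i hA.1, ht i hA.1, (hact i hi).2 hA] using h i hA
        · have := mt (hact i hi).1 hA
          simp only [ne_eq, not_not] at this
          simp [hi, g3, this]
    rw [Layout.Live, ← f15 v hv, ← f16 v hv, ← g15]
    simp only [Store.mem_toSet, hv, true_and, Cmd.exec_fill, Store.setArr_a, if_true]
    generalize (∃ i, L.Act i ∧ (L.s i = v ∨ L.t i = v)) = P at hsum ⊢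
    simp [hv, hsum, -eval_sum]
    tauto

theorem startMatching_spec {N : ℕ} {s : Store} {L : Layout} (hL : L.WF) (hn : 2 * L.n ≤ N)
    (hk : L.k ≤ N) (h10 : s.v 10 = L.n) (hs : ∀ i < L.k, s.a 13 0 i = L.s i)
    (ht : ∀ i < L.k, s.a 14 0 i = L.t i) (hact : ∀ i < N, s.a 3 0 i ≠ 0 ↔ L.Act i)
    (hnt : ∀ v < N, s.a 15 0 v ≠ 0 ↔ L.Nt v) (hpad : ∀ v < N, s.a 16 0 v ≠ 0 ↔ L.Pad v)
    {S : Finset ℕ} (hS : ∀ v, v ∈ S ↔ L.Live v) :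
    IsPM (L.Aux 0) S ((startMatching.exec N s).a 6 0) := by
  have hSN : ∀ v ∈ S, v < N := fun v hv => (hL.live_lt ((hS v).1 hv)).trans_le hn
  simp only [startMatching, Cmd.exec_seq]
  set s₁ := (Cmd.fill 17 (least 3 (and (get 3 (var 3))
    (Expr.or (eq (get 13 (var 3)) (var 2)) (eq (get 14 (var 3)) (var 2)))))).exec N s with hs₁
  -- Array `17` sends a terminal of an active pair to the number of its pair, which is unique since
  -- the pairs are disjoint.
  have f17 : ∀ i, L.Act i → s₁.a 17 0 (L.s i) = i ∧ s₁.a 17 0 (L.t i) = i := by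
    have aux : ∀ v i, L.Act i → (L.s i = v ∨ L.t i = v) → s₁.a 17 0 v = i := by
      intro v i hi hv
      have hiN := hi.1.trans_le hk
      have h1 := eval_least (N := N) (s := (s.set 1 0).set 2 v) (x := 3) (e := and (get 3 (var 3))
        (Expr.or (eq (get 13 (var 3)) (var 2)) (eq (get 14 (var 3)) (var 2)))) (by decide) (by decide)
      have h2 : s₁.a 17 0 v = (least 3 (and (get 3 (var 3))
        (Expr.or (eq (get 13 (var 3)) (var 2)) (eq (get 14 (var 3)) (var 2))))).eval N
        ((s.set 1 0).set 2 v) := by simp [hs₁]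
      rw [h2]
      generalize (least 3 (and (get 3 (var 3)) (Expr.or (eq (get 13 (var 3)) (var 2))
        (eq (get 14 (var 3)) (var 2))))).eval N ((s.set 1 0).set 2 v) = j at h1
      rcases h1 with ⟨hj, h1⟩ | ⟨-, h1⟩
      · simp [hj] at h1
        have hA := (hact j hj).1 h1.1
        rw [hs j hA.1, ht j hA.1] at h1
        have h2 : L.s j = v ∨ L.t j = v := by tauto
        rcases h2 with h | h <;> rcases hv with h' | h'
        · exact hL.ss j hA.1 i hi.1 (h.trans h'.symm)
        · exact hL.st j hA.1 i hi.1 (h.trans h'.symm)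
        · exact (hL.st i hi.1 j hA.1 (h'.trans h.symm)).symm
        · exact hL.tt j hA.1 i hi.1 (h.trans h'.symm)
      · have := h1 i hiN
        simp [hiN, hs i hi.1, ht i hi.1] at this
        have := this ((hact i hiN).2 hi)
        tauto
    exact fun i hi => ⟨aux _ i hi (Or.inl rfl), aux _ i hi (Or.inr rfl)⟩
  have e10 : s₁.v 10 = L.n := by simp [hs₁, h10]
  have e13 : s₁.a 13 = s.a 13 := by simp [hs₁]
  have e14 : s₁.a 14 = s.a 14 := by simp [hs₁]
  have e15 : s₁.a 15 = s.a 15 := by simp [hs₁]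
  have e16 : s₁.a 16 = s.a 16 := by simp [hs₁]
  clear_value s₁
  set μ := ((Cmd.fill 6 (ite (get 15 (var 2)) (add (var 2) (var 10)) (ite (get 16 (var 2))
    (sub (var 2) (var 10)) (ite (eq (get 13 (get 17 (var 2))) (var 2)) (get 14 (get 17 (var 2)))
      (get 13 (get 17 (var 2))))))).exec N s₁).a 6 0 with hμ
  have m1 : ∀ v, L.Nt v → μ v = v + L.n := by
    intro v hv
    have hvN : v < N := by have := hv.1; omega
    have := (hnt v hvN).2 hv
    simp [hμ, hvN, e15, this, e10]
  have m2 : ∀ v, L.Pad v → μ v = v - L.n := by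
    intro v hv
    have hvN : v < N := by have := hv.1; have := hv.2.1; omega
    have h1 := (hpad v hvN).2 hv
    have h2 : s.a 15 0 v = 0 := by_contra fun h => ((hnt v hvN).1 h).not_pad hv
    simp [hμ, hvN, e15, e16, h1, h2, e10]
  have m3 : ∀ i, L.Act i → μ (L.s i) = L.t i ∧ μ (L.t i) = L.s i := by
    intro i hi
    have h1 : L.s i < N := by have := hL.s_lt i hi.1; omega
    have h2 : L.t i < N := by have := hL.t_lt i hi.1; omega
    have hiN := hi.1.trans_le hk
    have h3 : s.a 15 0 (L.s i) = 0 := by_contra fun h => ((hnt _ h1).1 h).ne_s hi rfl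
    have h4 : s.a 15 0 (L.t i) = 0 := by_contra fun h => ((hnt _ h2).1 h).ne_t hi rfl
    have h5 : s.a 16 0 (L.s i) = 0 := by_contra fun h => hL.not_pad_s hi ((hpad _ h1).1 h)
    have h6 : s.a 16 0 (L.t i) = 0 := by_contra fun h => hL.not_pad_t hi ((hpad _ h2).1 h)
    constructor
    · simp [hμ, h1, e15, e16, h3, h5, (f17 i hi).1, hiN, e13, e14, hs i hi.1, ht i hi.1]
    · simp [hμ, h2, e15, e16, h4, h6, (f17 i hi).2, hiN, e13, e14, hs i hi.1, hi.2.1]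
  clear_value μ
  intro v hv
  rcases (hS v).1 hv with h | h | ⟨i, hi, rfl | rfl⟩
  · have hp : L.Pad (v + L.n) := ⟨by omega, by simpa using h⟩
    rw [m1 v h, m2 _ hp]
    refine ⟨(hS _).2 (Or.inr (Or.inl hp)), Or.inl (Or.inr ?_), by omega⟩
    exact Or.inr (Or.inr ⟨hp, Or.inl h, h.not_pad⟩)
  · rw [m2 v h, m1 _ h.2]
    refine ⟨(hS _).2 (Or.inl h.2), Or.inl (Or.inl ?_), by have := h.1; omega⟩
    exact Or.inr (Or.inr ⟨h, Or.inl h.2, h.2.not_pad⟩)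
  · rw [(m3 i hi).1, (m3 i hi).2]
    exact ⟨(hS _).2 (Or.inr (Or.inr ⟨i, hi, Or.inr rfl⟩)),
      Or.inr ⟨i, by omega, hi, Or.inl ⟨rfl, rfl⟩⟩, rfl⟩
  · rw [(m3 i hi).2, (m3 i hi).1]
    exact ⟨(hS _).2 (Or.inr (Or.inr ⟨i, hi, Or.inl rfl⟩)),
      Or.inr ⟨i, by omega, hi, Or.inr ⟨rfl, rfl⟩⟩, rfl⟩

/-- Variable `3` is bound by the sum inside the expression and must not hold an end of the edge. -/
theorem half_spec {N : ℕ} {s : Store} {L : Layout} (hL : L.WF) (hn : 2 * L.n ≤ N)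
    (hk : L.k ≤ N) (hs : ∀ i < L.k, s.a 13 0 i = L.s i)
    (ht : ∀ i < L.k, s.a 14 0 i = L.t i) (hact : ∀ i < N, s.a 3 0 i ≠ 0 ↔ L.Act i)
    (hnt : ∀ v < N, s.a 15 0 v ≠ 0 ↔ L.Nt v) (hpad : ∀ v < N, s.a 16 0 v ≠ 0 ↔ L.Pad v)
    (hlive : ∀ v < N, s.a 12 0 v ≠ 0 ↔ L.Live v) (hG : ∀ u < N, ∀ v < N, s.a 1 u v ≠ 0 ↔ L.G u v)
    (hc : s.a 2 0 = L.c) {a b : ℕ} (ha : a ≠ 3) (hb : b ≠ 3) (hu : s.v a < N) (hv : s.v b < N) :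
    (half a b).eval N s ≠ 0 ↔ L.Half (s.v a) (s.v b) := by
  rw [Layout.Half, ← hnt _ hu, ← hnt _ hv, ← hpad _ hu, ← hpad _ hv, ← hlive _ hv, ← hG _ hu _ hv, ← hc]
  have : (sum 3 (and (get 3 (var 3)) (and (eq (get 13 (var 3)) (var b)) (and (read 1 (var a)
      (get 13 (var 3))) (read 1 (var a) (get 14 (var 3))))))).eval N s = 0 ↔
      ¬ ∃ i, L.Act i ∧ L.s i = s.v b ∧ L.G (s.v a) (L.s i) ∧ L.G (s.v a) (L.t i) := by
    push Not
    rw [eval_sum]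
    refine ⟨fun h i hi => ?_, fun h i hi => ?_⟩
    · have hiN := hi.1.trans_le hk
      have h1 : L.s i < N := by have := hL.s_lt i hi.1; omega
      have h2 : L.t i < N := by have := hL.t_lt i hi.1; omega
      have := h i hiN
      simp [hiN, hs i hi.1, ht i hi.1, (hact i hiN).2 hi, h1, h2, hu, ha, hb] at this
      intro h3 h4
      rw [← hG _ hu _ h1] at h4
      rw [← hG _ hu _ h2, not_not]
      exact this h3 h4
    · by_cases hA : L.Act i
      · have h1 : L.s i < N := by have := hL.s_lt i hA.1; omega
        have h2 : L.t i < N := by have := hL.t_lt i hA.1; omega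
        have h0 := h i hA
        rw [← hG _ hu _ h1, ← hG _ hu _ h2, not_not] at h0
        simp [hi, hs i hA.1, ht i hA.1, (hact i hi).2 hA, h1, h2, hu, ha, hb]
        exact h0
      · have := mt (hact i hi).1 hA
        simp only [ne_eq, not_not] at this
        simp [hi, this]
  simp only [half]
  generalize (∃ i, L.Act i ∧ L.s i = s.v b ∧ L.G (s.v a) (L.s i) ∧ L.G (s.v a) (L.t i)) = P at this ⊢
  simp [this, hu, hv, -eval_sum]
  tauto

theorem edges_spec {N : ℕ} {s : Store} {L : Layout} (hL : L.WF) (hn : 2 * L.n ≤ N)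
    (hk : L.k ≤ N) (hs : ∀ i < L.k, s.a 13 0 i = L.s i)
    (ht : ∀ i < L.k, s.a 14 0 i = L.t i) (hact : ∀ i < N, s.a 3 0 i ≠ 0 ↔ L.Act i)
    (hnt : ∀ v < N, s.a 15 0 v ≠ 0 ↔ L.Nt v) (hpad : ∀ v < N, s.a 16 0 v ≠ 0 ↔ L.Pad v)
    (hlive : ∀ v < N, s.a 12 0 v ≠ 0 ↔ L.Live v) (hG : ∀ u < N, ∀ v < N, s.a 1 u v ≠ 0 ↔ L.G u v)
    (hc : s.a 2 0 = L.c) : (edges.exec N s).adj N 4 = L.Aux 0 := by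
  funext u v
  rw [eq_iff_iff]
  have hhalf : ∀ u v, L.Half u v → u < N ∧ v < N := by
    have : ∀ v, L.Live v → v < N := fun v h => (hL.live_lt h).trans_le hn
    rintro u v (⟨h1, h2, -⟩ | ⟨h1, i, hi, rfl, -⟩ | ⟨h1, h2, -⟩)
    · exact ⟨this u (Or.inl h1), this v (Or.inl h2)⟩
    · exact ⟨this u (Or.inl h1), this _ (Or.inr (Or.inr ⟨i, hi, Or.inl rfl⟩))⟩
    · exact ⟨this u (Or.inr (Or.inl h1)), this v h2⟩
  have hlt : L.Aux 0 u v → u < N ∧ v < N := by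
    rintro ((h | h) | ⟨i, -, hi, h⟩)
    · exact hhalf _ _ h
    · exact (hhalf _ _ h).symm
    · have h1 : L.s i < N := by have := hL.s_lt i hi.1; omega
      have h2 : L.t i < N := by have := hL.t_lt i hi.1; omega
      rcases h with ⟨rfl, rfl⟩ | ⟨rfl, rfl⟩ <;> simp [h1, h2]
  by_cases huv : u < N ∧ v < N
  swap
  · exact ⟨fun h => absurd ⟨h.1, h.2.1⟩ huv, fun h => absurd (hlt h) huv⟩
  obtain ⟨hu, hv⟩ := huv
  have h1 := half_spec (s := (s.set 1 u).set 2 v) (a := 1) (b := 2) hL hn hk hs ht hact hnt hpad hlive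
    hG hc (by decide) (by decide) (by simpa using hu) (by simpa using hv)
  have h2 := half_spec (s := (s.set 1 u).set 2 v) (a := 2) (b := 1) hL hn hk hs ht hact hnt hpad hlive
    hG hc (by decide) (by decide) (by simpa using hv) (by simpa using hu)
  simp at h1 h2
  have h3 : (sum 3 (and (get 3 (var 3)) (Expr.or (and (eq (get 13 (var 3)) (var 1))
      (eq (get 14 (var 3)) (var 2))) (and (eq (get 14 (var 3)) (var 1))
      (eq (get 13 (var 3)) (var 2)))))).eval N ((s.set 1 u).set 2 v) = 0 ↔
      ¬ ∃ i, 0 ≤ i ∧ L.Act i ∧ ((L.s i = u ∧ L.t i = v) ∨ (L.t i = u ∧ L.s i = v)) := by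
    push Not
    rw [eval_sum]
    refine ⟨fun h i _ hi => ?_, fun h i hi => ?_⟩
    · have hiN := hi.1.trans_le hk
      have := h i hiN
      simpa [hiN, hs i hi.1, ht i hi.1, (hact i hiN).2 hi] using this
    · by_cases hA : L.Act i
      · simpa [hi, hs i hA.1, ht i hA.1, (hact i hi).2 hA] using h i (Nat.zero_le _) hA
      · have := mt (hact i hi).1 hA
        simp only [ne_eq, not_not] at this
        simp [hi, this]
  simp only [Store.adj, hu, hv, true_and, edges, Cmd.exec_fill, Store.setArr_a, if_true, Layout.Aux,
    Layout.Edge]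
  rw [ne_eq, eval_or, not_not]
  simp only [ne_eq, h3, eval_or, not_not]
  rw [← h1, ← h2]

end Main
end RAM

/-- `w` is the list of `n`, `k`, the `s i`, the `t i` and the entries of the adjacency matrix. -/
structure Layout.IsCode (L : Layout) (w : List ℕ) : Prop where
  length : w.length = 2 + 2 * L.k + L.n * L.n
  order : w.getD 0 0 = L.n
  count : w.getD 1 0 = L.k
  fst : ∀ i < L.k, w.getD (2 + i) 0 = L.s i
  snd : ∀ i < L.k, w.getD (2 + (L.k + i)) 0 = L.t i
  graph : ∀ u < L.n, ∀ v < L.n, w.getD (2 + 2 * L.k + (u * L.n + v)) 0 ≠ 0 ↔ L.G u v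

/-! ### Reading the input, and the complete program -/

namespace RAM
open _root_.RAM.Expr _root_.RAM.Cmd

namespace Main
open Search

def readSize : Cmd := .seq (.set 10 (get 0 (const 0))) (.set 11 (get 0 (const 1)))

/-- The language has no product, so the row offset `u * n` is computed as a sum of one `n` for every
index less than `u`. -/
def readGraph : Cmd :=
  .fill 1 (and (lt (var 1) (var 10)) (and (lt (var 2) (var 10)) (get 0 (add (add (const 2)
    (add (var 11) (var 11))) (add (sum 3 (ite (lt (var 3) (var 1)) (var 10) (const 0))) (var 2))))))

theorem readSize_spec {w : List ℕ} {L : Layout} (hw : L.IsCode w) :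
    (readSize.exec w.length (Store.init w)).v 10 = L.n ∧
    (readSize.exec w.length (Store.init w)).v 11 = L.k := by
  have h0 : 0 < w.length := by rw [hw.length]; omega
  have h1 : 1 < w.length := by rw [hw.length]; omega
  have e0 := hw.order
  have e1 := hw.count
  constructor
  · simpa [readSize, h0, h1, Store.init] using e0
  · simpa [readSize, h0, h1, Store.init] using e1

theorem readGraph_spec {w : List ℕ} {s : Store} {L : Layout} (hw : L.IsCode w)
    (hG : ∀ u v, L.G u v → u < L.n ∧ v < L.n) (h10 : s.v 10 = L.n) (h11 : s.v 11 = L.k)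
    (h0 : ∀ j, s.a 0 0 j = w.getD j 0) (u v : ℕ) :
    (readGraph.exec w.length s).a 1 u v ≠ 0 ↔ L.G u v := by
  by_cases hu' : u < L.n
  swap
  · simp only [readGraph, Cmd.exec_fill, Store.setArr_a, if_true]
    simp [h10, hu', -eval_sum]
    exact fun h => hu' (hG _ _ h).1
  by_cases hv' : v < L.n
  swap
  · simp only [readGraph, Cmd.exec_fill, Store.setArr_a, if_true]
    simp [h10, hv', -eval_sum]
    exact fun h => hv' (hG _ _ h).2
  have hn : L.n ≤ L.n * L.n := Nat.le_mul_of_pos_left _ (by omega)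
  have hu : u < w.length := by rw [hw.length]; omega
  have hsum : (sum 3 (ite (lt (var 3) (var 1)) (var 10) (const 0))).eval w.length
      ((s.set 1 u).set 2 v) = u * L.n := by
    have : ∀ i, (ite (lt (var 3) (var 1)) (var 10) (const 0)).eval w.length
        (((s.set 1 u).set 2 v).set 3 i) = if i < u then L.n else 0 := by
      intro i
      by_cases hi : i < u <;> simp [hi, h10]
    simp only [Expr.eval] at this ⊢
    rw [Finset.sum_congr rfl fun i _ => this i, ← Finset.sum_filter]
    have : (Finset.range w.length).filter (· < u) = Finset.range u := by
      ext i; simp; omega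
    rw [this, Finset.sum_const, Finset.card_range, smul_eq_mul]
  rw [← hw.graph u hu' v hv', ← h0]
  have hlt : 2 + (L.k + L.k) + (u * L.n + v) < w.length := by
    have : (u + 1) * L.n ≤ L.n * L.n := Nat.mul_le_mul_right _ hu'
    rw [hw.length]
    rw [Nat.add_mul] at this
    omega
  simp [readGraph, h10, h11, hu', hv', hsum, hlt, two_mul, -eval_sum]

def setup : Cmd :=
  .seq readSize <| .seq readGraph <| .seq colour <| .seq pairs <| .seq vertices <|
  .seq startMatching <| .seq edges <| .seq (.set 12 (const 0)) (.set 13 (const 0))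

/-- The program that solves Disjoint Paths on cobipartite graphs. -/
def program : Cmd := .seq setup (.seq mainLoop (.set 0 (sub (const 1) (var 13))))

theorem setup_spec {w : List ℕ} {L : Layout} (hL : L.WF) (hw : L.IsCode w)
    (hG : ∀ u v, L.G u v → u < L.n ∧ v < L.n) (hsymm : ∀ u v, L.G u v → L.G v u)
    (hc : IsColouring L.n L.G L.c) :
    ∃ c, IsColouring L.n L.G c ∧
      Ready w.length (setup.exec w.length (Store.init w)) { L with c := c } := by
  have hlen := hw.length
  -- Padding vertices have numbers up to `2 * n - 1`, which must be valid indices. The `n * n`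
  -- matrix entries leave room for `n ≥ 2`, and the two leading entries for `n ≤ 1`.
  have hN : 2 * L.n ≤ w.length := by
    rw [hw.length]
    rcases Nat.lt_or_ge L.n 2 with h | h
    · omega
    · have := Nat.mul_le_mul_right L.n h
      omega
  have hk2 : 2 + 2 * L.k ≤ w.length := by omega
  have hk : L.k ≤ w.length := by omega
  have hn : L.n ≤ w.length := by omega
  simp only [setup, Cmd.exec_seq]
  obtain ⟨a10, a11⟩ := readSize_spec hw
  have a0 : ∀ j, (readSize.exec w.length (Store.init w)).a 0 0 j = w.getD j 0 := fun j => by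
    rw [exec_a _ _ _ (by decide)]; simp [Store.init]
  generalize readSize.exec w.length (Store.init w) = s₁ at *
  have b1 := readGraph_spec hw hG a10 a11 a0
  have b10 : (readGraph.exec w.length s₁).v 10 = L.n := by rw [exec_v _ _ _ (by decide), a10]
  have b11 : (readGraph.exec w.length s₁).v 11 = L.k := by rw [exec_v _ _ _ (by decide), a11]
  have b0 : (readGraph.exec w.length s₁).a 0 = s₁.a 0 := exec_a _ _ _ (by decide)
  generalize readGraph.exec w.length s₁ = s₂ at *
  have hGeq : (fun u v => s₂.a 1 u v ≠ 0) = L.G := by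
    funext u v; exact propext (b1 u v)
  have c2 := colour_spec (s := s₂) hn b10 (fun u v h => (b1 v u).2 (hsymm _ _ ((b1 u v).1 h)))
    (hGeq ▸ hc)
  rw [hGeq] at c2
  have c10 : (colour.exec w.length s₂).v 10 = L.n := by rw [exec_v _ _ _ (by decide), b10]
  have c11 : (colour.exec w.length s₂).v 11 = L.k := by rw [exec_v _ _ _ (by decide), b11]
  have c0 : (colour.exec w.length s₂).a 0 = s₁.a 0 := by rw [exec_a _ _ _ (by decide), b0]
  have c1 : (colour.exec w.length s₂).a 1 = s₂.a 1 := exec_a _ _ _ (by decide)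
  generalize colour.exec w.length s₂ = s₃ at *
  -- The colouring is the one that was computed, which may differ from the one assumed to exist.
  refine ⟨s₃.a 2 0, c2, ?_⟩
  obtain ⟨L', hL'⟩ : ∃ L', L' = { L with c := s₃.a 2 0 } := ⟨_, rfl⟩
  have hWF : L'.WF := by rw [hL']; exact ⟨hL.1, hL.2, hL.3, hL.4, hL.5⟩
  have en : L'.n = L.n := by rw [hL']
  have ek : L'.k = L.k := by rw [hL']
  have es : L'.s = L.s := by rw [hL']
  have et : L'.t = L.t := by rw [hL']
  have eG : L'.G = L.G := by rw [hL']
  have ec : L'.c = s₃.a 2 0 := by rw [hL']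
  rw [← hL']
  obtain ⟨d13, d14, d3⟩ := pairs_spec (N := w.length) (s := s₃) hWF (by rw [en]; exact hn) (by rw [ek]; exact hk2)
    (by rw [ek, c11]) (fun i hi => by rw [c0, a0, es]; exact hw.fst i (ek ▸ hi))
    (fun i hi => by rw [c0, a0, et, ek]; exact hw.snd i (ek ▸ hi))
    (fun u _ v _ => by rw [c1, eG]; exact b1 u v)
  have d10 : (pairs.exec w.length s₃).v 10 = L.n := by rw [exec_v _ _ _ (by decide), c10]
  have d11 : (pairs.exec w.length s₃).v 11 = L.k := by rw [exec_v _ _ _ (by decide), c11]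
  have d1 : (pairs.exec w.length s₃).a 1 = s₂.a 1 := by rw [exec_a _ _ _ (by decide), c1]
  have d2 : (pairs.exec w.length s₃).a 2 = s₃.a 2 := exec_a _ _ _ (by decide)
  generalize pairs.exec w.length s₃ = s₄ at *
  obtain ⟨e15, e16, e12⟩ := vertices_spec (N := w.length) (s := s₄) hWF (by rw [en]; exact hN) (by rw [ek]; exact hk)
    (by rw [en, d10]) (by rw [ek, d11]) d13 d14 d3
  have e10 : (vertices.exec w.length s₄).v 10 = L.n := by rw [exec_v _ _ _ (by decide), d10]
  have e1 : (vertices.exec w.length s₄).a 1 = s₂.a 1 := by rw [exec_a _ _ _ (by decide), d1]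
  have e2 : (vertices.exec w.length s₄).a 2 = s₃.a 2 := by rw [exec_a _ _ _ (by decide), d2]
  have e3 : (vertices.exec w.length s₄).a 3 = s₄.a 3 := exec_a _ _ _ (by decide)
  have e13 : (vertices.exec w.length s₄).a 13 = s₄.a 13 := exec_a _ _ _ (by decide)
  have e14 : (vertices.exec w.length s₄).a 14 = s₄.a 14 := exec_a _ _ _ (by decide)
  rw [← e3] at d3
  rw [← e13] at d13
  rw [← e14] at d14
  generalize vertices.exec w.length s₄ = s₅ at *
  have f6 := startMatching_spec (N := w.length) (s := s₅) hWF (by rw [en]; exact hN) (by rw [ek]; exact hk)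
    (by rw [en, e10]) d13 d14 d3 e15 e16 e12
  have f1 : (startMatching.exec w.length s₅).a 1 = s₂.a 1 := by rw [exec_a _ _ _ (by decide), e1]
  have f2 : (startMatching.exec w.length s₅).a 2 = s₃.a 2 := by rw [exec_a _ _ _ (by decide), e2]
  have f3 : (startMatching.exec w.length s₅).a 3 = s₅.a 3 := exec_a _ _ _ (by decide)
  have f12 : (startMatching.exec w.length s₅).a 12 = s₅.a 12 := exec_a _ _ _ (by decide)
  have f13 : (startMatching.exec w.length s₅).a 13 = s₅.a 13 := exec_a _ _ _ (by decide)
  have f14 : (startMatching.exec w.length s₅).a 14 = s₅.a 14 := exec_a _ _ _ (by decide)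
  have f15 : (startMatching.exec w.length s₅).a 15 = s₅.a 15 := exec_a _ _ _ (by decide)
  have f16 : (startMatching.exec w.length s₅).a 16 = s₅.a 16 := exec_a _ _ _ (by decide)
  rw [← Store.toSet_congr f12] at e12 f6
  rw [← f3] at d3
  rw [← f13] at d13
  rw [← f14] at d14
  rw [← f15] at e15
  rw [← f16] at e16
  generalize startMatching.exec w.length s₅ = s₆ at *
  have g4 := edges_spec (N := w.length) (s := s₆) hWF (by rw [en]; exact hN) (by rw [ek]; exact hk) d13 d14 d3 e15 e16
    (fun v hv => by rw [← e12, Store.mem_toSet]; exact ⟨fun h => ⟨hv, h⟩, fun h => h.2⟩)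
    (fun u _ v _ => by rw [f1, eG]; exact b1 u v) (by rw [f2, ec])
  have g3 : (edges.exec w.length s₆).a 3 = s₆.a 3 := exec_a _ _ _ (by decide)
  have g6 : (edges.exec w.length s₆).a 6 = s₆.a 6 := exec_a _ _ _ (by decide)
  have g12 : (edges.exec w.length s₆).a 12 = s₆.a 12 := exec_a _ _ _ (by decide)
  have g13 : (edges.exec w.length s₆).a 13 = s₆.a 13 := exec_a _ _ _ (by decide)
  have g14 : (edges.exec w.length s₆).a 14 = s₆.a 14 := exec_a _ _ _ (by decide)
  rw [← Store.toSet_congr g12, ← g6] at f6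
  rw [← Store.toSet_congr g12] at e12
  rw [← g3] at d3
  rw [← g13] at d13
  rw [← g14] at d14
  generalize edges.exec w.length s₆ = s₇ at *
  exact ⟨g4, e12, d3, fun i _ hi => d13 i hi.1, fun i _ hi => d14 i hi.1, f6, by simp, by simp⟩

theorem program_spec {w : List ℕ} {L : Layout} (hL : L.WF) (hw : L.IsCode w)
    (hG : ∀ u v, L.G u v → u < L.n ∧ v < L.n) (hsymm : ∀ u v, L.G u v → L.G v u)
    (hc : IsColouring L.n L.G L.c) :
    ∃ c, IsColouring L.n L.G c ∧ ∃ S : Finset ℕ, (∀ v, v ∈ S ↔ L.Live v) ∧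
      (HasPM (Layout.Edge { L with c := c }) S →
        (program.exec w.length (Store.init w)).v 0 = 1) ∧
      (¬ HasPM (Layout.Edge { L with c := c }) S →
        (program.exec w.length (Store.init w)).v 0 = 0) := by
  obtain ⟨c, hc', hR⟩ := setup_spec hL hw hG hsymm hc
  have hlen := hw.length
  refine ⟨c, hc', _, hR.live, ?_⟩
  simp only [program, Cmd.exec_seq]
  have key := mainLoop_spec (L := { L with c := c }) ⟨hL.1, hL.2, hL.3, hL.4, hL.5⟩
    (by dsimp only; omega) hR
  rcases key with ⟨h1, h2⟩ | ⟨h1, h2⟩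
  · simp [h1, h2]
  · simp [h1, h2]

end Main
end RAM

namespace DisjointPathsInstance

variable {V ι : Type*}

/-! ### Disjoint paths in cobipartite graphs -/

/-- The terminals of the pair `i` are neither equal nor adjacent. -/
def Active (I : DisjointPathsInstance V ι) (i : ι) : Prop := I.s i ≠ I.t i ∧ ¬ I.G.Adj (I.s i) (I.t i)

/-- The interior of a path of the pair `i` can be chosen as `{p, q}`. -/
def Links (I : DisjointPathsInstance V ι) (A B : Set V) (i : ι) (p q : V) : Prop :=
  (p = q ∧ I.G.Adj p (I.s i) ∧ I.G.Adj p (I.t i)) ∨ (p ∈ A ∧ q ∈ B ∧ I.G.Adj p q)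

/-- The sets `{p i, q i}` consist of nonterminals and link the active pairs disjointly. -/
structure IsLinkage (I : DisjointPathsInstance V ι) (A B : Set V) (p q : ι → V) : Prop where
  left : ∀ i, I.Active i → ¬ I.IsTerminal (p i)
  right : ∀ i, I.Active i → ¬ I.IsTerminal (q i)
  links : ∀ i, I.Active i → I.Links A B i (p i) (q i)
  disjoint : ∀ i j, I.Active i → I.Active j → i ≠ j → p i ≠ p j ∧ p i ≠ q j ∧ q i ≠ q j

variable {I : DisjointPathsInstance V ι} {A B : Set V}

theorem isYes_of_walks (P : ∀ i, I.G.Walk (I.s i) (I.t i))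
    (h : ∀ i j, i ≠ j → List.Disjoint (P i).support (P j).support) : I.IsYes := by
  classical
  refine ⟨fun i => (P i).bypass, fun i => (P i).bypass_isPath, fun i j hij v hv hv' => ?_⟩
  exact h i j hij ((P i).support_bypass_subset_support hv) ((P j).support_bypass_subset_support hv')

/-- Distinct nonadjacent vertices lie on different sides. -/
theorem sides (hAB : IsCompl A B) (hA : I.G.IsClique A) (hB : I.G.IsClique B) {u v : V} (hne : u ≠ v)
    (h : ¬ I.G.Adj u v) : (u ∈ A ∧ u ∉ B ∧ v ∈ B ∧ v ∉ A) ∨ (u ∈ B ∧ u ∉ A ∧ v ∈ A ∧ v ∉ B) := by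
  have hc : ∀ x, x ∈ B ↔ x ∉ A := fun x => by rw [← hAB.compl_eq]; rfl
  by_cases hu : u ∈ A <;> by_cases hv : v ∈ A
  · exact absurd (hA hu hv hne) h
  · simp [hc, hu, hv]
  · simp [hc, hu, hv]
  · exact absurd (hB ((hc u).2 hu) ((hc v).2 hv) hne) h

/-- Take an edge `x y` of the path that leaves the clique of `s i`. If `x = s i`, then `y ≠ t i`,
and `y` is a common neighbour because it lies in the clique of `t i`; the case `y = t i` is
symmetric. Otherwise both ends are interior. -/
theorem exists_links (hAB : IsCompl A B) (hA : I.G.IsClique A) (hB : I.G.IsClique B) {i : ι}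
    (hi : I.Active i) (P : I.G.Walk (I.s i) (I.t i)) : ∃ p ∈ P.support, ∃ q ∈ P.support,
      p ≠ I.s i ∧ p ≠ I.t i ∧ q ≠ I.s i ∧ q ≠ I.t i ∧ I.Links A B i p q := by
  have hc : ∀ x, x ∈ B ↔ x ∉ A := fun x => by rw [← hAB.compl_eq]; rfl
  have key : ∀ (S T : Set V), I.G.IsClique S → I.G.IsClique T → (∀ x, x ∈ T ↔ x ∉ S) →
      I.s i ∈ S → I.t i ∈ T → ∃ p ∈ P.support, ∃ q ∈ P.support, p ≠ I.s i ∧ p ≠ I.t i ∧ q ≠ I.s i ∧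
      q ≠ I.t i ∧ ((p = q ∧ I.G.Adj p (I.s i) ∧ I.G.Adj p (I.t i)) ∨
        (p ∈ S ∧ q ∈ T ∧ I.G.Adj p q)) := by
    intro S T hS hT hST hs ht
    obtain ⟨d, hd, h1, h2⟩ := P.exists_boundary_dart S hs ((hST _).1 ht)
    have hx := P.dart_fst_mem_support_of_mem_darts hd
    have hy := P.dart_snd_mem_support_of_mem_darts hd
    have hadj := d.adj
    generalize d.fst = x at *
    generalize d.snd = y at *
    have hyT := (hST y).2 h2
    have hxt : x ≠ I.t i := fun e => (hST _).1 ht (e ▸ h1)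
    have hys : y ≠ I.s i := fun e => h2 (e ▸ hs)
    by_cases hxs : x = I.s i
    · subst hxs
      have hyt : y ≠ I.t i := fun e => hi.2 (e ▸ hadj)
      exact ⟨y, hy, y, hy, hys, hyt, hys, hyt, Or.inl ⟨rfl, hadj.symm, hT hyT ht hyt⟩⟩
    by_cases hyt : y = I.t i
    · subst hyt
      exact ⟨x, hx, x, hx, hxs, hxt, hxs, hxt, Or.inl ⟨rfl, hS h1 hs hxs, hadj⟩⟩
    exact ⟨x, hx, y, hy, hxs, hxt, hys, hyt, Or.inr ⟨h1, hyT, hadj⟩⟩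
  rcases sides hAB hA hB hi.1 hi.2 with ⟨hs, -, ht, -⟩ | ⟨hs, -, ht, -⟩
  · exact key A B hA hB hc hs ht
  · obtain ⟨p, hp, q, hq, h1, h2, h3, h4, h5⟩ := key B A hB hA (fun x => by rw [hc]; simp) hs ht
    refine ⟨q, hq, p, hp, h3, h4, h1, h2, ?_⟩
    rcases h5 with ⟨rfl, h5⟩ | ⟨h5, h6, h7⟩
    · exact Or.inl ⟨rfl, h5⟩
    · exact Or.inr ⟨h6, h5, h7.symm⟩

/-- A crossing edge works for every active pair: one of its ends lies in the clique of `s i`, the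
other in the clique of `t i`. -/
theorem exists_walk_of_links (hAB : IsCompl A B) (hA : I.G.IsClique A) (hB : I.G.IsClique B) {i : ι}
    (hi : I.Active i) {p q : V} (hp : ¬ I.IsTerminal p) (hq : ¬ I.IsTerminal q)
    (h : I.Links A B i p q) : ∃ P : I.G.Walk (I.s i) (I.t i),
      ∀ v ∈ P.support, v = I.s i ∨ v = I.t i ∨ v = p ∨ v = q := by
  simp only [IsTerminal, not_exists, not_or] at hp hq
  rcases h with ⟨rfl, h1, h2⟩ | ⟨h1, h2, h3⟩
  · exact ⟨.cons h1.symm (.cons h2 .nil), by simp⟩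
  rcases sides hAB hA hB hi.1 hi.2 with ⟨hs, -, ht, -⟩ | ⟨hs, -, ht, -⟩
  · exact ⟨.cons (hA hs h1 (Ne.symm (hp i).1)) (.cons h3 (.cons (hB h2 ht (hq i).2) .nil)), by simp⟩
  · exact ⟨.cons (hB hs h2 (Ne.symm (hq i).1)) (.cons h3.symm (.cons (hA h1 ht (hp i).2) .nil)),
      by simp⟩

theorem terminal_ne (I : DisjointPathsInstance V ι) {i j : ι} (hij : i ≠ j) : I.s i ≠ I.s j ∧
    I.s i ≠ I.t j ∧ I.t i ≠ I.s j ∧ I.t i ≠ I.t j := by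
  have h := I.disjoint i j hij
  simp only [Set.disjoint_insert_left, Set.disjoint_singleton_left, Set.mem_insert_iff,
    Set.mem_singleton_iff, not_or] at h
  tauto

/-- A vertex on the `i`-th path other than `s i` and `t i` is no terminal at all, since every other
terminal lies on its own path. Conversely, inactive pairs use the trivial path or their edge and so
meet terminals only. -/
theorem isYes_iff_exists_isLinkage (hAB : IsCompl A B) (hA : I.G.IsClique A) (hB : I.G.IsClique B) :
    I.IsYes ↔ ∃ p q, I.IsLinkage A B p q := by
  classical
  constructor
  · rintro ⟨P, -, hd⟩
    have key : ∀ i, ∃ p q, I.Active i → p ∈ (P i).support ∧ q ∈ (P i).support ∧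
        p ≠ I.s i ∧ p ≠ I.t i ∧ q ≠ I.s i ∧ q ≠ I.t i ∧ I.Links A B i p q := by
      intro i
      by_cases hi : I.Active i
      · obtain ⟨p, hp, q, hq, h⟩ := exists_links hAB hA hB hi (P i)
        exact ⟨p, q, fun _ => ⟨hp, hq, h⟩⟩
      · exact ⟨I.s i, I.s i, fun h => absurd h hi⟩
    choose p q h using key
    have hterm : ∀ i v, v ∈ (P i).support → v ≠ I.s i → v ≠ I.t i → ¬ I.IsTerminal v := by
      rintro i v hv h1 h2 ⟨j, h3⟩
      have hij : i ≠ j := by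
        rintro rfl
        tauto
      rcases h3 with rfl | rfl
      · exact hd i j hij hv (P j).start_mem_support
      · exact hd i j hij hv (P j).end_mem_support
    refine ⟨p, q, fun i hi => ?_, fun i hi => ?_, fun i hi => ?_, fun i j hi hj hij => ?_⟩
    · obtain ⟨h1, h2, h3, h4, h5, h6, h7⟩ := h i hi
      exact hterm i _ h1 h3 h4
    · obtain ⟨h1, h2, h3, h4, h5, h6, h7⟩ := h i hi
      exact hterm i _ h2 h5 h6
    · exact (h i hi).2.2.2.2.2.2
    · obtain ⟨h1, h2, -⟩ := h i hi
      obtain ⟨h1', h2', -⟩ := h j hj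
      exact ⟨fun e => hd i j hij h1 (e ▸ h1'), fun e => hd i j hij h1 (e ▸ h2'),
        fun e => hd i j hij h2 (e ▸ h2')⟩
  · rintro ⟨p, q, h⟩
    have key : ∀ i, ∃ P : I.G.Walk (I.s i) (I.t i), ∀ v ∈ P.support,
        v = I.s i ∨ v = I.t i ∨ (I.Active i ∧ (v = p i ∨ v = q i)) := by
      intro i
      by_cases hi : I.Active i
      · obtain ⟨P, hP⟩ := exists_walk_of_links hAB hA hB hi (h.left i hi) (h.right i hi) (h.links i hi)
        exact ⟨P, fun v hv => by have := hP v hv; tauto⟩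
      · by_cases hst : I.s i = I.t i
        · rw [← hst]
          exact ⟨.nil, by simp⟩
        · have hadj : I.G.Adj (I.s i) (I.t i) := by
            by_contra h'
            exact hi ⟨hst, h'⟩
          exact ⟨.cons hadj .nil, by simp⟩
    choose P hP using key
    refine isYes_of_walks P fun i j hij v hv hv' => ?_
    have hne := I.terminal_ne hij
    rcases hP i v hv with rfl | rfl | ⟨hi, h1⟩
    · rcases hP j _ hv' with e | e | ⟨hj, e | e⟩
      · exact hne.1 e
      · exact hne.2.1 e
      · exact h.left j hj ⟨i, Or.inl e.symm⟩
      · exact h.right j hj ⟨i, Or.inl e.symm⟩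
    · rcases hP j _ hv' with e | e | ⟨hj, e | e⟩
      · exact hne.2.2.1 e
      · exact hne.2.2.2 e
      · exact h.left j hj ⟨i, Or.inr e.symm⟩
      · exact h.right j hj ⟨i, Or.inr e.symm⟩
    · have hnt : ¬ I.IsTerminal v := by
        rcases h1 with rfl | rfl
        · exact h.left i hi
        · exact h.right i hi
      rcases hP j v hv' with e | e | ⟨hj, h2⟩
      · exact hnt ⟨j, Or.inl e⟩
      · exact hnt ⟨j, Or.inr e⟩
      · have h3 := h.disjoint i j hi hj hij
        have h4 := h.disjoint j i hj hi hij.symm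
        rcases h1 with rfl | rfl <;> rcases h2 with h2 | h2
        · exact h3.1 h2
        · exact h3.2.1 h2
        · exact h4.2.1 h2.symm
        · exact h3.2.2 h2

/-! ### Removing the adjacent pairs -/

/-- A linkage concerns only the active pairs and the nonterminals, and all of these survive the
removal. The terminals among the kept vertices are the same for both instances. -/
theorem isYes_iff_removeAdjacentPairs (hAB : IsCompl A B) (hA : I.G.IsClique A) (hB : I.G.IsClique B)
    (hst : ∀ i, I.s i ≠ I.t i) : I.IsYes ↔ I.removeAdjacentPairs.IsYes := by
  classical
  have hc : ∀ x, x ∈ B ↔ x ∉ A := fun x => by rw [← hAB.compl_eq]; rfl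
  have hclique : ∀ S : Set V, I.G.IsClique S →
      I.removeAdjacentPairs.G.IsClique ((↑) ⁻¹' S : Set I.keptVertices) :=
    fun S hS u hu v hv huv => hS hu hv (fun e => huv (Subtype.ext e))
  rw [isYes_iff_exists_isLinkage hAB hA hB, isYes_iff_exists_isLinkage
    (A := ((↑) ⁻¹' A : Set I.keptVertices)) (B := ((↑) ⁻¹' B : Set I.keptVertices)) ?_
    (hclique A hA) (hclique B hB)]
  swap
  · rw [← hAB.compl_eq]
    exact isCompl_compl
  have hact : ∀ i, I.removeAdjacentPairs.Active i := fun i =>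
    ⟨fun e => hst i (congrArg Subtype.val e), i.2⟩
  have hact' : ∀ i, I.Active i ↔ ¬ I.G.Adj (I.s i) (I.t i) := fun i => ⟨fun h => h.2, fun h => ⟨hst i, h⟩⟩
  have hterm : ∀ v : I.keptVertices, I.removeAdjacentPairs.IsTerminal v ↔ I.IsTerminal v := by
    intro v
    constructor
    · rintro ⟨i, hi⟩
      exact ⟨i, hi.imp (congrArg Subtype.val) (congrArg Subtype.val)⟩
    · rintro ⟨i, hi⟩
      have hia : ¬ I.G.Adj (I.s i) (I.t i) := fun h => by
        have := v.2 i h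
        tauto
      exact ⟨⟨i, hia⟩, hi.imp Subtype.ext Subtype.ext⟩
  have hkept : ∀ v, ¬ I.IsTerminal v → v ∈ I.keptVertices := fun v hv i _ =>
    ⟨fun e => hv ⟨i, Or.inl e⟩, fun e => hv ⟨i, Or.inr e⟩⟩
  constructor
  · rintro ⟨p, q, h⟩
    have hA' := fun i : {i // ¬ I.G.Adj (I.s i) (I.t i)} => (hact' i).2 i.2
    refine ⟨fun i => ⟨p i, hkept _ (h.left i (hA' i))⟩, fun i => ⟨q i, hkept _ (h.right i (hA' i))⟩,
      fun i _ => ?_, fun i _ => ?_, fun i _ => ?_, fun i j _ _ hij => ?_⟩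
    · rw [hterm]; exact h.left i (hA' i)
    · rw [hterm]; exact h.right i (hA' i)
    · exact (h.links i (hA' i)).imp (fun h => ⟨Subtype.ext h.1, h.2⟩) id
    · have := h.disjoint i j (hA' i) (hA' j) (fun e => hij (Subtype.ext e))
      simpa using this
  · rintro ⟨p, q, h⟩
    refine ⟨fun i => if hi : ¬ I.G.Adj (I.s i) (I.t i) then p ⟨i, hi⟩ else I.s i,
      fun i => if hi : ¬ I.G.Adj (I.s i) (I.t i) then q ⟨i, hi⟩ else I.s i,
      fun i hi => ?_, fun i hi => ?_, fun i hi => ?_, fun i j hi hj hij => ?_⟩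
    · rw [dif_pos hi.2, ← hterm]; exact h.left _ (hact _)
    · rw [dif_pos hi.2, ← hterm]; exact h.right _ (hact _)
    · rw [dif_pos hi.2, dif_pos hi.2]
      exact (h.links ⟨i, hi.2⟩ (hact _)).imp (fun h => ⟨congrArg Subtype.val h.1, h.2⟩) id
    · simp only [dif_pos hi.2, dif_pos hj.2]
      have := h.disjoint ⟨i, hi.2⟩ ⟨j, hj.2⟩ (hact _) (hact _) (fun e => hij (congrArg Subtype.val e))
      exact ⟨fun e => this.1 (Subtype.ext e), fun e => this.2.1 (Subtype.ext e),
        fun e => this.2.2 (Subtype.ext e)⟩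

end DisjointPathsInstance

/-! ### From linkages to matchings -/

/-- Disjoint edges that join `α → V` to `V` or to elements of `α` can be distributed among the elements
of `α` such that those that end in `α` go to their end. -/
theorem exists_distribution {α V : Type*} [Finite α] {R : V → V → Prop} {C : α → V → Prop} (a : α → V)
    (b : α → V ⊕ α) (hR : ∀ i v, b i = .inl v → R (a i) v) (hC : ∀ i j, b i = .inr j → C j (a i))
    (ha : a.Injective) (hb : b.Injective) (hab : ∀ i j, b i ≠ .inl (a j)) :
    ∃ p q : α → V, (∀ i, (p i = q i ∧ C i (p i)) ∨ R (p i) (q i)) ∧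
      ∀ i j, i ≠ j → p i ≠ p j ∧ p i ≠ q j ∧ q i ≠ q j := by
  classical
  have := Fintype.ofFinite α
  -- The indices whose edge ends in `α` are sent injectively to these ends. Any extension to a
  -- permutation distributes the other edges.
  obtain ⟨g, hg⟩ : ∃ g : Equiv.Perm α, ∀ i j, b i = .inr j → g i = j := by
    obtain ⟨g, hg⟩ := Set.MapsTo.exists_equiv_extend_of_card_eq (α := α) (β := α) (t := Finset.univ)
      (by simp) (s := {i | ∃ j, b i = .inr j}) (f := fun i => (b i).elim (fun _ => i) id)
      (fun i _ => by simp) (by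
        rintro i ⟨j, hj⟩ i' ⟨j', hj'⟩ h
        simp only [hj, hj', Sum.elim_inr, id] at h
        subst h
        exact hb (hj.trans hj'.symm))
    refine ⟨g.trans (Equiv.subtypeUnivEquiv fun x => Finset.mem_univ x), fun i j hij => ?_⟩
    have := hg i ⟨j, hij⟩
    simpa [hij] using this
  -- The second vertex of a link is the other end of the edge, or `a i` again if that end lies in
  -- `α`.
  have hq : ∀ i, ∃ v, (b i = .inl v) ∨ ((∃ j, b i = .inr j) ∧ v = a i) := by
    intro i
    rcases hbi : b i with v | j
    · exact ⟨v, Or.inl rfl⟩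
    · exact ⟨a i, Or.inr ⟨⟨j, rfl⟩, rfl⟩⟩
  choose q hq using hq
  refine ⟨fun i => a (g.symm i), fun i => q (g.symm i), fun i => ?_, fun i j hij => ?_⟩
  · rcases hq (g.symm i) with h | ⟨⟨j, hj⟩, h⟩
    · exact Or.inr (hR _ _ h)
    · have := hg _ _ hj
      rw [g.apply_symm_apply] at this
      subst this
      exact Or.inl ⟨h.symm, hC _ _ hj⟩
  · have hij' : g.symm i ≠ g.symm j := fun e => hij (g.symm.injective e)
    dsimp only
    generalize g.symm i = i at *
    generalize g.symm j = j at *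
    refine ⟨fun e => hij' (ha e), fun e => ?_, fun e => ?_⟩
    · rcases hq j with h | ⟨-, h⟩
      · exact hab j i (by rw [h, ← e])
      · exact hij' (ha (e.trans h))
    · rcases hq i with h | ⟨-, h⟩ <;> rcases hq j with h' | ⟨-, h'⟩
      · exact hij' (hb (by rw [h, h', e]))
      · exact hab i j (by rw [h, e, h'])
      · exact hab j i (by rw [h', ← e, h])
      · exact hij' (ha (by rw [← h, ← h', e]))

/-- A graph has a matching with at least `card ι` edges if and only if it has disjoint edges indexed
by `ι`. -/
theorem SimpleGraph.exists_isMatching_iff {W ι : Type*} [Finite W] [Fintype ι] {H : SimpleGraph W} :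
    (∃ M : H.Subgraph, M.IsMatching ∧ Fintype.card ι ≤ M.edgeSet.ncard) ↔
    ∃ e : ι → Sym2 W, (∀ i, e i ∈ H.edgeSet) ∧ ∀ i j x, x ∈ e i → x ∈ e j → i = j := by
  classical
  constructor
  · rintro ⟨M, hM, hc⟩
    have hfin : M.edgeSet.Finite := Set.toFinite _
    have := hfin.fintype
    obtain ⟨f⟩ : Nonempty (ι ↪ M.edgeSet) := by
      apply Function.Embedding.nonempty_of_card_le
      rwa [← Set.toFinset_card, ← Set.ncard_eq_toFinset_card']
    refine ⟨fun i => f i, fun i => M.edgeSet_subset (f i).2, fun i j x hx hx' => ?_⟩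
    apply f.injective
    apply Subtype.ext
    obtain ⟨y, hy⟩ := hx
    obtain ⟨z, hz⟩ := hx'
    dsimp only at hy hz
    have h1 : M.Adj x y := by
      have := (f i).2
      rwa [hy] at this
    have h2 : M.Adj x z := by
      have := (f j).2
      rwa [hz] at this
    rw [hy, hz, (hM h1.fst_mem).unique h1 h2]
  · rintro ⟨e, he, hd⟩
    let M : H.Subgraph :=
      { verts := {x | ∃ i, x ∈ e i}
        Adj := fun x y => ∃ i, e i = s(x, y)
        adj_sub := by
          rintro x y ⟨i, hi⟩
          have := he i
          rwa [hi] at this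
        edge_vert := by
          rintro x y ⟨i, hi⟩
          exact ⟨i, by rw [hi]; exact Sym2.mem_mk_left x y⟩
        symm := ⟨by
          rintro x y ⟨i, hi⟩
          exact ⟨i, by rw [hi, Sym2.eq_swap]⟩⟩ }
    refine ⟨M, ?_, ?_⟩
    · rintro x ⟨i, y, hy⟩
      refine ⟨y, ⟨i, hy⟩, ?_⟩
      rintro z ⟨j, hj⟩
      have hij : i = j := hd i j x (by rw [hy]; exact Sym2.mem_mk_left x y)
        (by rw [hj]; exact Sym2.mem_mk_left x z)
      subst hij
      rw [hy] at hj
      exact (Sym2.congr_right.1 hj).symm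
    · have hinj : Function.Injective e := by
        intro i j hij
        obtain ⟨x, hx⟩ : ∃ x, x ∈ e i := ⟨_, (e i).out_fst_mem⟩
        exact hd i j x hx (hij ▸ hx)
      rw [← Nat.card_eq_fintype_card, ← Set.ncard_range_of_injective hinj]
      refine Set.ncard_le_ncard ?_ (Set.toFinite _)
      rintro _ ⟨i, rfl⟩
      induction h : e i using Sym2.ind with
      | _ x y => exact ⟨i, h⟩

namespace DisjointPathsInstance

variable {V ι : Type*} {I : DisjointPathsInstance V ι} {A B : Set V}

theorem crossGraph_isBipartite (hAB : IsCompl A B) : (I.crossGraph A B).IsBipartite := by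
  classical
  have hc : ∀ x, x ∈ B ↔ x ∉ A := fun x => by rw [← hAB.compl_eq]; rfl
  refine ⟨SimpleGraph.Coloring.mk (fun v => if v ∈ A then 0 else 1) ?_⟩
  rintro u v ⟨-, h1, h2, -⟩
  rw [hc, hc] at h2
  by_cases hu : u ∈ A <;> by_cases hv : v ∈ A <;> simp_all

/-- One of `s i` and `t i` lies in the clique of `u`. That one is adjacent to `u` in the original
graph but not in the cross graph, so either statement says that `u` is adjacent to the other
terminal. -/
theorem crossGraph_adj_terminal (hAB : IsCompl A B) (hA : I.G.IsClique A) (hB : I.G.IsClique B) {i : ι}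
    (hi : I.Active i) {u : V} (hu : ¬ I.IsTerminal u) :
    ((I.crossGraph A B).Adj u (I.s i) ∨ (I.crossGraph A B).Adj u (I.t i)) ↔
      I.G.Adj u (I.s i) ∧ I.G.Adj u (I.t i) := by
  have hc : ∀ x, x ∈ B ↔ x ∉ A := fun x => by rw [← hAB.compl_eq]; rfl
  have hs : u ≠ I.s i := fun e => hu ⟨i, Or.inl e⟩
  have ht : u ≠ I.t i := fun e => hu ⟨i, Or.inr e⟩
  simp only [crossGraph, hu, false_and, not_false_iff, and_true]
  rcases sides hAB hA hB hi.1 hi.2 with ⟨h1, h2, h3, h4⟩ | ⟨h1, h2, h3, h4⟩ <;> by_cases huA : u ∈ A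
  · have := hA huA h1 hs
    have h5 := (hc u).not_left.2 huA
    simp [h1, h2, h3, h4, huA, h5, this]
  · have h5 := (hc u).2 huA
    have := hB h5 h3 ht
    simp [h1, h2, h3, h4, huA, h5, this]
  · have h5 := (hc u).not_left.2 huA
    have := hA huA h3 ht
    simp [h1, h2, h3, h4, huA, h5, this]
  · have h5 := (hc u).2 huA
    have := hB h5 h1 hs
    simp [h1, h2, h3, h4, huA, h5, this]

/-- A link with `p i = q i` becomes an edge at the new vertex `i`, and a crossing edge stays itself.
In the other direction a matching edge at the new vertex `j` need not carry the index `j`;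
`exists_distribution` rearranges the indices. -/
theorem isYes_iff_exists_isMatching [Finite V] [Fintype ι] (hAB : IsCompl A B) (hA : I.G.IsClique A)
    (hB : I.G.IsClique B) (hI : ∀ i, I.Active i) :
    I.IsYes ↔ ∃ M : (I.matchingGraph A B).Subgraph, M.IsMatching ∧ Fintype.card ι ≤ M.edgeSet.ncard := by
  classical
  have hc : ∀ x, x ∈ B ↔ x ∉ A := fun x => by rw [← hAB.compl_eq]; rfl
  rw [isYes_iff_exists_isLinkage hAB hA hB, SimpleGraph.exists_isMatching_iff]
  constructor
  · rintro ⟨p, q, h⟩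
    have key : ∀ i, ∃ e ∈ (I.matchingGraph A B).edgeSet, ∀ x ∈ e,
        x = .inl ⟨p i, h.left i (hI i)⟩ ∨ (p i ≠ q i ∧ x = .inl ⟨q i, h.right i (hI i)⟩) ∨
        x = .inr i := by
      intro i
      rcases h.links i (hI i) with ⟨-, h2⟩ | ⟨h1, h2, h3⟩
      · exact ⟨s(.inl ⟨p i, h.left i (hI i)⟩, .inr i),
          (crossGraph_adj_terminal hAB hA hB (hI i) (h.left i (hI i))).2 h2, by simp⟩
      · refine ⟨s(.inl ⟨p i, h.left i (hI i)⟩, .inl ⟨q i, h.right i (hI i)⟩),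
          ⟨h3, fun e => (hc _).1 h2 e.2, fun e => (hc _).1 e.1 h1, fun e => h.left i (hI i) e.1⟩, ?_⟩
        have := h3.ne
        simp; tauto
    choose e he hx using key
    refine ⟨e, he, fun i j x hxi hxj => ?_⟩
    by_contra hij
    have h1 := h.disjoint i j (hI i) (hI j) hij
    have h2 := h.disjoint j i (hI j) (hI i) (Ne.symm hij)
    rcases hx i x hxi with rfl | ⟨-, rfl⟩ | rfl <;> rcases hx j _ hxj with e | ⟨-, e⟩ | e <;> simp at e
    · exact h1.1 e
    · exact h1.2.1 e
    · exact h2.2.1 e.symm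
    · exact h1.2.2 e
    · exact hij e
  · rintro ⟨e, he, hd⟩
    -- Each edge is oriented so that its first end is a nonterminal, and one in `A` if both ends are
    -- nonterminals. This is possible since no edge joins two new vertices.
    have key : ∀ i, ∃ u : {v // ¬ I.IsTerminal v}, ∃ y : {v // ¬ I.IsTerminal v} ⊕ ι,
        e i = s(.inl u, y) ∧ (∀ v, y = .inl v → u.1 ∈ A ∧ v.1 ∈ B ∧ I.G.Adj u v) ∧
        (∀ j, y = .inr j → I.G.Adj u (I.s j) ∧ I.G.Adj u (I.t j)) := by
      intro i
      have h := he i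
      induction hxy : e i using Sym2.ind with
      | _ x y =>
        rw [hxy, SimpleGraph.mem_edgeSet] at h
        rcases x with u | j <;> rcases y with v | k
        · obtain ⟨h1, h2, h3, -⟩ := h
          rw [hc, hc] at h3
          by_cases hu : u.1 ∈ A
          · refine ⟨u, .inl v, rfl, ?_, by simp⟩
            rintro _ ⟨⟩
            exact ⟨hu, (hc _).2 fun hv => h2 ⟨hu, hv⟩, h1⟩
          · refine ⟨v, .inl u, Sym2.eq_swap, ?_, by simp⟩
            rintro _ ⟨⟩
            exact ⟨by_contra fun hv => h3 ⟨hu, hv⟩, (hc _).2 hu, h1.symm⟩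
        · refine ⟨u, .inr k, rfl, by simp, ?_⟩
          rintro _ ⟨⟩
          exact (crossGraph_adj_terminal hAB hA hB (hI k) u.2).1 h
        · refine ⟨v, .inr j, Sym2.eq_swap, by simp, ?_⟩
          rintro _ ⟨⟩
          exact (crossGraph_adj_terminal hAB hA hB (hI j) v.2).1 h
        · exact absurd h id
    choose a b hab hR hC using key
    have ha : ∀ i, .inl (a i) ∈ e i := fun i => by rw [hab]; exact Sym2.mem_mk_left _ _
    have hb : ∀ i, b i ∈ e i := fun i => by rw [hab]; exact Sym2.mem_mk_right _ _
    obtain ⟨p, q, h2, h3⟩ := exists_distribution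
      (R := fun u v : {v // ¬ I.IsTerminal v} => u.1 ∈ A ∧ v.1 ∈ B ∧ I.G.Adj u v)
      (C := fun j (u : {v // ¬ I.IsTerminal v}) => I.G.Adj u (I.s j) ∧ I.G.Adj u (I.t j)) a b hR hC
      (fun i j hij => hd i j _ (ha i) (hij ▸ ha j)) (fun i j hij => hd i j _ (hb i) (hij ▸ hb j))
      (fun i j hij => by
        obtain rfl := hd i j _ (hb i) (hij ▸ ha j)
        have := he i
        rw [hab, hij] at this
        exact (SimpleGraph.mem_edgeSet _ |>.1 this).ne rfl)
    refine ⟨fun i => p i, fun i => q i, fun i _ => (p i).2, fun i _ => (q i).2, fun i _ => ?_,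
      fun i j _ _ hij => ?_⟩
    · exact (h2 i).imp (fun h => ⟨congrArg Subtype.val h.1, h.2⟩) id
    · have := h3 i j hij
      exact ⟨fun e => this.1 (Subtype.ext e), fun e => this.2.1 (Subtype.ext e),
        fun e => this.2.2 (Subtype.ext e)⟩

end DisjointPathsInstance

/-! ### Counting with padding vertices: perfect matchings and linkages -/

theorem HasPM.of_pairs {V α : Type*} [DecidableEq V] {E : V → V → Prop} (T : Finset α) {a b : α → V}
    (hE : ∀ i, E (a i) (b i) ∧ E (b i) (a i)) (ha : a.Injective) (hb : b.Injective)
    (hab : ∀ i j, a i ≠ b j) : HasPM E (T.image a ∪ T.image b) := by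
  classical
  induction T using Finset.induction_on with
  | empty => simpa using HasPM.empty
  | insert i T hi ih =>
    refine ih.insert_pair (hE i).1 (hE i).2 (hab i i) ?_ ?_ fun v => ?_
    · simp only [Finset.mem_union, Finset.mem_image, not_or, not_exists, not_and]
      exact ⟨fun j hj e => hi (ha e ▸ hj), fun j _ e => hab i j e.symm⟩
    · simp only [Finset.mem_union, Finset.mem_image, not_or, not_exists, not_and]
      exact ⟨fun j _ e => hab j i e, fun j hj e => hi (hb e ▸ hj)⟩
    · simp only [Finset.mem_union, Finset.mem_image, Finset.mem_insert, exists_eq_or_imp,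
        eq_comm (a := v)]
      grind

namespace Layout
variable {L : Layout}

/-- `u` and `v` are adjacent nonterminals of the colours `1` and `2`. -/
def Cross (L : Layout) (u v : ℕ) : Prop := L.Nt u ∧ L.Nt v ∧ L.c u = 1 ∧ L.c v = 2 ∧ L.G u v

/-- `u` is a common neighbour of `s i` and `t i`. -/
def Common (L : Layout) (i u : ℕ) : Prop := L.Nt u ∧ L.G u (L.s i) ∧ L.G u (L.t i)

/-- The active pairs can be linked disjointly. -/
def Linked (L : Layout) : Prop := ∃ p q : {i // L.Act i} → ℕ,
  (∀ i, (p i = q i ∧ L.Common i (p i)) ∨ L.Cross (p i) (q i)) ∧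
  ∀ i j, i ≠ j → p i ≠ p j ∧ p i ≠ q j ∧ q i ≠ q j

theorem finite_act : Finite {i // L.Act i} :=
  Set.Finite.subset (Set.finite_Iio L.k) fun _ hi => hi.1

theorem WF.ne_of_act (hL : L.WF) {i j : ℕ} (hi : L.Act i) (hj : L.Act j) : L.s i ≠ L.t j := fun h => by
  obtain rfl := hL.st i hi.1 j hj.1 h
  exact hi.2.1 h

theorem WF.edge_t (hL : L.WF) {i v : ℕ} (hi : L.Act i) (h : L.Edge (L.t i) v) : L.Pad v := by
  rcases h with h | ⟨-, h, -⟩ | ⟨-, j, hj, h, -⟩ | ⟨h, -⟩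
  · exact absurd h (hL.not_half_t hi)
  · exact absurd rfl (h.ne_t hi)
  · exact absurd h (hL.ne_of_act hj hi)
  · exact h

theorem WF.edge_s (hL : L.WF) {i v : ℕ} (hi : L.Act i) (h : L.Edge v (L.s i)) (hv : ¬ L.Pad v) :
    L.Common i v := by
  rcases h with (⟨-, h, -⟩ | ⟨h, j, hj, h', h''⟩ | ⟨h, -⟩) | h
  · exact absurd rfl (h.ne_s hi)
  · obtain rfl := hL.ss j hj.1 i hi.1 h'
    exact ⟨h, h''⟩
  · exact absurd h hv
  · exact absurd h (hL.not_half_s hi)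

theorem cross_of_edge (hsymm : ∀ u v, L.G u v → L.G v u) (hc : RAM.Main.IsColouring L.n L.G L.c)
    {u v : ℕ} (hu : L.Nt u) (hv : L.Nt v) (h : L.Edge u v) : L.Cross u v ∨ L.Cross v u := by
  have key : L.c u ≠ L.c v ∧ L.G u v := by
    rcases h with (h | ⟨-, i, hi, h, -⟩ | ⟨h, -⟩) | (h | ⟨-, i, hi, h, -⟩ | ⟨h, -⟩)
    · exact h.2.2
    · exact absurd h (hv.ne_s hi)
    · exact absurd h hu.not_pad
    · exact ⟨h.2.2.1.symm, hsymm _ _ h.2.2.2⟩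
    · exact absurd h (hu.ne_s hi)
    · exact absurd h hv.not_pad
  have h1 := hc.1 u hu.1
  have h2 := hc.1 v hv.1
  rcases h1 with h1 | h1
  · exact Or.inl ⟨hu, hv, h1, by omega, key.2⟩
  · exact Or.inr ⟨hv, hu, by omega, h1, hsymm _ _ key.2⟩

section Counting
open scoped Classical
variable {S : Finset ℕ}

theorem card_filter_pad (hS : ∀ v, v ∈ S ↔ L.Live v) : (S.filter L.Pad).card = (S.filter L.Nt).card := by
  rw [← Finset.card_image_of_injective (S.filter L.Nt) (add_left_injective L.n)]
  congr 1
  ext v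
  simp only [Finset.mem_filter, Finset.mem_image, hS]
  constructor
  · rintro ⟨-, h⟩
    exact ⟨v - L.n, ⟨Or.inl h.2, h.2⟩, Nat.sub_add_cancel h.1⟩
  · rintro ⟨u, ⟨-, h⟩, rfl⟩
    have : L.Pad (u + L.n) := ⟨by omega, by simpa using h⟩
    exact ⟨Or.inr (Or.inl this), this⟩

variable [Fintype {i // L.Act i}]

theorem WF.card_image_s (hL : L.WF) : (Finset.univ.image fun i : {i // L.Act i} => L.s i).card =
    Fintype.card {i // L.Act i} :=
  Finset.card_image_of_injective _ fun i j h => Subtype.ext (hL.ss i i.2.1 j j.2.1 h)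

theorem WF.card_image_t (hL : L.WF) : (Finset.univ.image fun i : {i // L.Act i} => L.t i).card =
    Fintype.card {i // L.Act i} :=
  Finset.card_image_of_injective _ fun i j h => Subtype.ext (hL.tt i i.2.1 j j.2.1 h)

/-- The `t i` use up as many padding vertices as there are active pairs. So too few are left for the
nonterminals and the `s i`, and at least one proper edge per active pair remains to be distributed.
-/
theorem linked_of_isPM (hL : L.WF) (hsymm : ∀ u v, L.G u v → L.G v u)
    (hc : RAM.Main.IsColouring L.n L.G L.c) (hS : ∀ v, v ∈ S ↔ L.Live v) {μ : ℕ → ℕ}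
    (hμ : IsPM L.Edge S μ) : L.Linked := by
  set X := Finset.univ.image fun i : {i // L.Act i} => L.s i with hX
  set Y := Finset.univ.image fun i : {i // L.Act i} => L.t i with hY
  have hXS : ∀ v ∈ X, v ∈ S ∧ ∃ i, L.Act i ∧ L.s i = v := by
    intro v hv
    obtain ⟨i, -, rfl⟩ := Finset.mem_image.1 hv
    exact ⟨(hS _).2 (Or.inr (Or.inr ⟨i, i.2, Or.inl rfl⟩)), i, i.2, rfl⟩
  have hYS : ∀ v ∈ Y, v ∈ S ∧ ∃ i, L.Act i ∧ L.t i = v := by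
    intro v hv
    obtain ⟨i, -, rfl⟩ := Finset.mem_image.1 hv
    exact ⟨(hS _).2 (Or.inr (Or.inr ⟨i, i.2, Or.inr rfl⟩)), i, i.2, rfl⟩
  -- `R` contains one end of every matching edge between vertices that are not padding: the
  -- nonterminal if the other end is some `s i`, and the end of colour `1` if both are nonterminals.
  set R := S.filter fun v => L.Nt v ∧ ((∃ i, L.Act i ∧ L.s i = μ v) ∨ L.Cross v (μ v)) with hR
  set Z := S.filter fun v => (L.Nt v ∨ v ∈ X) ∧ L.Pad (μ v) with hZ
  have hcover : S.filter L.Nt ∪ X ⊆ (R ∪ R.image μ) ∪ Z := by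
    intro v hv
    have hv' : v ∈ S ∧ (L.Nt v ∨ v ∈ X) := by
      rcases Finset.mem_union.1 hv with hv | hv
      · rw [Finset.mem_filter] at hv
        exact ⟨hv.1, Or.inl hv.2⟩
      · exact ⟨(hXS v hv).1, Or.inr hv⟩
    obtain ⟨h1, h2, h3⟩ := hμ v hv'.1
    by_cases hp : L.Pad (μ v)
    · exact Finset.mem_union_right _ (Finset.mem_filter.2 ⟨hv'.1, hv'.2, hp⟩)
    apply Finset.mem_union_left
    rcases hv'.2 with hnt | hx
    · rcases (hS _).1 h1 with h | h | ⟨i, hi, h | h⟩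
      · rcases cross_of_edge hsymm hc hnt h h2 with h' | h'
        · exact Finset.mem_union_left _ (Finset.mem_filter.2 ⟨hv'.1, hnt, Or.inr h'⟩)
        · refine Finset.mem_union_right _ (Finset.mem_image.2 ⟨μ v, Finset.mem_filter.2 ⟨h1, h, ?_⟩, h3⟩)
          rw [h3]
          exact Or.inr h'
      · exact absurd h hp
      · exact Finset.mem_union_left _ (Finset.mem_filter.2 ⟨hv'.1, hnt, Or.inl ⟨i, hi, h⟩⟩)
      · rw [← h] at h2
        exact absurd (hL.edge_t hi h2.symm) hnt.not_pad
    · obtain ⟨-, i, hi, rfl⟩ := hXS v hx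
      have := hL.edge_s hi h2.symm hp
      refine Finset.mem_union_right _ (Finset.mem_image.2 ⟨_, Finset.mem_filter.2 ⟨h1, this.1, ?_⟩, h3⟩)
      rw [h3]
      exact Or.inl ⟨i, hi, rfl⟩
  have hpads : (Z ∪ Y).image μ ⊆ S.filter L.Pad := by
    intro w hw
    obtain ⟨v, hv, rfl⟩ := Finset.mem_image.1 hw
    rcases Finset.mem_union.1 hv with hv | hv
    · rw [Finset.mem_filter] at hv
      exact Finset.mem_filter.2 ⟨(hμ v hv.1).1, hv.2.2⟩
    · obtain ⟨h1, i, hi, rfl⟩ := hYS v hv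
      exact Finset.mem_filter.2 ⟨(hμ _ h1).1, hL.edge_t hi (hμ _ h1).2.1⟩
  have hinj : Set.InjOn μ (Z ∪ Y : Finset ℕ) := hμ.injOn.mono fun v hv => by
    rcases Finset.mem_union.1 hv with hv | hv
    · exact (Finset.mem_filter.1 hv).1
    · exact (hYS v hv).1
  have hZY : Disjoint Z Y := by
    rw [Finset.disjoint_left]
    intro v hz hy
    obtain ⟨-, i, hi, rfl⟩ := hYS v hy
    rcases (Finset.mem_filter.1 hz).2.1 with h | h
    · exact h.ne_t hi rfl
    · obtain ⟨-, j, hj, h⟩ := hXS _ h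
      exact hL.ne_of_act hj hi h
  have hNX : Disjoint (S.filter L.Nt) X := by
    rw [Finset.disjoint_left]
    intro v hv hx
    obtain ⟨-, i, hi, rfl⟩ := hXS v hx
    exact (Finset.mem_filter.1 hv).2.ne_s hi rfl
  have c1 := Finset.card_le_card hcover
  have c2 := Finset.card_le_card hpads
  have c3 := Finset.card_union_le (R ∪ R.image μ) Z
  have c4 := Finset.card_union_le R (R.image μ)
  have c5 := Finset.card_image_le (s := R) (f := μ)
  rw [Finset.card_union_of_disjoint hNX, hX, hL.card_image_s] at c1
  rw [Finset.card_image_of_injOn hinj, Finset.card_union_of_disjoint hZY, card_filter_pad hS, hY,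
    hL.card_image_t] at c2
  -- With `m` nonterminals and `k` active pairs, the covering gives `m + k ≤ 2 |R| + |Z|`, and the
  -- padding vertices give `|Z| + k ≤ m`. Hence `k ≤ |R|`.
  have hcard : Fintype.card {i // L.Act i} ≤ Fintype.card R := by rw [Fintype.card_coe]; omega
  obtain ⟨f⟩ := Function.Embedding.nonempty_of_card_le hcard
  have hf : ∀ i : {i // L.Act i}, (f i : ℕ) ∈ S ∧ L.Nt (f i) ∧ ((∃ j, L.Act j ∧ L.s j = μ (f i)) ∨
      L.Cross (f i) (μ (f i))) := fun i => Finset.mem_filter.1 (f i).2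
  have hb : ∀ i : {i // L.Act i}, ∃ y : ℕ ⊕ {i // L.Act i}, (y = .inl (μ (f i)) ∧ L.Cross (f i) (μ (f i))) ∨
      ∃ j, y = .inr j ∧ L.s j = μ (f i) := by
    intro i
    rcases (hf i).2.2 with ⟨j, hj, h⟩ | h
    · exact ⟨.inr ⟨j, hj⟩, Or.inr ⟨_, rfl, h⟩⟩
    · exact ⟨_, Or.inl ⟨rfl, h⟩⟩
  choose b hb using hb
  refine exists_distribution (R := L.Cross) (C := fun i : {i // L.Act i} => L.Common i)
    (fun i => (f i : ℕ)) b (fun i v hv => ?_)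
    (fun i j hj => ?_) (fun i j h => f.injective (Subtype.ext h)) (fun i j h => ?_) (fun i j h => ?_)
  · rcases hb i with ⟨h1, h2⟩ | ⟨j, h1, -⟩
    · rw [hv, Sum.inl.injEq] at h1
      rwa [h1]
    · simp [hv] at h1
  · rcases hb i with ⟨h1, -⟩ | ⟨j', h1, h2⟩
    · simp [hj] at h1
    · rw [hj, Sum.inr.injEq] at h1
      subst h1
      exact hL.edge_s j.2 (h2 ▸ (hμ _ (hf i).1).2.1) (hf i).2.1.not_pad
  · have : μ (f i) = μ (f j) := by
      rcases hb i with ⟨h1, -⟩ | ⟨j', h1, h2⟩ <;> rcases hb j with ⟨h3, -⟩ | ⟨j'', h3, h4⟩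
      · rw [h1, h3, Sum.inl.injEq] at h
        exact h
      · simp [h1, h3] at h
      · simp [h1, h3] at h
      · rw [h1, h3, Sum.inr.injEq] at h
        rw [← h2, ← h4, h]
    exact f.injective (Subtype.ext (hμ.injOn (hf i).1 (hf j).1 this))
  -- A second end that is a nonterminal has colour `2` and is matched to a nonterminal of colour
  -- `1`, so it is not in `R`.
  · rcases hb i with ⟨h1, h2⟩ | ⟨j', h1, -⟩
    · rw [h, Sum.inl.injEq] at h1
      rw [← h1] at h2
      have h3 : μ (f j) = f i := by rw [h1, (hμ _ (hf i).1).2.2]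
      rcases (hf j).2.2 with ⟨l, hl, h4⟩ | h4
      · exact h2.1.ne_s hl (h4.trans h3)
      · have := h2.2.2.2.1
        have := h4.2.2.1
        omega
    · simp [h] at h1

/-- The links give `k` disjoint edges, with `s i` as the second end for a common neighbour. Of the
`m + 2 k` vertices that are not padding, `m` are left over, and these can be matched arbitrarily to
the `m` padding vertices. -/
theorem hasPM_of_linked (hL : L.WF) (hS : ∀ v, v ∈ S ↔ L.Live v) (h : L.Linked) :
    HasPM L.Edge S := by
  obtain ⟨p, q, hpq, hd⟩ := h
  have hq : ∀ i : {i // L.Act i}, ∃ y, (y = L.s i ∧ p i = q i ∧ L.Common i (p i)) ∨ (y = q i ∧ L.Cross (p i) (q i)) := by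
    intro i
    rcases hpq i with h | h
    · exact ⟨_, Or.inl ⟨rfl, h⟩⟩
    · exact ⟨_, Or.inr ⟨rfl, h⟩⟩
  choose b hb using hq
  have hp : ∀ i, L.Nt (p i) := fun i => by
    rcases hpq i with h | h
    · exact h.2.1
    · exact h.1
  have hpinj : p.Injective := fun i j e => by_contra fun hij => (hd i j hij).1 e
  have hbinj : b.Injective := by
    intro i j e
    by_contra hij
    rcases hb i with ⟨h1, -⟩ | ⟨h1, h2⟩ <;> rcases hb j with ⟨h3, -⟩ | ⟨h3, h4⟩
    · exact hij (Subtype.ext (hL.ss i i.2.1 j j.2.1 (by rw [← h1, ← h3, e])))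
    · exact h4.2.1.ne_s i.2 (by rw [← h1, ← h3, e])
    · exact h2.2.1.ne_s j.2 (by rw [← h1, ← h3, e])
    · exact (hd i j hij).2.2 (by rw [← h1, ← h3, e])
  have hpb : ∀ i j, p i ≠ b j := by
    intro i j e
    rcases hb j with ⟨h1, -⟩ | ⟨h1, h2⟩
    · exact (hp i).ne_s j.2 (by rw [e, h1])
    · by_cases hij : i = j
      · subst hij
        have h3 := h2.2.2.1
        have h4 := h2.2.2.2.1
        rw [← h1, ← e] at h4
        omega
      · exact (hd i j hij).2.1 (by rw [e, h1])
  have hE : ∀ i, L.Edge (p i) (b i) := by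
    intro i
    rcases hb i with ⟨h1, -, h2⟩ | ⟨h1, h2⟩
    · exact Or.inl (Or.inr (Or.inl ⟨h2.1, i, i.2, h1.symm, h2.2⟩))
    · rw [h1]
      exact Or.inl (Or.inl ⟨h2.1, h2.2.1, by rw [h2.2.2.1, h2.2.2.2.1]; decide, h2.2.2.2.2⟩)
  set D := Finset.univ.image p ∪ Finset.univ.image b with hD
  have hDpm : HasPM L.Edge D := HasPM.of_pairs _ (fun i => ⟨hE i, (hE i).symm⟩) hpinj hbinj hpb
  have hDcard : D.card = 2 * Fintype.card {i // L.Act i} := by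
    rw [hD, Finset.card_union_of_disjoint, Finset.card_image_of_injective _ hpinj,
      Finset.card_image_of_injective _ hbinj, Finset.card_univ, two_mul]
    rw [Finset.disjoint_left]
    intro v h1 h2
    obtain ⟨i, -, rfl⟩ := Finset.mem_image.1 h1
    obtain ⟨j, -, h⟩ := Finset.mem_image.1 h2
    exact hpb i j h.symm
  have hDS : D ⊆ S.filter fun v => ¬ L.Pad v := by
    intro v hv
    rw [Finset.mem_filter, hS]
    rcases Finset.mem_union.1 hv with hv | hv <;> obtain ⟨i, -, rfl⟩ := Finset.mem_image.1 hv
    · exact ⟨Or.inl (hp i), (hp i).not_pad⟩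
    · rcases hb i with ⟨h1, -⟩ | ⟨h1, h2⟩ <;> rw [h1]
      · exact ⟨Or.inr (Or.inr ⟨i, i.2, Or.inl rfl⟩), hL.not_pad_s i.2⟩
      · exact ⟨Or.inl h2.2.1, h2.2.1.not_pad⟩
  have hcard : (S.filter fun v => ¬ L.Pad v).card =
      (S.filter L.Pad).card + 2 * Fintype.card {i // L.Act i} := by
    have : S.filter (fun v => ¬ L.Pad v) = S.filter L.Nt ∪
        (Finset.univ.image (fun i : {i // L.Act i} => L.s i) ∪
        Finset.univ.image fun i : {i // L.Act i} => L.t i) := by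
      ext v
      simp only [Finset.mem_filter, Finset.mem_union, Finset.mem_image, Finset.mem_univ, true_and, hS]
      constructor
      · rintro ⟨h | h | ⟨i, hi, h | h⟩, h'⟩
        · exact Or.inl ⟨Or.inl h, h⟩
        · exact absurd h h'
        · exact Or.inr (Or.inl ⟨⟨i, hi⟩, h⟩)
        · exact Or.inr (Or.inr ⟨⟨i, hi⟩, h⟩)
      · rintro (⟨h, h'⟩ | ⟨i, rfl⟩ | ⟨i, rfl⟩)
        · exact ⟨h, h'.not_pad⟩
        · exact ⟨Or.inr (Or.inr ⟨i, i.2, Or.inl rfl⟩), hL.not_pad_s i.2⟩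
        · exact ⟨Or.inr (Or.inr ⟨i, i.2, Or.inr rfl⟩), hL.not_pad_t i.2⟩
    rw [this, Finset.card_union_of_disjoint, Finset.card_union_of_disjoint, hL.card_image_s,
      hL.card_image_t, card_filter_pad hS, two_mul]
    · rw [Finset.disjoint_left]
      intro v h1 h2
      obtain ⟨i, -, rfl⟩ := Finset.mem_image.1 h1
      obtain ⟨j, -, h⟩ := Finset.mem_image.1 h2
      exact hL.ne_of_act i.2 j.2 h.symm
    · rw [Finset.disjoint_left]
      intro v h1 h2
      have h1 := (Finset.mem_filter.1 h1).2
      rcases Finset.mem_union.1 h2 with h2 | h2 <;> obtain ⟨i, -, h⟩ := Finset.mem_image.1 h2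
      · exact h1.ne_s i.2 h
      · exact h1.ne_t i.2 h
  have hrest : HasPM L.Edge (((S.filter fun v => ¬ L.Pad v) \ D) ∪ S.filter L.Pad) := by
    refine HasPM.of_card_eq ?_ ?_ fun a ha b hb => ?_
    · rw [Finset.disjoint_left]
      intro v h1 h2
      exact (Finset.mem_filter.1 (Finset.mem_sdiff.1 h1).1).2 (Finset.mem_filter.1 h2).2
    · rw [Finset.card_sdiff_of_subset hDS]
      omega
    · have h1 := Finset.mem_filter.1 (Finset.mem_sdiff.1 ha).1
      have h2 := Finset.mem_filter.1 hb
      have : L.Edge b a := Or.inl (Or.inr (Or.inr ⟨h2.2, (hS _).1 h1.1, h1.2⟩))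
      exact ⟨this.symm, this⟩
  have hall := hDpm.union hrest (by
    rw [Finset.disjoint_left]
    intro v h1 h2
    rcases Finset.mem_union.1 h2 with h2 | h2
    · exact (Finset.mem_sdiff.1 h2).2 h1
    · exact (Finset.mem_filter.1 (hDS h1)).2 (Finset.mem_filter.1 h2).2)
  convert hall using 1
  ext v
  have hvD : v ∈ D → v ∈ S ∧ ¬ L.Pad v := fun h => Finset.mem_filter.1 (hDS h)
  simp only [Finset.mem_union, Finset.mem_sdiff, Finset.mem_filter]
  tauto

end Counting

theorem WF.hasPM_iff (hL : L.WF) (hsymm : ∀ u v, L.G u v → L.G v u)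
    (hc : RAM.Main.IsColouring L.n L.G L.c) {S : Finset ℕ} (hS : ∀ v, v ∈ S ↔ L.Live v) :
    HasPM L.Edge S ↔ L.Linked := by
  have := L.finite_act
  have := Fintype.ofFinite {i // L.Act i}
  exact ⟨fun ⟨_, hμ⟩ => linked_of_isPM hL hsymm hc hS hμ, hasPM_of_linked hL hS⟩

end Layout

/-! ### Instances in numerical form, and the algorithmic statement -/

namespace DisjointPathsInstance

variable {n k : ℕ} (I : DisjointPathsInstance (Fin n) (Fin k)) (c : ℕ → ℕ)

/-- The numerical description of an instance together with a colouring. -/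
def layout : Layout where
  n := n
  k := k
  s := fun i => if h : i < k then I.s ⟨i, h⟩ else 0
  t := fun i => if h : i < k then I.t ⟨i, h⟩ else 0
  G := fun u v => ∃ (hu : u < n) (hv : v < n), I.G.Adj ⟨u, hu⟩ ⟨v, hv⟩
  c := c

variable {I c}

theorem layout_s (i : Fin k) : (I.layout c).s i = I.s i := by simp [layout]
theorem layout_t (i : Fin k) : (I.layout c).t i = I.t i := by simp [layout]

theorem layout_G (u v : Fin n) : (I.layout c).G u v ↔ I.G.Adj u v := by simp [layout]

theorem layout_wf : (I.layout c).WF := by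
  refine ⟨fun i hi => ?_, fun i hi => ?_, fun i hi j hj h => ?_, fun i hi j hj h => ?_,
    fun i hi j hj h => ?_⟩ <;> lift i to Fin k using hi
  · rw [layout_s]; exact (I.s i).2
  · rw [layout_t]; exact (I.t i).2
  all_goals
    lift j to Fin k using hj
    simp only [layout_s, layout_t, Fin.val_inj] at h
    by_contra hij
    have := I.terminal_ne (i := i) (j := j) (fun e => hij (congrArg Fin.val e))
    tauto

theorem layout_act (i : Fin k) : (I.layout c).Act i ↔ I.Active i := by
  have : (i : ℕ) < (I.layout c).k := i.2
  rw [Layout.Act, layout_s, layout_t, layout_G, Active, ne_eq, ne_eq, Fin.val_inj]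
  exact and_iff_right this

theorem layout_nt (v : Fin n) : (I.layout c).Nt v ↔ ¬ I.IsTerminal v := by
  have hv : (v : ℕ) < (I.layout c).n := v.2
  simp only [Layout.Nt, hv, true_and, IsTerminal, not_exists, not_or]
  constructor
  · intro h i
    have := h i i.2
    rw [layout_s, layout_t, ne_eq, ne_eq, Fin.val_inj, Fin.val_inj] at this
    exact ⟨fun e => this.1 e.symm, fun e => this.2 e.symm⟩
  · intro h i hi
    lift i to Fin k using hi
    rw [layout_s, layout_t, ne_eq, ne_eq, Fin.val_inj, Fin.val_inj]
    exact ⟨fun e => (h i).1 e.symm, fun e => (h i).2 e.symm⟩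

/-- The colour classes are complementary cliques, so the description by linkages applies with the
vertices of colour `1` as `A`. -/
theorem isYes_iff_linked (hc : RAM.Main.IsColouring n (I.layout c).G c) :
    I.IsYes ↔ (I.layout c).Linked := by
  classical
  set A : Set (Fin n) := {v | c v = 1} with hA
  have hcl : ∀ u v : Fin n, u ≠ v → c u = c v → I.G.Adj u v := fun u v huv h => by
    by_contra hadj
    exact hc.2 u u.2 v v.2 (fun e => huv (Fin.ext e)) (by rwa [layout_G]) h
  have h2 : ∀ v : Fin n, v ∈ Aᶜ ↔ c v = 2 := fun v => by
    have := hc.1 v v.2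
    simp only [hA, Set.mem_compl_iff, Set.mem_ofPred_eq]
    omega
  rw [isYes_iff_exists_isLinkage (isCompl_compl (x := A))
    (fun u hu v hv huv => hcl u v huv (hu.trans hv.symm))
    (fun u hu v hv huv => hcl u v huv (((h2 u).1 hu).trans ((h2 v).1 hv).symm))]
  constructor
  · rintro ⟨p, q, h⟩
    have hk : ∀ i : {i // (I.layout c).Act i}, i.1 < k := fun i => i.2.1
    have hact : ∀ i : {i // (I.layout c).Act i}, I.Active ⟨i, hk i⟩ := fun i => (layout_act _).1 i.2
    refine ⟨fun i => p ⟨i, hk i⟩, fun i => q ⟨i, hk i⟩, fun i => ?_, fun i j hij => ?_⟩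
    · have hp := (layout_nt (c := c) _).2 (h.left _ (hact i))
      have hq := (layout_nt (c := c) _).2 (h.right _ (hact i))
      have hs : (I.layout c).s i = I.s ⟨i, hk i⟩ := layout_s ⟨i, hk i⟩
      have ht : (I.layout c).t i = I.t ⟨i, hk i⟩ := layout_t ⟨i, hk i⟩
      rcases h.links _ (hact i) with ⟨e1, e2, e3⟩ | ⟨e1, e2, e3⟩
      · refine Or.inl ⟨congrArg Fin.val e1, hp, ?_, ?_⟩
        · rw [hs, layout_G]; exact e2
        · rw [ht, layout_G]; exact e3
      · exact Or.inr ⟨hp, hq, e1, (h2 _).1 e2, (layout_G _ _).2 e3⟩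
    · have := h.disjoint _ _ (hact i) (hact j) (fun e => hij (Subtype.ext (congrArg Fin.val e)))
      simp only [ne_eq, Fin.val_inj]
      exact this
  · rintro ⟨p, q, h, hd⟩
    have hlt : ∀ i, p i < n ∧ q i < n := fun i => by
      rcases h i with ⟨h1, h2, -⟩ | ⟨h1, h2, -⟩
      · exact ⟨h2.1, h1 ▸ h2.1⟩
      · exact ⟨h1.1, h2.1⟩
    -- A linkage asks nothing of inactive pairs, so any vertex may be assigned to them.
    refine ⟨fun i => if hi : (I.layout c).Act i then ⟨p ⟨i, hi⟩, (hlt _).1⟩ else I.s i,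
      fun i => if hi : (I.layout c).Act i then ⟨q ⟨i, hi⟩, (hlt _).2⟩ else I.s i,
      fun i hi => ?_, fun i hi => ?_, fun i hi => ?_, fun i j hi hj hij => ?_⟩
    · rw [← layout_act (c := c)] at hi
      rw [dif_pos hi, ← layout_nt (c := c)]
      rcases h ⟨i, hi⟩ with h | h
      · exact h.2.1
      · exact h.1
    · rw [← layout_act (c := c)] at hi
      rw [dif_pos hi, ← layout_nt (c := c)]
      rcases h ⟨i, hi⟩ with h | h
      · change (I.layout c).Nt (q ⟨i, hi⟩)
        exact h.1 ▸ h.2.1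
      · exact h.2.1
    · rw [← layout_act (c := c)] at hi
      rw [dif_pos hi, dif_pos hi]
      rcases h ⟨i, hi⟩ with ⟨e1, -, e2, e3⟩ | ⟨-, -, e1, e2, e3⟩
      · refine Or.inl ⟨Fin.ext e1, ?_, ?_⟩
        · rwa [← layout_G (c := c), ← layout_s (c := c)]
        · rwa [← layout_G (c := c), ← layout_t (c := c)]
      · exact Or.inr ⟨e1, (h2 _).2 e2, (layout_G (c := c) _ _).1 e3⟩
    · rw [← layout_act (c := c)] at hi hj
      simp only [dif_pos hi, dif_pos hj, ne_eq, Fin.mk.injEq]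
      exact hd _ _ fun e => hij (Fin.ext (congrArg Subtype.val e))

theorem layout_isCode : (I.layout c).IsCode I.encode := by
  classical
  set l₁ := List.ofFn fun i => (I.s i : ℕ) with hl₁
  set l₂ := List.ofFn fun i => (I.t i : ℕ) with hl₂
  set l₃ := List.ofFn fun p : Fin (n * n) => if I.G.Adj p.divNat p.modNat then 1 else 0 with hl₃
  have e1 : l₁.length = k := by simp [hl₁]
  have e2 : l₂.length = k := by simp [hl₂]
  have e3 : l₃.length = n * n := by simp [hl₃]
  have he : I.encode = n :: k :: (l₁ ++ (l₂ ++ l₃)) := by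
    simp [encode, hl₁, hl₂, hl₃]
  have hadd : ∀ m, I.encode.getD (2 + m) 0 = (l₁ ++ (l₂ ++ l₃)).getD m 0 := fun m => by
    rw [he, Nat.add_comm]; rfl
  refine ⟨?_, by rw [he]; rfl, by rw [he]; rfl, fun i hi => ?_, fun i hi => ?_, fun u hu v hv => ?_⟩
  · rw [he]
    simp only [List.length_cons, List.length_append, e1, e2, e3, layout]
    omega
  · lift i to Fin k using hi
    rw [hadd, List.getD_append _ _ _ _ (by rw [e1]; exact i.2), layout_s]
    simp [hl₁]
  · lift i to Fin k using hi
    have : (I.layout c).k = k := rfl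
    rw [hadd, this, List.getD_append_right _ _ _ _ (by omega), e1, Nat.add_sub_cancel_left,
      List.getD_append _ _ _ _ (by rw [e2]; exact i.2), layout_t]
    simp [hl₂]
  · have hn : (I.layout c).n = n := rfl
    have hk : (I.layout c).k = k := rfl
    rw [hn] at hu hv ⊢
    rw [hk]
    lift u to Fin n using hu
    lift v to Fin n using hv
    have h1 : (u : ℕ) * n + v < n * n := by
      have := Nat.mul_le_mul_right n u.2
      have := v.2
      rw [Nat.succ_mul] at *
      omega
    rw [show 2 + 2 * k + ((u : ℕ) * n + v) = 2 + (k + (k + (u * n + v))) by ring, hadd,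
      List.getD_append_right _ _ _ _ (by omega), e1, Nat.add_sub_cancel_left,
      List.getD_append_right _ _ _ _ (by omega), e2, Nat.add_sub_cancel_left, layout_G]
    have hd : (⟨u * n + v, h1⟩ : Fin (n * n)).divNat = u := by
      apply Fin.ext
      have := v.2
      rw [Fin.coe_divNat]
      dsimp only
      rw [Nat.mul_comm, Nat.mul_add_div (by omega), Nat.div_eq_of_lt v.2, Nat.add_zero]
    have hm : (⟨u * n + v, h1⟩ : Fin (n * n)).modNat = v := by
      apply Fin.ext
      rw [Fin.coe_modNat]
      dsimp only
      rw [Nat.mul_comm, Nat.mul_add_mod, Nat.mod_eq_of_lt v.2]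
    rw [List.getD_eq_getElem _ _ (by rw [e3]; exact h1)]
    simp [hl₃, hd, hm]

/-- The two colours of the complement are shifted by one, because the program reserves `0` for
uncoloured vertices. -/
theorem exists_isColouring (h : I.G.IsCobipartite) :
    ∃ c, RAM.Main.IsColouring n (I.layout c).G c := by
  obtain ⟨C⟩ := h
  refine ⟨fun v => if hv : v < n then (C ⟨v, hv⟩ : ℕ) + 1 else 0, fun v hv => ?_,
    fun u hu v hv huv hG => ?_⟩
  · have := (C ⟨v, hv⟩).2
    simp only [dif_pos hv]
    omega
  · lift u to Fin n using hu
    lift v to Fin n using hv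
    rw [layout_G] at hG
    have : C u ≠ C v := C.valid ((SimpleGraph.compl_adj _ _ _).2 ⟨fun e => huv (congrArg Fin.val e), hG⟩)
    simp only [Fin.is_lt, dif_pos]
    intro e
    exact this (Fin.ext (by simpa using e))

/-- Cobipartiteness supplies a colouring `c₀` that only guarantees the success of the colouring
step. The answer is then analysed with the colouring `c` found by the program, since being a
yes-instance does not depend on the choice of the cliques. -/
theorem polyTimeSolvableOn_isCobipartite : RAM.PolyTimeSolvableOn
    (α := Σ n : ℕ, Σ k : ℕ, DisjointPathsInstance (Fin n) (Fin k)) (fun x => x.2.2.encode)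
    (fun x => x.2.2.G.IsCobipartite) (fun x => x.2.2.IsYes) := by
  refine RAM.polyTimeSolvableOn_of_cmd _ _ _ RAM.Main.program ?_
  rintro ⟨n, k, I⟩ hI
  obtain ⟨c₀, hc₀⟩ := exists_isColouring hI
  have hsymm : ∀ c u v, (I.layout c).G u v → (I.layout c).G v u := by
    rintro c u v ⟨hu, hv, h⟩
    exact ⟨hv, hu, h.symm⟩
  obtain ⟨c, hc, S, hS, h1, h2⟩ := RAM.Main.program_spec (layout_wf (I := I) (c := c₀)) layout_isCode
    (fun u v ⟨hu, hv, _⟩ => ⟨hu, hv⟩) (hsymm c₀) hc₀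
  have key : I.IsYes ↔ HasPM (I.layout c).Edge S := by
    exact (isYes_iff_linked hc).trans ((layout_wf (I := I) (c := c)).hasPM_iff (hsymm c) hc hS).symm
  exact ⟨fun h => h1 (key.1 h), fun h => h2 fun h' => h (key.2 h')⟩

end DisjointPathsInstance

theorem mainTheorem9 :
    RAM.PolyTimeSolvableOn
      (α := Σ n : ℕ, Σ k : ℕ, DisjointPathsInstance (Fin n) (Fin k))
      (fun x => x.2.2.encode)
      (fun x => x.2.2.G.IsCobipartite)
      (fun x => x.2.2.IsYes) ∧
    ∀ (V ι : Type*) [Fintype V] [Fintype ι] (I : DisjointPathsInstance V ι) (A B : Set V),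
      IsCompl A B → I.G.IsClique A → I.G.IsClique B → (∀ i, I.s i ≠ I.t i) →
      (I.IsYes ↔ I.removeAdjacentPairs.IsYes) ∧
      ((∀ i, ¬ I.G.Adj (I.s i) (I.t i)) →
        (I.crossGraph A B).IsBipartite ∧
        (I.IsYes ↔ ∃ M : (I.matchingGraph A B).Subgraph,
          M.IsMatching ∧ Fintype.card ι ≤ M.edgeSet.ncard)) := by
  refine ⟨DisjointPathsInstance.polyTimeSolvableOn_isCobipartite, ?_⟩
  intro V ι _ _ I A B hAB hA hB hst
  exact ⟨DisjointPathsInstance.isYes_iff_removeAdjacentPairs hAB hA hB hst, fun hn =>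
    ⟨DisjointPathsInstance.crossGraph_isBipartite hAB,
      DisjointPathsInstance.isYes_iff_exists_isMatching hAB hA hB fun i => ⟨hst i, hn i⟩⟩⟩
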